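/- **Setting.** Let $t_0\ge 0$ and let $V_{\mathrm{const}}>0$. Identify functions on $\mathbb S^1$ with $2\pi$-periodic functions of $\theta$, and let $\alpha>0$, $\lambda$, $P$, $Q$, $G$, $H$, $\phi$ be smooth real functions of $(t,\theta)\in(t_0,\infty)\times\mathbb S^1$. On $(t_0,\infty)\times\mathbb T^3$, with coordinates $(t,\theta,x,y)$, consider the $\mathbb T^2$-symmetric metric $$g=t^{-1/2}e^{\lambda/2}\left(-dt^2+\alpha^{-1}d\theta^2\right)+te^{P}\left[dx+Q\,dy+(G+QH)\,d\theta\right]^2+te^{-P}\left(dy+H\,d\theta\right)^2 .$$ Assume that $(g,\phi)$ solves the Einstein non-linear scalar field equations with the constant potential $V=V_{\mathrm{const}}$: $$\operatorname{Ric}-\tfrac12 S g=T,\qquad T_{\alpha\beta}=\nabla_\alpha\phi\nabla_\beta\phi-\left[\tfrac12\nabla_\gamma\phi\nabla^\gamma\phi+V(\phi)\right]g_{\alpha\beta},\qquad \nabla^\alpha\nabla_\alpha\phi-V'(\phi)=0 .$$ Assume also that $g$ has $\lambda$-asymptotics with constant $V_{\mathrm{const}}$: for every $\varepsilon>0$ there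 is a $T>t_0$ such that $$\lambda(t,\theta)\ge -3\ln t+2\ln\frac{3}{4V_{\mathrm{const}}}-\varepsilon\qquad\text{for all }(t,\theta)\in[T,\infty)\times\mathbb S^1 .$$ Set $t_1=t_0+2$ and $\|f\|_{C^N}=\sum_{k=0}^N\sup_{\mathbb S^1}|\partial_\theta^kf|$. **Proposition (Asymptotic properties of the variables in the metric).** There are smooth functions $\alpha_\infty>0$, $P_\infty$, $Q_\infty$, $\phi_\infty$, $G_\infty$, $H_\infty$ on $\mathbb S^1$ and, for every integer $N\ge 0$, a constant $C_N$ such that for all $t\ge t_1$ $$\|P_t(t,\cdot)\|_{C^N}+\|Q_t(t,\cdot)\|_{C^N}+\|\phi_t(t,\cdot)\|_{C^N}\le C_Nt^{-2},$$ $$\|P(t,\cdot)-P_\infty\|_{C^N}+\|Q(t,\cdot)-Q_\infty\|_{C^N}+\|\phi(t,\cdot)-\phi_\infty\|_{C^N}\le C_Nt^{-1},$$ $$\left\|\frac{\alpha_t}{\alpha}+\frac3t\right\|_{C^N}+\left\|\lambda_t+\frac3t\right\|_{C^N}\le C_Nt^{-2},$$ $$\|t^3\alpha(t,\cdot)-\alpha_\infty\|_{C^N}+\left\|\lambda(t,\cdot)+3\ln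 t-2\ln\frac{3}{4V_{\mathrm{const}}}\right\|_{C^N}\le C_Nt^{-1},$$ $$t\|G_t(t,\cdot)\|_{C^N}+t\|H_t(t,\cdot)\|_{C^N}+\|G(t,\cdot)-G_\infty\|_{C^N}+\|H(t,\cdot)-H_\infty\|_{C^N}\le C_Nt^{-3/2}.$$ Moreover, let $\bar g(t,\cdot)$ and $\bar k(t,\cdot)$ be the metric and the second fundamental form (with respect to the future directed unit normal $n$, $\bar k(X,Y)=g(\nabla_Xn,Y)$) induced on $\{t\}\times\mathbb T^3$, with components $\bar g_{ij}$, $\bar k_{ij}$ with respect to $\partial_\theta,\partial_x,\partial_y$. Then, for all $t\ge t_1$ and all $i,j$, $$\|t^{-1}\bar g_{ij}(t,\cdot)-\bar g_{\infty,ij}\|_{C^N}+\|t^{-1}\bar k_{ij}(t,\cdot)-\mathcal H\,\bar g_{\infty,ij}\|_{C^N}\le C_Nt^{-1},$$ where $\mathcal H=(V_{\mathrm{const}}/3)^{1/2}$ and $$\bar g_\infty=\frac{3}{4V_{\mathrm{const}}\alpha_\infty}d\theta^2+e^{P_\infty}\left[dx+Q_\infty dy+(G_\infty+Q_\infty H_\infty)d\theta\right]^2+e^{-P_\infty}\left(dy+H_\infty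 d\theta\right)^2 .$$ -/

import Mathlib

open Set
open scoped ENNReal ContDiff

namespace T2Sym

noncomputable section

/-! ### Pseudo-Riemannian geometry in coordinates

A metric on an open subset of `ℝⁿ` is given by its matrix of components. -/

/-- The partial derivative `∂ᵢ f` at `p`. -/
def pd {n : ℕ} (i : Fin n) (f : (Fin n → ℝ) → ℝ) (p : Fin n → ℝ) : ℝ :=
  deriv (fun s => f (Function.update p i s)) (p i)

/-- Christoffel symbols `Γᵏᵢⱼ = ½ gᵏˡ (∂ᵢ gⱼₗ + ∂ⱼ gᵢₗ - ∂ₗ gᵢⱼ)` of the Levi-Civita connection. -/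
def christoffel {n : ℕ} (g : (Fin n → ℝ) → Matrix (Fin n) (Fin n) ℝ) (k i j : Fin n)
    (p : Fin n → ℝ) : ℝ :=
  (1 / 2) * ∑ l, (g p)⁻¹ k l *
    (pd i (fun q => g q j l) p + pd j (fun q => g q i l) p - pd l (fun q => g q i j) p)

/-- Ricci tensor
`Ricᵢⱼ = ∂ₖ Γᵏᵢⱼ - ∂ᵢ Γᵏₖⱼ + Γᵏₖₗ Γˡᵢⱼ - Γᵏᵢₗ Γˡₖⱼ`. -/
def ricci {n : ℕ} (g : (Fin n → ℝ) → Matrix (Fin n) (Fin n) ℝ) (i j : Fin n)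
    (p : Fin n → ℝ) : ℝ :=
  (∑ k, pd k (christoffel g k i j) p) - (∑ k, pd i (christoffel g k k j) p)
    + (∑ k, ∑ l, christoffel g k k l p * christoffel g l i j p)
    - (∑ k, ∑ l, christoffel g k i l p * christoffel g l k j p)

/-- Scalar curvature `S = gⁱʲ Ricᵢⱼ`. -/
def scalarCurvature {n : ℕ} (g : (Fin n → ℝ) → Matrix (Fin n) (Fin n) ℝ) (p : Fin n → ℝ) : ℝ :=
  ∑ i, ∑ j, (g p)⁻¹ i j * ricci g i j p

/-- Einstein tensor `Ein = Ric - ½ S g`. -/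
def einsteinTensor {n : ℕ} (g : (Fin n → ℝ) → Matrix (Fin n) (Fin n) ℝ) (i j : Fin n)
    (p : Fin n → ℝ) : ℝ :=
  ricci g i j p - (1 / 2) * scalarCurvature g p * g p i j

/-- The wave operator `∇ᵃ∇ₐ φ = gᵃᵇ (∂ₐ∂ᵦ φ - Γᶜₐᵦ ∂ᵪ φ)`. -/
def waveOperator {n : ℕ} (g : (Fin n → ℝ) → Matrix (Fin n) (Fin n) ℝ) (φ : (Fin n → ℝ) → ℝ)
    (p : Fin n → ℝ) : ℝ :=
  ∑ a, ∑ b, (g p)⁻¹ a b * (pd a (pd b φ) p - ∑ c, christoffel g c a b p * pd c φ p)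

/-! ### The Einstein non-linear scalar field equations -/

/-- Stress-energy tensor `Tᵢⱼ = ∂ᵢφ ∂ⱼφ - (½ ∂ₖφ ∂ᵏφ + V(φ)) gᵢⱼ` of a non-linear scalar field. -/
def stressEnergy {n : ℕ} (g : (Fin n → ℝ) → Matrix (Fin n) (Fin n) ℝ) (V : ℝ → ℝ)
    (φ : (Fin n → ℝ) → ℝ) (i j : Fin n) (p : Fin n → ℝ) : ℝ :=
  pd i φ p * pd j φ p
    - ((1 / 2) * (∑ a, ∑ b, (g p)⁻¹ a b * pd a φ p * pd b φ p) + V (φ p)) * g p i j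

/-- `(g, φ)` solves `Ein = T` and the equation of motion `∇ᵃ∇ₐφ = V'(φ)` at every point of `U`. -/
structure SolvesEinsteinScalarField {n : ℕ} (g : (Fin n → ℝ) → Matrix (Fin n) (Fin n) ℝ)
    (V : ℝ → ℝ) (φ : (Fin n → ℝ) → ℝ) (U : Set (Fin n → ℝ)) : Prop where
  einstein : ∀ p ∈ U, ∀ i j, einsteinTensor g i j p = stressEnergy g V φ i j p
  motion : ∀ p ∈ U, waveOperator g φ p - deriv V (φ p) = 0

/-! ### `T²`-symmetric metrics in areal time

Functions on `(t₀, ∞) × S¹` are functions of `(t, θ)` that are `2π`-periodic in `θ`. The coordinates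
`(t, θ, x, y)` of the spacetime have the indices `0, 1, 2, 3`. -/

/-- `f` is a smooth function on `S¹`. -/
def SmoothOnCircle (f : ℝ → ℝ) : Prop :=
  ContDiff ℝ ∞ f ∧ Function.Periodic f (2 * Real.pi)

/-- `f` is a smooth function on `(t₀, ∞) × S¹`. -/
def SmoothOnCylinder (t₀ : ℝ) (f : ℝ → ℝ → ℝ) : Prop :=
  ContDiffOn ℝ ∞ (fun z : ℝ × ℝ => f z.1 z.2) (Ioi t₀ ×ˢ univ) ∧
    ∀ t, t₀ < t → Function.Periodic (f t) (2 * Real.pi)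

/-- The functions `α, λ, P, Q, G, H` of `(t, θ)` in the metric, and the scalar field `φ`. -/
structure Fields where
  α : ℝ → ℝ → ℝ
  lam : ℝ → ℝ → ℝ
  P : ℝ → ℝ → ℝ
  Q : ℝ → ℝ → ℝ
  G : ℝ → ℝ → ℝ
  H : ℝ → ℝ → ℝ
  φ : ℝ → ℝ → ℝ

/-- The square `w ⊗ w` of the one-form with components `w`. -/
def formSq {n : ℕ} (w : Fin n → ℝ) : Matrix (Fin n) (Fin n) ℝ := Matrix.vecMulVec w w

/-- The metric
`t^{-1/2} e^{λ/2} (-dt² + α⁻¹ dθ²) + t e^P [dx + Q dy + (G + QH) dθ]² + t e^{-P} (dy + H dθ)²`. -/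
def Fields.metric (u : Fields) (p : Fin 4 → ℝ) : Matrix (Fin 4) (Fin 4) ℝ :=
  let t := p 0
  let θ := p 1
  (t ^ (-(1 / 2) : ℝ) * Real.exp (u.lam t θ / 2)) •
      (-formSq ![1, 0, 0, 0] + (u.α t θ)⁻¹ • formSq ![0, 1, 0, 0])
    + (t * Real.exp (u.P t θ)) • formSq ![0, u.G t θ + u.Q t θ * u.H t θ, 1, u.Q t θ]
    + (t * Real.exp (-u.P t θ)) • formSq ![0, u.H t θ, 0, 1]

/-- The fields `u` are smooth on `(t₀, ∞) × S¹` with `α > 0`, and the metric and the scalar field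
which they define on `(t₀, ∞) × T³` solve the Einstein non-linear scalar field equations with
potential `V`. -/
structure IsT2Solution (t₀ : ℝ) (V : ℝ → ℝ) (u : Fields) : Prop where
  smooth_α : SmoothOnCylinder t₀ u.α
  smooth_lam : SmoothOnCylinder t₀ u.lam
  smooth_P : SmoothOnCylinder t₀ u.P
  smooth_Q : SmoothOnCylinder t₀ u.Q
  smooth_G : SmoothOnCylinder t₀ u.G
  smooth_H : SmoothOnCylinder t₀ u.H
  smooth_φ : SmoothOnCylinder t₀ u.φ
  α_pos : ∀ t θ, t₀ < t → 0 < u.α t θ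
  solves : SolvesEinsteinScalarField u.metric V (fun p => u.φ (p 0) (p 1)) {p | t₀ < p 0}

/-- `λ`-asymptotics with constant `Va`, for a metric defined for all `t > t₀`. -/
def HasLambdaAsymptotics (t₀ Va : ℝ) (u : Fields) : Prop :=
  ∀ ε : ℝ, 0 < ε → ∃ T : ℝ, t₀ < T ∧ ∀ t θ : ℝ, T ≤ t →
    u.lam t θ ≥ -3 * Real.log t + 2 * Real.log (3 / (4 * Va)) - ε

/-! ### Geometry of the hypersurfaces `{t} × T³`

The coordinates `(θ, x, y)` have the indices `0, 1, 2` in `Fin 3` and thus `1, 2, 3` in `Fin 4`. -/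

/-- The components of the metric induced on the level sets of the coordinate `t`. -/
def inducedMetric (g : (Fin 4 → ℝ) → Matrix (Fin 4) (Fin 4) ℝ) (p : Fin 4 → ℝ) :
    Matrix (Fin 3) (Fin 3) ℝ :=
  Matrix.of fun i j => g p i.succ j.succ

/-- The components of the future directed unit normal of the level sets of `t`,
`nᵘ = -g⁰ᵘ / (-g⁰⁰)^{1/2}`. -/
def unitNormal (g : (Fin 4 → ℝ) → Matrix (Fin 4) (Fin 4) ℝ) (μ : Fin 4) (p : Fin 4 → ℝ) : ℝ :=
  -(g p)⁻¹ 0 μ / Real.sqrt (-(g p)⁻¹ 0 0)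

/-- The components `k(∂ᵢ, ∂ⱼ) = g(∇_{∂ᵢ} n, ∂ⱼ)` of the second fundamental form induced on the level
sets of `t`. -/
def secondFundamentalForm (g : (Fin 4 → ℝ) → Matrix (Fin 4) (Fin 4) ℝ) (p : Fin 4 → ℝ) :
    Matrix (Fin 3) (Fin 3) ℝ :=
  Matrix.of fun i j => ∑ μ,
    (pd i.succ (unitNormal g μ) p + ∑ ν, christoffel g μ i.succ ν p * unitNormal g ν p)
      * g p μ j.succ

/-- The components, with respect to `(∂_θ, ∂_x, ∂_y)`, of
`3 / (4 V α∞) dθ² + e^{P∞} [dx + Q∞ dy + (G∞ + Q∞ H∞) dθ]² + e^{-P∞} (dy + H∞ dθ)²`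
at a point of `S¹` where the functions have the given values. -/
def limitMetric (Vc α P Q G H : ℝ) : Matrix (Fin 3) (Fin 3) ℝ :=
  (3 / (4 * Vc * α)) • formSq ![1, 0, 0] + Real.exp P • formSq ![G + Q * H, 1, Q]
    + Real.exp (-P) • formSq ![H, 0, 1]

/-! ### Norms on `S¹` -/

/-- The norm `‖f‖_{C^N} = ∑_{k ≤ N} sup |∂_θ^k f|`, with values in `[0, ∞]`. -/
def cNorm (N : ℕ) (f : ℝ → ℝ) : ℝ≥0∞ :=
  ∑ k ∈ Finset.range (N + 1), ⨆ θ, ‖iteratedDeriv k f θ‖ₑ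

/-- The time derivative `f_t`. -/
def dt (f : ℝ → ℝ → ℝ) (t θ : ℝ) : ℝ := deriv (fun s => f s θ) t

end

end T2Sym

/-!
Write `ℓ = ln (t³ α)` and `Λ = λ + 3 ln t - 2 ln (3 / (4 V))`. The Ricci tensor of the metric is
computed in the frame `∂_t, ∂_θ - G ∂_x - H ∂_y, ∂_x, ∂_y - Q ∂_x`, in which the metric is
diagonal. The mixed components along one Killing field say that the two twist quantities are
constants `J, K` (`IsT2Solution.exists_twist`), so that `G_t` and `H_t` are determined by the
other variables. The remaining equations form a closed system for `P, Q, φ, ℓ, Λ`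
(`NormalizedSystem`, `IsT2Solution.exists_normalizedSystem`): three wave equations, and first
order equations for `ℓ` and `Λ`. The hypothesis on `λ` becomes `liminf Λ ≥ 0`, uniformly in `θ`.

The analysis rests on one tool. With `D_± = t^{3/2} ∂_t ± e^{ℓ/2} ∂_θ` (`nullD`), the waves are
described by the characteristic variables `D_± P`, `e^P D_± Q`, `D_± φ`, which satisfy transport
equations. Where a function of `θ` is maximal its `θ`-derivative vanishes, so that a transport
equation controls the time derivative of the maximum: a family of functions remains bounded if its
maximum grows at most at an integrable rate (`maximum_principle`). In contrast to energy methods,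
this needs no integration over the circle and applies to `ℓ` and `Λ` as well.

* The energy densities `𝓐_± = (D_± P)² + (e^P D_± Q)² + 2 (D_± φ)²` satisfy transport equations in
  which the nonlinear interaction of `P` and `Q` cancels. Expansion damps them, and the twist
  sources are compensated by adding to `𝓐_±` a multiple of the twist term. As soon as `Λ` is
  almost nonnegative this yields `𝓐_± = O(t^{1/2})` (`NormalizedSystem.exists_energy_bound`). This
  suffices to bound `P, Q, φ` and `Λ`. The weighted quantity `t^δ (e^{-Λ/2} - 1)` satisfies a
  damped equation, so that `Λ = O(t^{-1/4})`; this in turn makes the growth rate of `𝓐_±`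
  integrable, and then `Λ = O(t^{-1/2})`, and `ℓ` and `∂_θ ℓ` are bounded
  (`NormalizedSystem.isOrd_unknowns`).
* For the derivatives in `θ` all variables are treated as one semilinear system of transport
  equations. After `k + 1` differentiations the sources are affine in the derivatives of top
  order, with coefficients bounded by the induction hypothesis, and the maximum principle applies
  again (`bd_of_system`, `NormalizedSystem.bd_unknowns`). Including `∂_θ ℓ` among the unknowns,
  with an evolution equation from which `∂_θ Λ` is eliminated, avoids a loss of derivatives.
* The sum `D_+ f + D_- f = 2 t^{3/2} f_t` and `t^{1/2} (e^{-Λ/2} - 1)` are damped at the rate `1/t`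
  with sources of size `t^{-3/2}`, whence both are `O(t^{-1/2})` (`SmoothOrd.of_damped`). This
  gives the decay `O(t^{-2})` of all time derivatives (`NormalizedSystem.smoothOrd_dt`), and
  `O(t^{-5/2})` for `G_t, H_t`. Integration in time yields smooth limits with rates
  (`SmoothOrd.exists_limit`).
* The second fundamental form is half the time derivative of the induced metric divided by the
  lapse, and the lapse is asymptotic to `(3 / V)^{1/2} / (2 t)`; its asymptotics therefore follow
  from those of the induced metric (`IsT2Solution.asymptotics`).
-/

namespace T2Sym

open Filter Topology

/-! ### Partial derivatives -/

section PartialDerivatives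

variable {n : ℕ} {f h : (Fin n → ℝ) → ℝ} {p : Fin n → ℝ}

lemma hasDerivAt_comp_update (i : Fin n) (hf : DifferentiableAt ℝ f p) :
    HasDerivAt (fun s => f (Function.update p i s)) (fderiv ℝ f p (Pi.single i 1)) (p i) := by
  have h1 : HasDerivAt (fun s => Function.update p i s) (Pi.single i (1 : ℝ)) (p i) :=
    hasDerivAt_update p i (p i)
  have h2 : HasFDerivAt f (fderiv ℝ f p) (Function.update p i (p i)) := by
    rw [Function.update_eq_self]; exact hf.hasFDerivAt
  exact h2.comp_hasDerivAt (p i) h1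

lemma pd_eq_fderiv (i : Fin n) (hf : DifferentiableAt ℝ f p) :
    pd i f p = fderiv ℝ f p (Pi.single i 1) :=
  (hasDerivAt_comp_update i hf).deriv

lemma pd_congr (i : Fin n) (hfh : f =ᶠ[𝓝 p] h) : pd i f p = pd i h p := by
  have : Tendsto (fun s => Function.update p i s) (𝓝 (p i)) (𝓝 p) := by
    have h1 : ContinuousAt (fun s => Function.update p i s) (p i) :=
      (_root_.hasDerivAt_update p i (p i)).continuousAt
    simpa [ContinuousAt] using h1
  exact Filter.EventuallyEq.deriv_eq (this.eventually hfh)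

lemma eventually_pd_eq (i : Fin n) (hfh : f =ᶠ[𝓝 p] h) : pd i f =ᶠ[𝓝 p] pd i h :=
  hfh.eventually_nhds.mono fun _ hq => pd_congr i hq

lemma pd_add (i : Fin n) (hf : DifferentiableAt ℝ f p) (hh : DifferentiableAt ℝ h p) :
    pd i (fun q => f q + h q) p = pd i f p + pd i h p := by
  rw [pd_eq_fderiv i hf, pd_eq_fderiv i hh, pd_eq_fderiv i (hf.fun_add hh), fderiv_fun_add hf hh]
  rfl

lemma pd_sub (i : Fin n) (hf : DifferentiableAt ℝ f p) (hh : DifferentiableAt ℝ h p) :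
    pd i (fun q => f q - h q) p = pd i f p - pd i h p := by
  rw [pd_eq_fderiv i hf, pd_eq_fderiv i hh, pd_eq_fderiv i (hf.fun_sub hh), fderiv_fun_sub hf hh]
  rfl

lemma pd_mul (i : Fin n) (hf : DifferentiableAt ℝ f p) (hh : DifferentiableAt ℝ h p) :
    pd i (fun q => f q * h q) p = pd i f p * h p + f p * pd i h p := by
  rw [pd_eq_fderiv i hf, pd_eq_fderiv i hh, pd_eq_fderiv i (hf.fun_mul hh), fderiv_fun_mul hf hh]
  simp
  ring

@[simp]
lemma pd_const (i : Fin n) (c : ℝ) : pd i (fun _ => c) p = 0 := by simp [pd]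

lemma pd_const_mul (i : Fin n) (c : ℝ) : pd i (fun q => c * f q) p = c * pd i f p := by
  simp [pd]

lemma pd_sum (i : Fin n) {ι : Type*} (s : Finset ι) {F : ι → (Fin n → ℝ) → ℝ}
    (hF : ∀ k ∈ s, DifferentiableAt ℝ (F k) p) :
    pd i (fun q => ∑ k ∈ s, F k q) p = ∑ k ∈ s, pd i (F k) p := by
  rw [pd_eq_fderiv i (DifferentiableAt.fun_sum hF), fderiv_fun_sum hF]
  simp only [sum_apply]
  exact Finset.sum_congr rfl fun k hk => (pd_eq_fderiv i (hF k hk)).symm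

lemma _root_.ContDiffAt.eventually_differentiableAt (hf : ContDiffAt ℝ ∞ f p) :
    ∀ᶠ q in 𝓝 p, DifferentiableAt ℝ f q :=
  ((hf.of_le (m := 1) (by norm_cast)).eventually (by simp)).mono
    fun _ hq => hq.differentiableAt (by simp)

lemma eventually_pd_eq_fderiv (i : Fin n) (hf : ContDiffAt ℝ ∞ f p) :
    pd i f =ᶠ[𝓝 p] fun q => fderiv ℝ f q (Pi.single i 1) :=
  hf.eventually_differentiableAt.mono fun _ hq => pd_eq_fderiv i hq

lemma contDiffAt_pd (i : Fin n) (hf : ContDiffAt ℝ ∞ f p) : ContDiffAt ℝ ∞ (pd i f) p := by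
  refine ContDiffAt.congr_of_eventuallyEq ?_ (eventually_pd_eq_fderiv i hf)
  exact (hf.fderiv_right (m := ∞) (by simp)).clm_apply contDiffAt_const

end PartialDerivatives

/-! ### The Ricci tensor in terms of the second derivatives of the metric -/

section Ricci

/-- The Christoffel symbols with lowered first index, `Γₘᵢⱼ`, in terms of the derivatives
`D m i j = ∂ₘ gᵢⱼ` of the metric. -/
noncomputable def gammaLow {n : ℕ} (D : Fin n → Fin n → Fin n → ℝ) (m i j : Fin n) : ℝ :=
  (1 / 2) * (D i j m + D j i m - D m i j)

/-- The Ricci tensor as an algebraic expression in the inverse metric `I`, the first derivatives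
`D m i j = ∂ₘ gᵢⱼ` and the second derivatives `DD k l i j = ∂ₖ ∂ₗ gᵢⱼ`. -/
noncomputable def ricciAlg {n : ℕ} (I : Fin n → Fin n → ℝ) (D : Fin n → Fin n → Fin n → ℝ)
    (DD : Fin n → Fin n → Fin n → Fin n → ℝ) (i j : Fin n) : ℝ :=
  ∑ k, ∑ l, I k l * ((1 / 2) * (DD k i j l + DD k j i l - DD k l i j - DD i j k l)
    + ∑ m, ∑ r, I m r * (gammaLow D m i k * gammaLow D r j l - gammaLow D m k l * gammaLow D r i j))

variable {n : ℕ} {g : (Fin n → ℝ) → Matrix (Fin n) (Fin n) ℝ} {p : Fin n → ℝ}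

/-- `g` is a smooth pseudo-Riemannian metric near `p`. -/
structure IsMetricAt (g : (Fin n → ℝ) → Matrix (Fin n) (Fin n) ℝ) (p : Fin n → ℝ) : Prop where
  smooth : ∀ i j, ContDiffAt ℝ ∞ (fun q => g q i j) p
  smooth_inv : ∀ i j, ContDiffAt ℝ ∞ (fun q => (g q)⁻¹ i j) p
  symm : ∀ᶠ q in 𝓝 p, ∀ i j, g q i j = g q j i
  inv_mul : ∀ᶠ q in 𝓝 p, (g q)⁻¹ * g q = 1

namespace IsMetricAt

lemma mul_inv (hg : IsMetricAt g p) : g p * (g p)⁻¹ = 1 :=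
  mul_eq_one_comm.1 hg.inv_mul.self_of_nhds

lemma inv_symm (hg : IsMetricAt g p) (i j : Fin n) : (g p)⁻¹ i j = (g p)⁻¹ j i := by
  have h1 : (g p).transpose = g p := by
    ext i j; exact hg.symm.self_of_nhds j i
  have h2 : ((g p)⁻¹).transpose = (g p)⁻¹ := by rw [Matrix.transpose_nonsing_inv, h1]
  exact congrFun (congrFun h2 j) i

lemma pd_symm (hg : IsMetricAt g p) (m i j : Fin n) :
    pd m (fun q => g q i j) p = pd m (fun q => g q j i) p :=
  pd_congr m (hg.symm.mono fun _ hq => hq i j)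

lemma pd_pd_symm (hg : IsMetricAt g p) (k m i j : Fin n) :
    pd k (pd m (fun q => g q i j)) p = pd k (pd m (fun q => g q j i)) p :=
  pd_congr k (eventually_pd_eq m (hg.symm.mono fun _ hq => hq i j))

lemma pd_inv (hg : IsMetricAt g p) (m k l : Fin n) :
    pd m (fun q => (g q)⁻¹ k l) p
      = -∑ b, (∑ a, (g p)⁻¹ k a * pd m (fun q => g q a b) p) * (g p)⁻¹ b l := by
  have hd := fun i j => (hg.smooth i j).differentiableAt (by simp)
  have hd' := fun i j => (hg.smooth_inv i j).differentiableAt (by simp)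
  have h1 : ∀ b, ∑ a, pd m (fun q => (g q)⁻¹ k a) p * g p a b
      = -∑ a, (g p)⁻¹ k a * pd m (fun q => g q a b) p := by
    intro b
    have h2 : pd m (fun q => ∑ a, (g q)⁻¹ k a * g q a b) p = 0 := by
      rw [pd_congr m (h := fun _ => (1 : Matrix (Fin n) (Fin n) ℝ) k b), pd_const]
      filter_upwards [hg.inv_mul] with q hq
      rw [← hq, Matrix.mul_apply]
    rw [pd_sum m _ fun a _ => (hd' k a).fun_mul (hd a b)] at h2
    simp only [pd_mul m (hd' k _) (hd _ b), Finset.sum_add_distrib] at h2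
    linarith
  have h3 : ∀ a, ∑ b, g p a b * (g p)⁻¹ b l = if a = l then 1 else 0 := by
    intro a
    rw [← Matrix.mul_apply, hg.mul_inv, Matrix.one_apply]
  calc pd m (fun q => (g q)⁻¹ k l) p
      = ∑ a, pd m (fun q => (g q)⁻¹ k a) p * ∑ b, g p a b * (g p)⁻¹ b l := by
        simp [h3]
    _ = ∑ b, (∑ a, pd m (fun q => (g q)⁻¹ k a) p * g p a b) * (g p)⁻¹ b l := by
        simp only [Finset.mul_sum, Finset.sum_mul]
        rw [Finset.sum_comm]
        simp only [mul_assoc]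
    _ = _ := by simp only [h1, neg_mul, Finset.sum_neg_distrib]

end IsMetricAt

lemma christoffel_eq (g : (Fin n → ℝ) → Matrix (Fin n) (Fin n) ℝ) (k i j : Fin n)
    (p : Fin n → ℝ) :
    christoffel g k i j p
      = ∑ l, (g p)⁻¹ k l * gammaLow (fun m i j => pd m (fun q => g q i j) p) l i j := by
  simp only [christoffel, gammaLow, Finset.mul_sum]
  exact Finset.sum_congr rfl fun l _ => by ring

lemma IsMetricAt.pd_christoffel (hg : IsMetricAt g p) (m k i j : Fin n) :
    pd m (christoffel g k i j) p = ∑ l, (g p)⁻¹ k l *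
      ((1 / 2) * (pd m (pd i (fun q => g q j l)) p + pd m (pd j (fun q => g q i l)) p
          - pd m (pd l (fun q => g q i j)) p)
        - ∑ b, (gammaLow (fun m i j => pd m (fun q => g q i j) p) l m b
            + gammaLow (fun m i j => pd m (fun q => g q i j) p) b m l)
          * christoffel g b i j p) := by
  have hd := fun m i j => (contDiffAt_pd m (hg.smooth i j)).differentiableAt (by simp)
  have hd' := fun i j => (hg.smooth_inv i j).differentiableAt (by simp)
  have hG : ∀ l, DifferentiableAt ℝ (fun q => (1 / 2) * (pd i (fun q => g q j l) q
      + pd j (fun q => g q i l) q - pd l (fun q => g q i j) q)) p := fun l =>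
    (((hd i j l).add (hd j i l)).sub (hd l i j)).const_mul _
  have hGd : ∀ l, pd m (fun q => (1 / 2) * (pd i (fun q => g q j l) q
      + pd j (fun q => g q i l) q - pd l (fun q => g q i j) q)) p
      = (1 / 2) * (pd m (pd i (fun q => g q j l)) p + pd m (pd j (fun q => g q i l)) p
          - pd m (pd l (fun q => g q i j)) p) := by
    intro l
    rw [pd_const_mul, pd_sub m ((hd i j l).fun_add (hd j i l)) (hd l i j),
      pd_add m (hd i j l) (hd j i l)]
  have h0 : christoffel g k i j = fun q => ∑ l, (g q)⁻¹ k l * ((1 / 2) *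
      (pd i (fun q => g q j l) q + pd j (fun q => g q i l) q - pd l (fun q => g q i j) q)) := by
    ext q
    rw [christoffel_eq]
    rfl
  have hsum : ∀ l b, gammaLow (fun m i j => pd m (fun q => g q i j) p) l m b
      + gammaLow (fun m i j => pd m (fun q => g q i j) p) b m l = pd m (fun q => g q l b) p := by
    intro l b
    simp only [gammaLow]
    rw [hg.pd_symm m l b, hg.pd_symm b m l, hg.pd_symm l m b]
    ring
  rw [h0, pd_sum m _ fun l _ => (hd' k l).fun_mul (hG l)]
  simp only [pd_mul m (hd' k _) (hG _), hGd, Finset.sum_add_distrib, hsum]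
  have h4 : ∑ l, pd m (fun q => (g q)⁻¹ k l) p * ((1 / 2) * (pd i (fun q => g q j l) p
      + pd j (fun q => g q i l) p - pd l (fun q => g q i j) p))
      = -∑ l, (g p)⁻¹ k l * ∑ b, pd m (fun q => g q l b) p * christoffel g b i j p := by
    simp only [hg.pd_inv, christoffel_eq, gammaLow, Finset.mul_sum, Finset.sum_mul, neg_mul,
      Finset.sum_neg_distrib]
    congr 1
    rw [Finset.sum_comm]
    rw [Finset.sum_comm' (t' := Finset.univ) (s' := fun _ => Finset.univ) (by simp)]
    rw [Finset.sum_comm]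
    conv_rhs => rw [Finset.sum_comm]
    refine Finset.sum_congr rfl fun b _ => ?_
    rw [Finset.sum_comm]
    refine Finset.sum_congr rfl fun a _ => ?_
    refine Finset.sum_congr rfl fun c _ => ?_
    ring
  rw [h4]
  simp only [mul_sub, Finset.sum_sub_distrib]
  ring

/-- The Ricci tensor in terms of the first two derivatives of the metric. -/
theorem IsMetricAt.ricci_eq (hg : IsMetricAt g p) (i j : Fin n) :
    ricci g i j p = ricciAlg (fun k l => (g p)⁻¹ k l) (fun m i j => pd m (fun q => g q i j) p)
      (fun k l i j => pd k (pd l (fun q => g q i j)) p) i j := by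
  set Γ := gammaLow (fun m i j => pd m (fun q => g q i j) p) with hΓ
  set I : Fin n → Fin n → ℝ := fun k l => (g p)⁻¹ k l with hI
  have hIs : ∀ i j, I i j = I j i := hg.inv_symm
  have hΓs : ∀ m i j, Γ m i j = Γ m j i := by
    intro m i j
    simp only [hΓ, gammaLow]
    rw [hg.pd_symm m i j]
    ring
  have e1 : (∑ k, pd k (christoffel g k i j) p)
      + ∑ k, ∑ l, christoffel g k k l p * christoffel g l i j p
      = ∑ k, ∑ l, I k l * ((1 / 2) * (pd k (pd i (fun q => g q j l)) p
          + pd k (pd j (fun q => g q i l)) p - pd k (pd l (fun q => g q i j)) p)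
        - ∑ b, Γ b k l * christoffel g b i j p) := by
    have : ∀ k, ∑ l, christoffel g k k l p * christoffel g l i j p
        = ∑ l, I k l * ∑ b, Γ l k b * christoffel g b i j p := by
      intro k
      simp only [christoffel_eq g k k, Finset.sum_mul, Finset.mul_sum, ← hΓ, ← hI]
      rw [Finset.sum_comm]
      simp only [mul_assoc]
    simp only [hg.pd_christoffel, this, ← Finset.sum_add_distrib, ← hΓ, ← hI]
    refine Finset.sum_congr rfl fun k _ => Finset.sum_congr rfl fun l _ => ?_
    simp only [add_mul, Finset.sum_add_distrib]
    ring
  have e2 : (∑ k, pd i (christoffel g k k j) p)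
      + ∑ k, ∑ l, christoffel g k i l p * christoffel g l k j p
      = ∑ k, ∑ l, I k l * ((1 / 2) * pd i (pd j (fun q => g q k l)) p
        - ∑ b, Γ b i l * christoffel g b k j p) := by
    have h1 : ∀ k, ∑ l, christoffel g k i l p * christoffel g l k j p
        = ∑ l, I k l * ∑ b, Γ l i b * christoffel g b k j p := by
      intro k
      simp only [christoffel_eq g k i, Finset.sum_mul, Finset.mul_sum, ← hΓ, ← hI]
      rw [Finset.sum_comm]
      simp only [mul_assoc]
    have h2 : ∑ k, ∑ l, I k l * pd i (pd k (fun q => g q j l)) p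
        = ∑ k, ∑ l, I k l * pd i (pd l (fun q => g q k j)) p := by
      rw [Finset.sum_comm]
      refine Finset.sum_congr rfl fun k _ => Finset.sum_congr rfl fun l _ => ?_
      rw [hIs l k, hg.pd_pd_symm i l j k]
    have h3 : ∑ k, ∑ l, I k l * ((1 / 2) * (pd i (pd k (fun q => g q j l)) p
          + pd i (pd j (fun q => g q k l)) p - pd i (pd l (fun q => g q k j)) p))
        = ∑ k, ∑ l, I k l * ((1 / 2) * pd i (pd j (fun q => g q k l)) p) := by
      have : ∀ k l, I k l * ((1 / 2) * (pd i (pd k (fun q => g q j l)) p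
          + pd i (pd j (fun q => g q k l)) p - pd i (pd l (fun q => g q k j)) p))
          = (1 / 2) * (I k l * pd i (pd k (fun q => g q j l)) p)
            + I k l * ((1 / 2) * pd i (pd j (fun q => g q k l)) p)
            - (1 / 2) * (I k l * pd i (pd l (fun q => g q k j)) p) := fun k l => by ring
      simp only [this, Finset.sum_sub_distrib, Finset.sum_add_distrib, ← Finset.mul_sum, h2]
      ring
    simp only [hg.pd_christoffel, h1, ← Finset.sum_add_distrib, ← hΓ, ← hI]
    rw [show (∑ k, ∑ l, I k l * ((1 / 2) * pd i (pd j (fun q => g q k l)) p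
        - ∑ b, Γ b i l * christoffel g b k j p))
        = (∑ k, ∑ l, I k l * ((1 / 2) * pd i (pd j (fun q => g q k l)) p))
        - ∑ k, ∑ l, I k l * ∑ b, Γ b i l * christoffel g b k j p by
      simp only [mul_sub, Finset.sum_sub_distrib], ← h3]
    simp only [← Finset.sum_sub_distrib]
    refine Finset.sum_congr rfl fun k _ => Finset.sum_congr rfl fun l _ => ?_
    simp only [add_mul, Finset.sum_add_distrib]
    ring
  have e3 : ∑ k, ∑ l, I k l * ∑ b, Γ b i l * christoffel g b k j p
      = ∑ k, ∑ l, I k l * ∑ b, Γ b i k * christoffel g b j l p := by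
    rw [Finset.sum_comm]
    refine Finset.sum_congr rfl fun k _ => Finset.sum_congr rfl fun l _ => ?_
    rw [hIs l k]
    simp only [christoffel_eq g _ _ _ p, ← hΓ, hΓs _ l j]
  have e4 : ricci g i j p = ∑ k, ∑ l, I k l * ((1 / 2) * (pd k (pd i (fun q => g q j l)) p
          + pd k (pd j (fun q => g q i l)) p - pd k (pd l (fun q => g q i j)) p
          - pd i (pd j (fun q => g q k l)) p)
        + (∑ b, Γ b i k * christoffel g b j l p - ∑ b, Γ b k l * christoffel g b i j p)) := by
    have : ricci g i j p = ((∑ k, pd k (christoffel g k i j) p)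
      + ∑ k, ∑ l, christoffel g k k l p * christoffel g l i j p)
      - ((∑ k, pd i (christoffel g k k j) p)
      + ∑ k, ∑ l, christoffel g k i l p * christoffel g l k j p) := by
      unfold ricci; ring
    rw [this, e1, e2]
    simp only [mul_sub, mul_add, Finset.sum_sub_distrib, Finset.sum_add_distrib] at e3 ⊢
    rw [e3]
    ring
  rw [e4, ricciAlg]
  refine Finset.sum_congr rfl fun k _ => Finset.sum_congr rfl fun l _ => ?_
  congr 2
  simp only [christoffel_eq g _ _ _ p, ← hΓ, ← hI, mul_sub, Finset.mul_sum,
    Finset.sum_sub_distrib]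
  congr 1 <;>
  · refine Finset.sum_congr rfl fun b _ => Finset.sum_congr rfl fun c _ => ?_
    ring

end Ricci

/-! ### Components in a frame that diagonalizes the metric -/

section Frame

variable {n : ℕ}

/-- The component of the covector `f` along the frame vector with components `E · b`. -/
def frameComp (E : Fin n → Fin n → ℝ) (b : Fin n) (f : Fin n → ℝ) : ℝ := ∑ i, E i b * f i

variable (E : Fin n → Fin n → ℝ)

lemma frameComp_add (b : Fin n) (f h : Fin n → ℝ) :
    frameComp E b (fun i => f i + h i) = frameComp E b f + frameComp E b h := by
  simp [frameComp, mul_add, Finset.sum_add_distrib]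

lemma frameComp_sub (b : Fin n) (f h : Fin n → ℝ) :
    frameComp E b (fun i => f i - h i) = frameComp E b f - frameComp E b h := by
  simp [frameComp, mul_sub, Finset.sum_sub_distrib]

lemma frameComp_const_mul (b : Fin n) (c : ℝ) (f : Fin n → ℝ) :
    frameComp E b (fun i => c * f i) = c * frameComp E b f := by
  simp only [frameComp, Finset.mul_sum]
  exact Finset.sum_congr rfl fun i _ => by ring

lemma frameComp_mul_const (b : Fin n) (c : ℝ) (f : Fin n → ℝ) :
    frameComp E b (fun i => f i * c) = frameComp E b f * c := by
  simp only [frameComp, Finset.sum_mul]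
  exact Finset.sum_congr rfl fun i _ => by ring

lemma frameComp_sum (b : Fin n) {ι : Type*} (s : Finset ι) (F : ι → Fin n → ℝ) :
    frameComp E b (fun i => ∑ a ∈ s, F a i) = ∑ a ∈ s, frameComp E b (F a) := by
  simp only [frameComp, Finset.mul_sum]
  exact Finset.sum_comm

lemma frameComp_comm (b d : Fin n) (F : Fin n → Fin n → ℝ) :
    frameComp E b (fun i => frameComp E d fun j => F i j)
      = frameComp E d fun j => frameComp E b fun i => F i j := by
  simp only [frameComp, Finset.mul_sum]
  rw [Finset.sum_comm]
  exact Finset.sum_congr rfl fun i _ => Finset.sum_congr rfl fun j _ => by ring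

lemma sum_inv_mul_eq {I : Fin n → Fin n → ℝ} {s : Fin n → ℝ}
    (hI : ∀ k l, I k l = ∑ a, s a * E k a * E l a) (X : Fin n → Fin n → ℝ) :
    ∑ k, ∑ l, I k l * X k l = ∑ a, s a * frameComp E a fun k => frameComp E a fun l => X k l := by
  simp only [frameComp, hI, Finset.mul_sum, Finset.sum_mul]
  simp_rw [Finset.sum_comm (s := Finset.univ) (t := Finset.univ) (γ := Fin n)
    (f := fun l a => s a * E _ a * E l a * X _ l)]
  rw [Finset.sum_comm]
  exact Finset.sum_congr rfl fun i _ => Finset.sum_congr rfl fun j _ =>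
    Finset.sum_congr rfl fun j _ => by ring

/-- The Ricci tensor in a frame in which the inverse metric is diagonal. -/
theorem frameComp_ricciAlg {I : Fin n → Fin n → ℝ} {s : Fin n → ℝ}
    (hI : ∀ k l, I k l = ∑ a, s a * E k a * E l a)
    (D : Fin n → Fin n → Fin n → ℝ) (DD : Fin n → Fin n → Fin n → Fin n → ℝ)
    {D' : Fin n → Fin n → Fin n → ℝ} {DD' : Fin n → Fin n → Fin n → Fin n → ℝ}
    (hD' : ∀ a b c, D' a b c = frameComp E a fun m => frameComp E b fun i => frameComp E c fun j =>
      D m i j)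
    (hDD' : ∀ a b c d, DD' a b c d = frameComp E a fun k => frameComp E b fun l =>
      frameComp E c fun i => frameComp E d fun j => DD k l i j) (b d : Fin n) :
    frameComp E b (fun i => frameComp E d fun j => ricciAlg I D DD i j)
      = ∑ c, s c * ((1 / 2) * (DD' c b d c + DD' c d b c - DD' c c b d - DD' b d c c)
        + ∑ a, s a * (gammaLow D' a b c * gammaLow D' a d c
          - gammaLow D' a c c * gammaLow D' a b d)) := by
  have h3 : ∀ (a b c : Fin n) (F : Fin n → Fin n → Fin n → ℝ),
      (frameComp E a fun i => frameComp E b fun j => frameComp E c fun k => F i j k)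
        = frameComp E c fun k => frameComp E a fun i => frameComp E b fun j => F i j k := by
    intro a b c F
    exact (congrArg _ (funext fun i => frameComp_comm E b c _)).trans (frameComp_comm E a c _)
  have hΓ : ∀ a b c, (frameComp E a fun m => frameComp E b fun i => frameComp E c fun j =>
      gammaLow D m i j) = gammaLow D' a b c := by
    intro a b c
    simp only [gammaLow, frameComp_const_mul, frameComp_add, frameComp_sub, hD']
    rw [h3 b c a, h3 c b a]
    congr 4
    exact funext fun m => frameComp_comm E b c _
  have hR : ∀ i j, ricciAlg I D DD i j = ∑ c, s c * frameComp E c fun k => frameComp E c fun l =>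
      ((1 / 2) * (DD k i j l + DD k j i l - DD k l i j - DD i j k l)
        + ∑ a, s a * (((frameComp E a fun m => gammaLow D m i k)
            * frameComp E a fun m => gammaLow D m j l)
          - (frameComp E a fun m => gammaLow D m k l)
            * frameComp E a fun m => gammaLow D m i j)) := by
    intro i j
    rw [ricciAlg, sum_inv_mul_eq E hI]
    simp only [sum_inv_mul_eq E hI, frameComp_sub, frameComp_const_mul, frameComp_mul_const]
  have hΓ2 : ∀ a b c, (frameComp E b fun i => frameComp E c fun j => frameComp E a fun m =>
      gammaLow D m i j) = gammaLow D' a b c := fun a b c => by rw [← hΓ, h3 b c a]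
  simp only [hR, frameComp_sum, frameComp_add, frameComp_sub, frameComp_const_mul,
    frameComp_mul_const]
  refine Finset.sum_congr rfl fun c _ => ?_
  simp only [hΓ2]
  have e1 : (frameComp E b fun i => frameComp E d fun j => frameComp E c fun k =>
      frameComp E c fun l => DD k i j l) = DD' c b d c := by
    rw [hDD', h3 b d c]
  have e2 : (frameComp E b fun i => frameComp E d fun j => frameComp E c fun k =>
      frameComp E c fun l => DD k j i l) = DD' c d b c := by
    rw [hDD', frameComp_comm E b d, h3 d b c]
  have e3 : (frameComp E b fun i => frameComp E d fun j => frameComp E c fun k =>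
      frameComp E c fun l => DD k l i j) = DD' c c b d := by
    rw [hDD', h3 b d c]
    exact congrArg _ (funext fun k => h3 b d c _)
  rw [e1, e2, e3, ← hDD']

/-- The wave operator in a frame in which the inverse metric is diagonal. -/
theorem waveOperator_eq {g : (Fin n → ℝ) → Matrix (Fin n) (Fin n) ℝ} {φ : (Fin n → ℝ) → ℝ}
    {p : Fin n → ℝ} {s : Fin n → ℝ} (hI : ∀ k l, (g p)⁻¹ k l = ∑ a, s a * E k a * E l a) :
    waveOperator g φ p = ∑ a, s a * ((frameComp E a fun k => frameComp E a fun l => pd k (pd l φ) p)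
      - ∑ m, s m * ((frameComp E m fun r => frameComp E a fun i => frameComp E a fun j =>
          gammaLow (fun m i j => pd m (fun q => g q i j) p) r i j)
        * frameComp E m fun r => pd r φ p)) := by
  have h3 : ∀ (a b c : Fin n) (F : Fin n → Fin n → Fin n → ℝ),
      (frameComp E a fun i => frameComp E b fun j => frameComp E c fun k => F i j k)
        = frameComp E c fun k => frameComp E a fun i => frameComp E b fun j => F i j k := by
    intro a b c F
    exact (congrArg _ (funext fun i => frameComp_comm E b c _)).trans (frameComp_comm E a c _)
  have h1 : ∀ a b, ∑ c, christoffel g c a b p * pd c φ p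
      = ∑ m, s m * ((frameComp E m fun r =>
          gammaLow (fun m i j => pd m (fun q => g q i j) p) r a b)
        * frameComp E m fun r => pd r φ p) := by
    intro a b
    have := sum_inv_mul_eq E hI fun c l =>
      gammaLow (fun m i j => pd m (fun q => g q i j) p) l a b * pd c φ p
    simp only [frameComp_mul_const, frameComp_const_mul] at this
    rw [← this]
    simp only [christoffel_eq, Finset.sum_mul, mul_assoc]
  rw [waveOperator, sum_inv_mul_eq E hI]
  simp only [h1, frameComp_sub, frameComp_sum, frameComp_const_mul, frameComp_mul_const]
  refine Finset.sum_congr rfl fun a _ => ?_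
  congr 2
  exact Finset.sum_congr rfl fun m _ => by rw [h3]

end Frame

/-! ### Consequences of the Einstein equations and the second fundamental form -/

section Einstein

/-- The trace-reversed Einstein equations of a scalar field with potential `V` in four dimensions. -/
theorem ricci_of_einstein {g : (Fin 4 → ℝ) → Matrix (Fin 4) (Fin 4) ℝ} {V : ℝ → ℝ}
    {φ : (Fin 4 → ℝ) → ℝ} {p : Fin 4 → ℝ} (hg : IsMetricAt g p)
    (h : ∀ i j, einsteinTensor g i j p = stressEnergy g V φ i j p) (i j : Fin 4) :
    ricci g i j p = pd i φ p * pd j φ p + V (φ p) * g p i j := by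
  set N := ∑ a, ∑ b, (g p)⁻¹ a b * pd a φ p * pd b φ p with hN
  have htr : ∑ i, ∑ j, (g p)⁻¹ i j * g p i j = 4 := by
    have h1 : ∀ i, ∑ j, (g p)⁻¹ i j * g p i j = 1 := by
      intro i
      have h2 := congrFun (congrFun hg.inv_mul.self_of_nhds i) i
      rw [Matrix.mul_apply, Matrix.one_apply_eq] at h2
      rw [← h2]
      exact Finset.sum_congr rfl fun j _ => by rw [hg.symm.self_of_nhds i j]
    simp [h1]
  have hS : scalarCurvature g p = N + 4 * V (φ p) := by
    have h1 : ∑ i, ∑ j, (g p)⁻¹ i j * einsteinTensor g i j p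
        = ∑ i, ∑ j, (g p)⁻¹ i j * stressEnergy g V φ i j p := by simp only [h]
    have h2 : ∑ i, ∑ j, (g p)⁻¹ i j * einsteinTensor g i j p
        = scalarCurvature g p - (1 / 2) * scalarCurvature g p * 4 := by
      have : ∀ i j, (g p)⁻¹ i j * einsteinTensor g i j p = (g p)⁻¹ i j * ricci g i j p
          - (1 / 2) * scalarCurvature g p * ((g p)⁻¹ i j * g p i j) := by
        intro i j; unfold einsteinTensor; ring
      simp only [this, Finset.sum_sub_distrib, ← Finset.mul_sum, htr]
      rfl
    have h3 : ∑ i, ∑ j, (g p)⁻¹ i j * stressEnergy g V φ i j p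
        = N - ((1 / 2) * N + V (φ p)) * 4 := by
      have : ∀ i j, (g p)⁻¹ i j * stressEnergy g V φ i j p = (g p)⁻¹ i j * pd i φ p * pd j φ p
          - ((1 / 2) * N + V (φ p)) * ((g p)⁻¹ i j * g p i j) := by
        intro i j; unfold stressEnergy; ring
      simp only [this, Finset.sum_sub_distrib, ← Finset.mul_sum, htr]
      rw [hN]
    rw [h2, h3] at h1
    linarith
  have h1 := h i j
  unfold einsteinTensor stressEnergy at h1
  rw [hS, ← hN] at h1
  linarith

/-- The second fundamental form of the level sets of the time coordinate is half the derivative of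
the induced metric along the unit normal if there is no shift. -/
theorem secondFundamentalForm_eq {g : (Fin 4 → ℝ) → Matrix (Fin 4) (Fin 4) ℝ} {p : Fin 4 → ℝ}
    (hg : IsMetricAt g p) (hshift : ∀ᶠ q in 𝓝 p, ∀ i : Fin 3, g q 0 i.succ = 0)
    (hshift' : ∀ᶠ q in 𝓝 p, ∀ i : Fin 3, (g q)⁻¹ 0 i.succ = 0) (i j : Fin 3) :
    secondFundamentalForm g p i j
      = (1 / 2) * unitNormal g 0 p * pd 0 (fun q => g q i.succ j.succ) p := by
  have hn : ∀ k : Fin 3, unitNormal g k.succ =ᶠ[𝓝 p] fun _ => 0 := by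
    intro k
    filter_upwards [hshift'] with q hq
    simp [unitNormal, hq]
  have hn' : ∀ k : Fin 3, unitNormal g k.succ p = 0 := fun k => (hn k).self_of_nhds
  have h0 : g p 0 j.succ = 0 := hshift.self_of_nhds j
  have h1 : ∀ μ, (pd i.succ (unitNormal g μ) p
      + ∑ ν, christoffel g μ i.succ ν p * unitNormal g ν p) * g p μ j.succ
      = unitNormal g 0 p * (christoffel g μ i.succ 0 p * g p μ j.succ) := by
    intro μ
    rw [Fin.sum_univ_succ]
    simp only [hn', mul_zero, Finset.sum_const_zero, add_zero]
    induction μ using Fin.cases with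
    | zero => simp [h0]
    | succ k => rw [pd_congr i.succ (hn k), pd_const]; ring
  have h2 : ∑ μ, christoffel g μ i.succ 0 p * g p μ j.succ
      = gammaLow (fun m i j => pd m (fun q => g q i j) p) j.succ i.succ 0 := by
    have h3 : ∀ l, ∑ μ, g p j.succ μ * (g p)⁻¹ μ l = if j.succ = l then 1 else 0 := by
      intro l; rw [← Matrix.mul_apply, hg.mul_inv, Matrix.one_apply]
    simp only [christoffel_eq, Finset.sum_mul]
    rw [Finset.sum_comm]
    have : ∀ l, ∑ μ, (g p)⁻¹ μ l * gammaLow (fun m i j => pd m (fun q => g q i j) p) l i.succ 0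
        * g p μ j.succ = gammaLow (fun m i j => pd m (fun q => g q i j) p) l i.succ 0
          * ∑ μ, g p j.succ μ * (g p)⁻¹ μ l := by
      intro l
      rw [Finset.mul_sum]
      refine Finset.sum_congr rfl fun μ _ => ?_
      rw [hg.symm.self_of_nhds μ j.succ]; ring
    simp [this, h3]
  have h4 : ∀ m (k : Fin 3), pd m (fun q => g q 0 k.succ) p = 0 := by
    intro m k
    rw [pd_congr m (h := fun _ => 0) (hshift.mono fun q hq => hq k), pd_const]
  rw [secondFundamentalForm, Matrix.of_apply]
  simp only [h1, ← Finset.mul_sum, h2, gammaLow]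
  rw [h4, hg.pd_symm _ i.succ 0, h4]
  ring

end Einstein

/-! ### Calculus of functions of `(t, θ)` -/

section Cylinder

/-- The derivative `∂_θ f`. -/
noncomputable def dth (f : ℝ → ℝ → ℝ) (t θ : ℝ) : ℝ := deriv (f t) θ

/-- `f` is smooth on `(t₀, ∞) × ℝ`. -/
def Sm (t₀ : ℝ) (f : ℝ → ℝ → ℝ) : Prop :=
  ContDiffOn ℝ ∞ (fun z : ℝ × ℝ => f z.1 z.2) (Ioi t₀ ×ˢ univ)

variable {t₀ t θ : ℝ} {f h : ℝ → ℝ → ℝ}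

lemma isOpen_cylinder (t₀ : ℝ) : IsOpen (Ioi t₀ ×ˢ (univ : Set ℝ)) := isOpen_Ioi.prod isOpen_univ

lemma cylinder_mem_nhds (ht : t₀ < t) (θ : ℝ) : Ioi t₀ ×ˢ (univ : Set ℝ) ∈ 𝓝 (t, θ) :=
  (isOpen_cylinder t₀).mem_nhds ⟨ht, mem_univ _⟩

namespace Sm

lemma contDiffAt (hf : Sm t₀ f) (ht : t₀ < t) (θ : ℝ) :
    ContDiffAt ℝ ∞ (fun z : ℝ × ℝ => f z.1 z.2) (t, θ) :=
  ContDiffOn.contDiffAt hf (cylinder_mem_nhds ht θ)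

lemma congr (hf : Sm t₀ f) (hfh : ∀ t θ, t₀ < t → h t θ = f t θ) : Sm t₀ h :=
  ContDiffOn.congr hf fun z hz => hfh z.1 z.2 hz.1

lemma differentiableAt (hf : Sm t₀ f) (ht : t₀ < t) (θ : ℝ) :
    DifferentiableAt ℝ (fun z : ℝ × ℝ => f z.1 z.2) (t, θ) :=
  (hf.contDiffAt ht θ).differentiableAt (by simp)

lemma hasDerivAt_t_fderiv (hf : Sm t₀ f) (ht : t₀ < t) (θ : ℝ) :
    HasDerivAt (fun s => f s θ) (fderiv ℝ (fun z : ℝ × ℝ => f z.1 z.2) (t, θ) (1, 0)) t := by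
  have h1 : HasDerivAt (fun s : ℝ => (s, θ)) ((1 : ℝ), (0 : ℝ)) t :=
    (hasDerivAt_id t).prodMk (hasDerivAt_const t θ)
  exact (hf.differentiableAt ht θ).hasFDerivAt.comp_hasDerivAt t h1

lemma hasDerivAt_th_fderiv (hf : Sm t₀ f) (ht : t₀ < t) (θ : ℝ) :
    HasDerivAt (f t) (fderiv ℝ (fun z : ℝ × ℝ => f z.1 z.2) (t, θ) (0, 1)) θ := by
  have h1 : HasDerivAt (fun s : ℝ => (t, s)) ((0 : ℝ), (1 : ℝ)) θ :=
    (hasDerivAt_const θ t).prodMk (hasDerivAt_id θ)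
  exact (hf.differentiableAt ht θ).hasFDerivAt.comp_hasDerivAt θ h1

lemma hasDerivAt_t (hf : Sm t₀ f) (ht : t₀ < t) (θ : ℝ) :
    HasDerivAt (fun s => f s θ) (dt f t θ) t :=
  (hf.hasDerivAt_t_fderiv ht θ).differentiableAt.hasDerivAt

lemma hasDerivAt_th (hf : Sm t₀ f) (ht : t₀ < t) (θ : ℝ) :
    HasDerivAt (f t) (dth f t θ) θ :=
  (hf.hasDerivAt_th_fderiv ht θ).differentiableAt.hasDerivAt

lemma dt_eq (hf : Sm t₀ f) (ht : t₀ < t) (θ : ℝ) :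
    dt f t θ = fderiv ℝ (fun z : ℝ × ℝ => f z.1 z.2) (t, θ) (1, 0) :=
  (hf.hasDerivAt_t_fderiv ht θ).deriv

lemma dth_eq (hf : Sm t₀ f) (ht : t₀ < t) (θ : ℝ) :
    dth f t θ = fderiv ℝ (fun z : ℝ × ℝ => f z.1 z.2) (t, θ) (0, 1) :=
  (hf.hasDerivAt_th_fderiv ht θ).deriv

lemma contDiffOn_fderiv (hf : Sm t₀ f) (v : ℝ × ℝ) :
    ContDiffOn ℝ ∞ (fun z => fderiv ℝ (fun z : ℝ × ℝ => f z.1 z.2) z v) (Ioi t₀ ×ˢ univ) :=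
  (ContDiffOn.fderiv_of_isOpen hf (isOpen_cylinder t₀) (by simp)).clm_apply contDiffOn_const

lemma dt (hf : Sm t₀ f) : Sm t₀ (dt f) :=
  (hf.contDiffOn_fderiv (1, 0)).congr fun z hz => hf.dt_eq hz.1 z.2

lemma dth (hf : Sm t₀ f) : Sm t₀ (dth f) :=
  (hf.contDiffOn_fderiv (0, 1)).congr fun z hz => hf.dth_eq hz.1 z.2

lemma dt_dth_comm (hf : Sm t₀ f) (ht : t₀ < t) (θ : ℝ) :
    T2Sym.dt (T2Sym.dth f) t θ = T2Sym.dth (T2Sym.dt f) t θ := by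
  have hF := hf.contDiffAt ht θ
  set F := fun z : ℝ × ℝ => f z.1 z.2
  have hd : DifferentiableAt ℝ (fderiv ℝ F) (t, θ) :=
    (hF.fderiv_right (m := 1) (by norm_cast)).differentiableAt (by simp)
  have hev : ∀ᶠ z in 𝓝 (t, θ), z ∈ Ioi t₀ ×ˢ (univ : Set ℝ) := cylinder_mem_nhds ht θ
  have e1 : (fun z : ℝ × ℝ => T2Sym.dth f z.1 z.2) =ᶠ[𝓝 (t, θ)] fun z => fderiv ℝ F z (0, 1) :=
    hev.mono fun z hz => hf.dth_eq hz.1 z.2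
  have e2 : (fun z : ℝ × ℝ => T2Sym.dt f z.1 z.2) =ᶠ[𝓝 (t, θ)] fun z => fderiv ℝ F z (1, 0) :=
    hev.mono fun z hz => hf.dt_eq hz.1 z.2
  rw [hf.dth.dt_eq ht, hf.dt.dth_eq ht, e1.fderiv_eq, e2.fderiv_eq,
    fderiv_clm_apply hd (differentiableAt_const _), fderiv_clm_apply hd (differentiableAt_const _)]
  simpa using (hF.isSymmSndFDerivAt (by simp; norm_cast)).eq (1, 0) (0, 1)

lemma const (c : ℝ) : Sm t₀ fun _ _ => c := contDiffOn_const

lemma add (hf : Sm t₀ f) (hh : Sm t₀ h) : Sm t₀ fun t θ => f t θ + h t θ := ContDiffOn.add hf hh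

lemma sub (hf : Sm t₀ f) (hh : Sm t₀ h) : Sm t₀ fun t θ => f t θ - h t θ := ContDiffOn.sub hf hh

lemma mul (hf : Sm t₀ f) (hh : Sm t₀ h) : Sm t₀ fun t θ => f t θ * h t θ := ContDiffOn.mul hf hh

lemma neg (hf : Sm t₀ f) : Sm t₀ fun t θ => -f t θ := ContDiffOn.neg hf

lemma sum {ι : Type*} {s : Finset ι} {F : ι → ℝ → ℝ → ℝ} (hF : ∀ i ∈ s, Sm t₀ (F i)) :
    Sm t₀ fun t θ => ∑ i ∈ s, F i t θ := ContDiffOn.sum hF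

lemma exp (hf : Sm t₀ f) : Sm t₀ fun t θ => Real.exp (f t θ) := ContDiffOn.exp hf

lemma inv (hf : Sm t₀ f) (hne : ∀ t θ, t₀ < t → f t θ ≠ 0) : Sm t₀ fun t θ => (f t θ)⁻¹ :=
  ContDiffOn.inv hf fun z hz => hne z.1 z.2 hz.1

lemma log (hf : Sm t₀ f) (hne : ∀ t θ, t₀ < t → f t θ ≠ 0) : Sm t₀ fun t θ => Real.log (f t θ) :=
  ContDiffOn.log hf fun z hz => hne z.1 z.2 hz.1

lemma time : Sm t₀ fun t _ => t := contDiff_fst.contDiffOn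

lemma rpow (ht₀ : 0 ≤ t₀) (r : ℝ) : Sm t₀ fun t _ => t ^ r :=
  ContDiffOn.rpow_const_of_ne contDiff_fst.contDiffOn fun _ hz =>
    (ht₀.trans_lt (mem_Ioi.1 hz.1)).ne'

end Sm

lemma dth_congr (hfh : ∀ θ, f t θ = h t θ) (θ : ℝ) : dth f t θ = dth h t θ := by
  rw [dth, dth, funext hfh]

lemma dt_congr (hfh : ∀ t, t₀ < t → f t θ = h t θ) (ht : t₀ < t) : dt f t θ = dt h t θ :=
  Filter.EventuallyEq.deriv_eq ((eventually_gt_nhds ht).mono fun s hs => hfh s hs)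

/-- The derivative in the direction of the coordinate `m` of a function of `(t, θ)`, seen as a
function on the spacetime. -/
noncomputable def dd (m : Fin 4) (f : ℝ → ℝ → ℝ) : ℝ → ℝ → ℝ :=
  ![dt f, dth f, fun _ _ => 0, fun _ _ => 0] m

lemma pd_cylinder (m : Fin 4) (f : ℝ → ℝ → ℝ) (p : Fin 4 → ℝ) :
    pd m (fun q => f (q 0) (q 1)) p = dd m f (p 0) (p 1) := by
  fin_cases m <;> simp [pd, dd, dt, dth]

lemma Sm.dd (hf : Sm t₀ f) (m : Fin 4) : Sm t₀ (dd m f) := by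
  fin_cases m
  exacts [hf.dt, hf.dth, Sm.const 0, Sm.const 0]

lemma dd_congr (m : Fin 4) (hfh : ∀ t θ, t₀ < t → f t θ = h t θ) (ht : t₀ < t) (θ : ℝ) :
    dd m f t θ = dd m h t θ := by
  fin_cases m
  exacts [dt_congr (fun s hs => hfh s θ hs) ht, dth_congr (fun θ => hfh t θ ht) θ, rfl, rfl]

lemma dd_add (m : Fin 4) (hf : Sm t₀ f) (hh : Sm t₀ h) (ht : t₀ < t) (θ : ℝ) :
    dd m (fun t θ => f t θ + h t θ) t θ = dd m f t θ + dd m h t θ := by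
  fin_cases m
  · exact ((hf.hasDerivAt_t ht θ).fun_add (hh.hasDerivAt_t ht θ)).deriv
  · exact ((hf.hasDerivAt_th ht θ).fun_add (hh.hasDerivAt_th ht θ)).deriv
  all_goals simp [dd]

lemma dd_mul (m : Fin 4) (hf : Sm t₀ f) (hh : Sm t₀ h) (ht : t₀ < t) (θ : ℝ) :
    dd m (fun t θ => f t θ * h t θ) t θ = dd m f t θ * h t θ + f t θ * dd m h t θ := by
  fin_cases m
  · exact ((hf.hasDerivAt_t ht θ).fun_mul (hh.hasDerivAt_t ht θ)).deriv
  · exact ((hf.hasDerivAt_th ht θ).fun_mul (hh.hasDerivAt_th ht θ)).deriv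
  all_goals simp [dd]

lemma dd_const (m : Fin 4) (c t θ : ℝ) : dd m (fun _ _ => c) t θ = 0 := by
  fin_cases m <;> simp [dd, dt, dth]

lemma dd_sum (m : Fin 4) {ι : Type*} (s : Finset ι) {F : ι → ℝ → ℝ → ℝ} (hF : ∀ i, Sm t₀ (F i))
    (ht : t₀ < t) (θ : ℝ) :
    dd m (fun t θ => ∑ i ∈ s, F i t θ) t θ = ∑ i ∈ s, dd m (F i) t θ := by
  fin_cases m
  · exact (HasDerivAt.fun_sum fun i _ => (hF i).hasDerivAt_t ht θ).deriv
  · exact (HasDerivAt.fun_sum fun i _ => (hF i).hasDerivAt_th ht θ).deriv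
  all_goals simp [dd]

lemma Sm.contDiffAt_cylinder (hf : Sm t₀ f) {p : Fin 4 → ℝ} (hp : t₀ < p 0) :
    ContDiffAt ℝ ∞ (fun q : Fin 4 → ℝ => f (q 0) (q 1)) p :=
  ContDiffAt.comp (g := fun z : ℝ × ℝ => f z.1 z.2) (f := fun q : Fin 4 → ℝ => (q 0, q 1)) p
    (hf.contDiffAt hp (p 1)) (by fun_prop)

end Cylinder

/-! ### The Ricci tensor of a `T²`-symmetric metric as a function of the 2-jet of the fields -/

section JetAlgebra

/-- The Ricci tensor, in a frame in which the inverse metric is `diag s`, as an expression in the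
frame components of the first and the second derivatives of the metric. -/
noncomputable def ricciFrame {n : ℕ} (s : Fin n → ℝ) (D : Fin n → Fin n → Fin n → ℝ)
    (DD : Fin n → Fin n → Fin n → Fin n → ℝ) (b d : Fin n) : ℝ :=
  ∑ c, s c * ((1 / 2) * (DD c b d c + DD c d b c - DD c c b d - DD b d c c)
        + ∑ a, s a * (gammaLow D a b c * gammaLow D a d c - gammaLow D a c c * gammaLow D a b d))

/-- The 2-jet at a point of the data of a `T²`-symmetric metric
`c₀ dt² + c₁ dθ² + c₂ (dx + Q dy + (G + QH) dθ)² + c₃ (dy + H dθ)²`. The entry `τ` is `1 / t`;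
`l, a, p, q` are the first derivatives of `λ, ln α, P, Q`, and `γₘ = ∂ₘG + Q ∂ₘH`, `hₘ = ∂ₘH`. The
second derivatives have the index `₂`, with
`γ₂ₘₙ = ∂ₘ∂ₙG + Q ∂ₘ∂ₙH + ∂ₘQ ∂ₙH + ∂ₙQ ∂ₘH`. -/
structure T2Jet where
  c : Fin 4 → ℝ
  τ : ℝ
  l : Fin 4 → ℝ
  a : Fin 4 → ℝ
  p : Fin 4 → ℝ
  q : Fin 4 → ℝ
  γ : Fin 4 → ℝ
  h : Fin 4 → ℝ
  l₂ : Fin 4 → Fin 4 → ℝ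
  a₂ : Fin 4 → Fin 4 → ℝ
  p₂ : Fin 4 → Fin 4 → ℝ
  q₂ : Fin 4 → Fin 4 → ℝ
  γ₂ : Fin 4 → Fin 4 → ℝ
  h₂ : Fin 4 → Fin 4 → ℝ

namespace T2Jet

variable (j : T2Jet)

/-- The derivatives of `ln t`. -/
def dlogt (m : Fin 4) : ℝ := ![j.τ, 0, 0, 0] m

/-- The second derivatives of `ln t`. -/
def ddlogt (m n : Fin 4) : ℝ := ![![-j.τ ^ 2, 0, 0, 0], 0, 0, 0] m n

/-- The derivatives of `ln |cₑ|`, where `c₀ = -t^{-1/2} e^{λ/2}`, `c₁ = -c₀ / α`, `c₂ = t e^P`,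
`c₃ = t e^{-P}`. -/
noncomputable def f (m : Fin 4) : Fin 4 → ℝ :=
  ![j.l m / 2 - j.dlogt m / 2, j.l m / 2 - j.dlogt m / 2 - j.a m, j.dlogt m + j.p m,
    j.dlogt m - j.p m]

/-- The second derivatives of `ln |cₑ|`. -/
noncomputable def f₂ (m n : Fin 4) : Fin 4 → ℝ :=
  ![j.l₂ m n / 2 - j.ddlogt m n / 2, j.l₂ m n / 2 - j.ddlogt m n / 2 - j.a₂ m n,
    j.ddlogt m n + j.p₂ m n, j.ddlogt m n - j.p₂ m n]

/-- The derivatives of `cₑ`. -/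
noncomputable def dc (m e : Fin 4) : ℝ := j.c e * j.f m e

/-- The second derivatives of `cₑ`. -/
noncomputable def ddc (m n e : Fin 4) : ℝ := j.c e * (j.f m e * j.f n e + j.f₂ m n e)

/-- The components of the derivatives of the metric in the frame
`∂_t, ∂_θ - G ∂_x - H ∂_y, ∂_x, ∂_y - Q ∂_x`. -/
noncomputable def D (m : Fin 4) : Fin 4 → Fin 4 → ℝ :=
  ![![j.dc m 0, 0, 0, 0],
    ![0, j.dc m 1, j.c 2 * j.γ m, j.c 3 * j.h m],
    ![0, j.c 2 * j.γ m, j.dc m 2, j.c 2 * j.q m],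
    ![0, j.c 3 * j.h m, j.c 2 * j.q m, j.dc m 3]]

/-- The frame components of the second derivatives of the metric. -/
noncomputable def DD (m n : Fin 4) : Fin 4 → Fin 4 → ℝ :=
  let x := j.dc m 2 * j.γ n + j.dc n 2 * j.γ m + j.c 2 * j.γ₂ m n
  let y := j.dc m 3 * j.h n + j.dc n 3 * j.h m + j.c 3 * j.h₂ m n
    + j.c 2 * (j.γ m * j.q n + j.γ n * j.q m)
  let z := j.dc m 2 * j.q n + j.dc n 2 * j.q m + j.c 2 * j.q₂ m n
  ![![j.ddc m n 0, 0, 0, 0],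
    ![0, j.ddc m n 1 + 2 * j.c 2 * j.γ m * j.γ n + 2 * j.c 3 * j.h m * j.h n, x, y],
    ![0, x, j.ddc m n 2, z],
    ![0, y, z, j.ddc m n 3 + 2 * j.c 2 * j.q m * j.q n]]

/-- The Ricci tensor in the frame. -/
noncomputable def ric (b d : Fin 4) : ℝ := ricciFrame (fun e => (j.c e)⁻¹) j.D j.DD b d

/-- The constraints on the jet of fields that depend only on `(t, θ)`: derivatives along `x` and `y`
vanish and second derivatives are symmetric. -/
structure IsCylindrical : Prop where
  c : ∀ e, j.c e ≠ 0
  l : j.l 2 = 0 ∧ j.l 3 = 0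
  a : j.a 2 = 0 ∧ j.a 3 = 0
  p : j.p 2 = 0 ∧ j.p 3 = 0
  q : j.q 2 = 0 ∧ j.q 3 = 0
  γ : j.γ 2 = 0 ∧ j.γ 3 = 0
  h : j.h 2 = 0 ∧ j.h 3 = 0
  l₂ : ∀ m, j.l₂ m 2 = 0 ∧ j.l₂ m 3 = 0 ∧ j.l₂ 2 m = 0 ∧ j.l₂ 3 m = 0
  a₂ : ∀ m, j.a₂ m 2 = 0 ∧ j.a₂ m 3 = 0 ∧ j.a₂ 2 m = 0 ∧ j.a₂ 3 m = 0
  p₂ : ∀ m, j.p₂ m 2 = 0 ∧ j.p₂ m 3 = 0 ∧ j.p₂ 2 m = 0 ∧ j.p₂ 3 m = 0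
  q₂ : ∀ m, j.q₂ m 2 = 0 ∧ j.q₂ m 3 = 0 ∧ j.q₂ 2 m = 0 ∧ j.q₂ 3 m = 0
  γ₂ : ∀ m, j.γ₂ m 2 = 0 ∧ j.γ₂ m 3 = 0 ∧ j.γ₂ 2 m = 0 ∧ j.γ₂ 3 m = 0
  h₂ : ∀ m, j.h₂ m 2 = 0 ∧ j.h₂ m 3 = 0 ∧ j.h₂ 2 m = 0 ∧ j.h₂ 3 m = 0
  symm : j.l₂ 1 0 = j.l₂ 0 1 ∧ j.a₂ 1 0 = j.a₂ 0 1 ∧ j.p₂ 1 0 = j.p₂ 0 1 ∧ j.q₂ 1 0 = j.q₂ 0 1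
    ∧ j.γ₂ 1 0 = j.γ₂ 0 1 ∧ j.h₂ 1 0 = j.h₂ 0 1

variable {j}

lemma IsCylindrical.ric_02 (H : j.IsCylindrical) : j.ric 0 2
    = j.c 2 / (2 * j.c 1)
      * ((j.a 1 / 2 - j.l 1 / 2 + j.p 1) * j.γ 0 + (j.γ₂ 0 1 - j.q 0 * j.h 1)) := by
  have h0 := H.c 0
  have h1 := H.c 1
  have h2 := H.c 2
  have h3 := H.c 3
  simp [ric, ricciFrame, Fin.sum_univ_four, gammaLow, D, DD, dc, ddc, f, f₂, dlogt, ddlogt, H.l,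
    H.a, H.p, H.q, H.γ, H.h, H.l₂, H.a₂, H.p₂, H.q₂, H.γ₂, H.h₂, H.symm]
  field_simp
  ring

lemma IsCylindrical.ric_12 (H : j.IsCylindrical) : j.ric 1 2
    = -j.c 2 / (2 * j.c 0)
      * ((5 / 2 * j.τ + j.a 0 / 2 - j.l 0 / 2 + j.p 0) * j.γ 0 + (j.γ₂ 0 0 - j.q 0 * j.h 0)) := by
  have h0 := H.c 0
  have h1 := H.c 1
  have h2 := H.c 2
  have h3 := H.c 3
  simp [ric, ricciFrame, Fin.sum_univ_four, gammaLow, D, DD, dc, ddc, f, f₂, dlogt, ddlogt, H.l,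
    H.a, H.p, H.q, H.γ, H.h, H.l₂, H.a₂, H.p₂, H.q₂, H.γ₂, H.h₂]
  field_simp
  ring

lemma IsCylindrical.ric_03 (H : j.IsCylindrical) : j.ric 0 3
    = j.c 3 / (2 * j.c 1)
      * ((j.a 1 / 2 - j.l 1 / 2 - j.p 1) * j.h 0 + j.h₂ 0 1 + j.q 1 * (j.c 2 / j.c 3) * j.γ 0) := by
  have h0 := H.c 0
  have h1 := H.c 1
  have h2 := H.c 2
  have h3 := H.c 3
  simp [ric, ricciFrame, Fin.sum_univ_four, gammaLow, D, DD, dc, ddc, f, f₂, dlogt, ddlogt, H.l,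
    H.a, H.p, H.q, H.γ, H.h, H.l₂, H.a₂, H.p₂, H.q₂, H.γ₂, H.h₂, H.symm]
  field_simp
  ring

lemma IsCylindrical.ric_13 (H : j.IsCylindrical) : j.ric 1 3
    = -j.c 3 / (2 * j.c 0) * ((5 / 2 * j.τ + j.a 0 / 2 - j.l 0 / 2 - j.p 0) * j.h 0 + j.h₂ 0 0
        + j.q 0 * (j.c 2 / j.c 3) * j.γ 0) := by
  have h0 := H.c 0
  have h1 := H.c 1
  have h2 := H.c 2
  have h3 := H.c 3
  simp [ric, ricciFrame, Fin.sum_univ_four, gammaLow, D, DD, dc, ddc, f, f₂, dlogt, ddlogt, H.l,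
    H.a, H.p, H.q, H.γ, H.h, H.l₂, H.a₂, H.p₂, H.q₂, H.γ₂, H.h₂]
  field_simp
  ring

lemma IsCylindrical.ric_22_add_33 (H : j.IsCylindrical) : j.ric 2 2 / j.c 2 + j.ric 3 3 / j.c 3
      = (j.a 0 * j.τ + (j.c 2 * j.γ 0 ^ 2 + j.c 3 * j.h 0 ^ 2) / j.c 1) / (2 * j.c 0) := by
  have h0 := H.c 0
  have h1 := H.c 1
  have h2 := H.c 2
  have h3 := H.c 3
  simp [ric, ricciFrame, Fin.sum_univ_four, gammaLow, D, DD, dc, ddc, f, f₂, dlogt, ddlogt, H.l,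
    H.a, H.p, H.q, H.γ, H.h, H.l₂, H.a₂, H.p₂, H.q₂, H.γ₂, H.h₂]
  field_simp
  ring

lemma IsCylindrical.ric_22_sub_33 (H : j.IsCylindrical) : j.ric 2 2 / j.c 2 - j.ric 3 3 / j.c 3
      = -(1 / j.c 0) * (j.p₂ 0 0 + j.τ * j.p 0 - j.a 0 / 2 * j.p 0
        + j.c 0 / j.c 1 * (j.p₂ 1 1 + j.a 1 / 2 * j.p 1)
        - j.c 2 / j.c 3 * (j.q 0 ^ 2 + j.c 0 / j.c 1 * j.q 1 ^ 2)
        - (j.c 2 * j.γ 0 ^ 2 - j.c 3 * j.h 0 ^ 2) / (2 * j.c 1)) := by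
  have h0 := H.c 0
  have h1 := H.c 1
  have h2 := H.c 2
  have h3 := H.c 3
  simp [ric, ricciFrame, Fin.sum_univ_four, gammaLow, D, DD, dc, ddc, f, f₂, dlogt, ddlogt, H.l,
    H.a, H.p, H.q, H.γ, H.h, H.l₂, H.a₂, H.p₂, H.q₂, H.γ₂, H.h₂]
  field_simp
  ring

lemma IsCylindrical.ric_23 (H : j.IsCylindrical) : j.ric 2 3
      = -(j.c 2 / (2 * j.c 0)) * (j.q₂ 0 0 + j.τ * j.q 0 - j.a 0 / 2 * j.q 0
        + j.c 0 / j.c 1 * (j.q₂ 1 1 + j.a 1 / 2 * j.q 1)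
        + 2 * (j.p 0 * j.q 0 + j.c 0 / j.c 1 * (j.p 1 * j.q 1)) - j.c 3 * j.γ 0 * j.h 0 / j.c 1) := by
  have h0 := H.c 0
  have h1 := H.c 1
  have h2 := H.c 2
  have h3 := H.c 3
  simp [ric, ricciFrame, Fin.sum_univ_four, gammaLow, D, DD, dc, ddc, f, f₂, dlogt, ddlogt, H.l,
    H.a, H.p, H.q, H.γ, H.h, H.l₂, H.a₂, H.p₂, H.q₂, H.γ₂, H.h₂]
  field_simp
  ring

lemma IsCylindrical.ric_01 (H : j.IsCylindrical) : j.ric 0 1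
      = j.l 1 * j.τ / 4 - (1 / 2) * (j.p 0 * j.p 1 + j.c 2 / j.c 3 * (j.q 0 * j.q 1)) := by
  have h0 := H.c 0
  have h1 := H.c 1
  have h2 := H.c 2
  have h3 := H.c 3
  simp [ric, ricciFrame, Fin.sum_univ_four, gammaLow, D, DD, dc, ddc, f, f₂, dlogt, ddlogt, H.l,
    H.a, H.p, H.q, H.γ, H.h, H.l₂, H.a₂, H.γ₂, H.h₂, H.symm]
  field_simp
  ring

lemma IsCylindrical.ric_00_sub_11 (H : j.IsCylindrical) : j.ric 0 0 - j.c 0 / j.c 1 * j.ric 1 1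
      = (1 / 2) * (j.τ * j.l 0 - j.τ * j.a 0 - (j.p 0 ^ 2 - j.c 0 / j.c 1 * j.p 1 ^ 2
        + j.c 2 / j.c 3 * (j.q 0 ^ 2 - j.c 0 / j.c 1 * j.q 1 ^ 2))) := by
  have h0 := H.c 0
  have h1 := H.c 1
  have h2 := H.c 2
  have h3 := H.c 3
  simp [ric, ricciFrame, Fin.sum_univ_four, gammaLow, D, DD, dc, ddc, f, f₂, dlogt, ddlogt, H.l,
    H.a, H.p, H.q, H.γ, H.h, H.l₂, H.a₂, H.γ₂, H.h₂, H.symm]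
  field_simp
  ring

lemma IsCylindrical.wave (H : j.IsCylindrical) (φ : Fin 4 → ℝ) (φ₂ : Fin 4 → Fin 4 → ℝ) (h₂ : φ₂ 2 2 = 0)
    (h₃ : φ₂ 3 3 = 0) (h₂' : φ 2 = 0) (h₃' : φ 3 = 0) :
    ∑ a, (j.c a)⁻¹ * (φ₂ a a - ∑ m, (j.c m)⁻¹ * (gammaLow j.D m a a * φ m))
      = 1 / j.c 0 * (φ₂ 0 0 + j.τ * φ 0 - j.a 0 / 2 * φ 0
        + j.c 0 / j.c 1 * (φ₂ 1 1 + j.a 1 / 2 * φ 1)) := by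
  have h0 := H.c 0
  have h1 := H.c 1
  have h2 := H.c 2
  have h3 := H.c 3
  simp [Fin.sum_univ_four, gammaLow, D, dc, f, dlogt, H.l, H.a, H.p, H.q, H.γ, H.h, h₂, h₃, h₂', h₃']
  field_simp
  ring

end T2Jet

end JetAlgebra

/-! ### The metric and its jet -/

section Metric

variable {t₀ t θ : ℝ} {f h : ℝ → ℝ → ℝ}

lemma dd_sub (m : Fin 4) (hf : Sm t₀ f) (hh : Sm t₀ h) (ht : t₀ < t) (θ : ℝ) :
    dd m (fun t θ => f t θ - h t θ) t θ = dd m f t θ - dd m h t θ := by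
  fin_cases m
  · exact ((hf.hasDerivAt_t ht θ).fun_sub (hh.hasDerivAt_t ht θ)).deriv
  · exact ((hf.hasDerivAt_th ht θ).fun_sub (hh.hasDerivAt_th ht θ)).deriv
  all_goals simp [dd]

lemma dd_const_mul (m : Fin 4) (c : ℝ) (f : ℝ → ℝ → ℝ) (t θ : ℝ) :
    dd m (fun t θ => c * f t θ) t θ = c * dd m f t θ := by
  fin_cases m <;> simp [dd, dt, dth]

lemma dd_exp (m : Fin 4) (hf : Sm t₀ f) (ht : t₀ < t) (θ : ℝ) :
    dd m (fun t θ => Real.exp (f t θ)) t θ = Real.exp (f t θ) * dd m f t θ := by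
  fin_cases m
  · exact (hf.hasDerivAt_t ht θ).exp.deriv
  · exact (hf.hasDerivAt_th ht θ).exp.deriv
  all_goals simp [dd]

lemma dd_log_time (m : Fin 4) (t θ : ℝ) :
    dd m (fun t _ => Real.log t) t θ = ![t⁻¹, 0, 0, 0] m := by
  fin_cases m <;> simp [dd, dt, dth]

lemma dd_dd_log_time (m n : Fin 4) (t θ : ℝ) :
    dd m (dd n fun t _ => Real.log t) t θ = ![![-(t⁻¹) ^ 2, 0, 0, 0], 0, 0, 0] m n := by
  have : dd n (fun t _ => Real.log t) = fun t _ => ![t⁻¹, 0, 0, 0] n := by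
    ext t θ; exact dd_log_time n t θ
  rw [this]
  fin_cases m <;> fin_cases n <;> simp [dd, dt, dth]

lemma Sm.log_time (ht₀ : 0 ≤ t₀) : Sm t₀ fun t _ => Real.log t :=
  Sm.time.log fun _ _ ht => (ht₀.trans_lt ht).ne'

lemma dd_dd_comm (m n : Fin 4) (hf : Sm t₀ f) (ht : t₀ < t) (θ : ℝ) :
    dd m (dd n f) t θ = dd n (dd m f) t θ := by
  fin_cases m <;> fin_cases n <;> try rfl
  · exact hf.dt_dth_comm ht θ
  · simpa [dd] using dd_const 0 0 t θ
  · simpa [dd] using dd_const 0 0 t θ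
  · exact (hf.dt_dth_comm ht θ).symm
  · simpa [dd] using dd_const 1 0 t θ
  · simpa [dd] using dd_const 1 0 t θ
  · simpa [dd] using (dd_const 0 0 t θ).symm
  · simpa [dd] using (dd_const 1 0 t θ).symm
  · simpa [dd] using (dd_const 0 0 t θ).symm
  · simpa [dd] using (dd_const 1 0 t θ).symm

@[simp] lemma dd_two (f : ℝ → ℝ → ℝ) : dd 2 f = fun _ _ => 0 := rfl

@[simp] lemma dd_three (f : ℝ → ℝ → ℝ) : dd 3 f = fun _ _ => 0 := rfl

lemma dd_zero_fun (m : Fin 4) : dd m (fun _ _ => (0 : ℝ)) = fun _ _ => 0 := by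
  ext t θ; exact dd_const m 0 t θ

namespace Fields

variable (u : Fields)

/-- The logarithms of the absolute values of the coefficients `c₀, …, c₃` of the metric with respect
to the coframe `dt, dθ, dx + Q dy + (G + QH) dθ, dy + H dθ`. -/
noncomputable def logCoeff : Fin 4 → ℝ → ℝ → ℝ :=
  ![fun t θ => (1 / 2) * u.lam t θ - (1 / 2) * Real.log t,
    fun t θ => (1 / 2) * u.lam t θ - (1 / 2) * Real.log t - Real.log (u.α t θ),
    fun t θ => Real.log t + u.P t θ, fun t θ => Real.log t - u.P t θ]

/-- The coefficients of the metric with respect to the coframe. -/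
noncomputable def coeff (e : Fin 4) (t θ : ℝ) : ℝ :=
  ![-1, 1, 1, 1] e * Real.exp (u.logCoeff e t θ)

/-- The components of the coframe. -/
def coframe : Fin 4 → Fin 4 → ℝ → ℝ → ℝ :=
  ![![fun _ _ => 1, fun _ _ => 0, fun _ _ => 0, fun _ _ => 0],
    ![fun _ _ => 0, fun _ _ => 1, fun _ _ => 0, fun _ _ => 0],
    ![fun _ _ => 0, fun t θ => u.G t θ + u.Q t θ * u.H t θ, fun _ _ => 1, u.Q],
    ![fun _ _ => 0, u.H, fun _ _ => 0, fun _ _ => 1]]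

/-- The components of the dual frame: `frame i b` is the component along `∂ᵢ` of the frame vector
with index `b`. -/
def frame (t θ : ℝ) : Fin 4 → Fin 4 → ℝ :=
  ![![1, 0, 0, 0], ![0, 1, 0, 0], ![0, -u.G t θ, 1, -u.Q t θ], ![0, -u.H t θ, 0, 1]]

/-- The components of the metric as functions of `(t, θ)`. -/
noncomputable def comp (i j : Fin 4) (t θ : ℝ) : ℝ :=
  ∑ e, u.coeff e t θ * u.coframe e i t θ * u.coframe e j t θ

/-- The components of the inverse metric as functions of `(t, θ)`. -/
noncomputable def invComp (i j : Fin 4) (t θ : ℝ) : ℝ :=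
  ∑ e, (u.coeff e t θ)⁻¹ * u.frame t θ i e * u.frame t θ j e

lemma coeff_ne_zero (e : Fin 4) (t θ : ℝ) : u.coeff e t θ ≠ 0 := by
  unfold coeff
  fin_cases e <;> simp [Real.exp_ne_zero]

lemma frameComp_coframe (e b : Fin 4) (t θ : ℝ) :
    frameComp (u.frame t θ) b (fun i => u.coframe e i t θ) = if e = b then 1 else 0 := by
  fin_cases e <;> fin_cases b <;>
    simp [frameComp, Fin.sum_univ_four, frame, coframe]
  ring

end Fields

end Metric

namespace IsT2Solution

variable {t₀ : ℝ} {V : ℝ → ℝ} {u : Fields}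

lemma smα (hu : IsT2Solution t₀ V u) : Sm t₀ u.α := hu.smooth_α.1
lemma smlam (hu : IsT2Solution t₀ V u) : Sm t₀ u.lam := hu.smooth_lam.1
lemma smP (hu : IsT2Solution t₀ V u) : Sm t₀ u.P := hu.smooth_P.1
lemma smQ (hu : IsT2Solution t₀ V u) : Sm t₀ u.Q := hu.smooth_Q.1
lemma smG (hu : IsT2Solution t₀ V u) : Sm t₀ u.G := hu.smooth_G.1
lemma smH (hu : IsT2Solution t₀ V u) : Sm t₀ u.H := hu.smooth_H.1
lemma smφ (hu : IsT2Solution t₀ V u) : Sm t₀ u.φ := hu.smooth_φ.1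

lemma smlogα (hu : IsT2Solution t₀ V u) : Sm t₀ fun t θ => Real.log (u.α t θ) :=
  hu.smα.log fun t θ ht => (hu.α_pos t θ ht).ne'

lemma sm_logCoeff (hu : IsT2Solution t₀ V u) (ht₀ : 0 ≤ t₀) (e : Fin 4) :
    Sm t₀ (u.logCoeff e) := by
  have h1 := ((Sm.const (1 / 2)).mul hu.smlam).sub ((Sm.const (1 / 2)).mul (Sm.log_time ht₀))
  fin_cases e
  exacts [h1, h1.sub hu.smlogα, (Sm.log_time ht₀).add hu.smP, (Sm.log_time ht₀).sub hu.smP]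

lemma sm_coeff (hu : IsT2Solution t₀ V u) (ht₀ : 0 ≤ t₀) (e : Fin 4) : Sm t₀ (u.coeff e) :=
  (Sm.const _).mul (hu.sm_logCoeff ht₀ e).exp

lemma sm_coframe (hu : IsT2Solution t₀ V u) (e i : Fin 4) : Sm t₀ (u.coframe e i) := by
  fin_cases e <;> fin_cases i <;> first
    | exact Sm.const _
    | exact hu.smQ
    | exact hu.smH
    | exact hu.smG.add (hu.smQ.mul hu.smH)

lemma sm_frame (hu : IsT2Solution t₀ V u) (i b : Fin 4) :
    Sm t₀ (fun t θ => u.frame t θ i b) := by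
  fin_cases i <;> fin_cases b <;> first
    | exact Sm.const _
    | exact hu.smQ.neg
    | exact hu.smH.neg
    | exact hu.smG.neg

lemma sm_comp (hu : IsT2Solution t₀ V u) (ht₀ : 0 ≤ t₀) (i j : Fin 4) : Sm t₀ (u.comp i j) :=
  Sm.sum fun e _ => ((hu.sm_coeff ht₀ e).mul (hu.sm_coframe e i)).mul (hu.sm_coframe e j)

lemma sm_invComp (hu : IsT2Solution t₀ V u) (ht₀ : 0 ≤ t₀) (i j : Fin 4) :
    Sm t₀ (u.invComp i j) :=
  Sm.sum fun e _ => (((hu.sm_coeff ht₀ e).inv fun t θ _ => u.coeff_ne_zero e t θ).mul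
    (hu.sm_frame i e)).mul (hu.sm_frame j e)

lemma metric_apply (hu : IsT2Solution t₀ V u) (ht₀ : 0 ≤ t₀) {p : Fin 4 → ℝ} (hp : t₀ < p 0)
    (i j : Fin 4) : u.metric p i j = u.comp i j (p 0) (p 1) := by
  have h0 : 0 < p 0 := ht₀.trans_lt hp
  have h1 : (p 0) ^ (-(1 / 2) : ℝ) * Real.exp (u.lam (p 0) (p 1) / 2)
      = Real.exp ((1 / 2) * u.lam (p 0) (p 1) - (1 / 2) * Real.log (p 0)) := by
    rw [Real.rpow_def_of_pos h0, ← Real.exp_add]; ring_nf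
  have h2 : Real.exp ((1 / 2) * u.lam (p 0) (p 1) - (1 / 2) * Real.log (p 0)
      - Real.log (u.α (p 0) (p 1)))
      = Real.exp ((1 / 2) * u.lam (p 0) (p 1) - (1 / 2) * Real.log (p 0)) * (u.α (p 0) (p 1))⁻¹ := by
    rw [Real.exp_sub, Real.exp_log (hu.α_pos _ _ hp), div_eq_mul_inv]
  have h3 : Real.exp (Real.log (p 0) + u.P (p 0) (p 1)) = p 0 * Real.exp (u.P (p 0) (p 1)) := by
    rw [Real.exp_add, Real.exp_log h0]
  have h4 : Real.exp (Real.log (p 0) - u.P (p 0) (p 1)) = p 0 * Real.exp (-u.P (p 0) (p 1)) := by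
    rw [sub_eq_add_neg, Real.exp_add, Real.exp_log h0]
  simp only [Fields.metric, h1, Fields.comp, Fin.sum_univ_four, Fields.coeff]
  rw [show u.logCoeff 1 (p 0) (p 1) = (1 / 2) * u.lam (p 0) (p 1) - (1 / 2) * Real.log (p 0)
      - Real.log (u.α (p 0) (p 1)) from rfl, h2,
    show u.logCoeff 2 (p 0) (p 1) = Real.log (p 0) + u.P (p 0) (p 1) from rfl, h3,
    show u.logCoeff 3 (p 0) (p 1) = Real.log (p 0) - u.P (p 0) (p 1) from rfl, h4,
    show u.logCoeff 0 (p 0) (p 1) = (1 / 2) * u.lam (p 0) (p 1) - (1 / 2) * Real.log (p 0) from rfl]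
  fin_cases i <;> fin_cases j <;>
    simp [formSq, Fields.coframe] <;> ring

lemma invComp_mul_metric (hu : IsT2Solution t₀ V u) (ht₀ : 0 ≤ t₀) {p : Fin 4 → ℝ}
    (hp : t₀ < p 0) : (Matrix.of fun i j => u.invComp i j (p 0) (p 1)) * u.metric p = 1 := by
  have hc := fun e => u.coeff_ne_zero e (p 0) (p 1)
  ext i j
  rw [Matrix.mul_apply]
  simp only [hu.metric_apply ht₀ hp, Fields.comp, Fields.invComp, Matrix.of_apply,
    Fin.sum_univ_four]
  fin_cases i <;> fin_cases j <;>
    simp [Fields.coframe, Fields.frame, hc] <;> field_simp [hc] <;> ring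

lemma inv_apply (hu : IsT2Solution t₀ V u) (ht₀ : 0 ≤ t₀) {p : Fin 4 → ℝ} (hp : t₀ < p 0)
    (i j : Fin 4) : (u.metric p)⁻¹ i j = u.invComp i j (p 0) (p 1) := by
  rw [Matrix.inv_eq_left_inv (hu.invComp_mul_metric ht₀ hp), Matrix.of_apply]

lemma eventually_mem {p : Fin 4 → ℝ} (hp : t₀ < p 0) : ∀ᶠ q in 𝓝 p, t₀ < q 0 :=
  (continuous_apply (0 : Fin 4)).continuousAt.eventually (eventually_gt_nhds hp)

lemma isMetricAt (hu : IsT2Solution t₀ V u) (ht₀ : 0 ≤ t₀) {p : Fin 4 → ℝ} (hp : t₀ < p 0) :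
    IsMetricAt u.metric p := by
  refine ⟨fun i j => ?_, fun i j => ?_, ?_, ?_⟩
  · exact ((hu.sm_comp ht₀ i j).contDiffAt_cylinder hp).congr_of_eventuallyEq
      ((eventually_mem hp).mono fun q hq => hu.metric_apply ht₀ hq i j)
  · exact ((hu.sm_invComp ht₀ i j).contDiffAt_cylinder hp).congr_of_eventuallyEq
      ((eventually_mem hp).mono fun q hq => hu.inv_apply ht₀ hq i j)
  · filter_upwards [eventually_mem hp] with q hq i j
    rw [hu.metric_apply ht₀ hq, hu.metric_apply ht₀ hq]
    exact Finset.sum_congr rfl fun e _ => by ring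
  · filter_upwards [eventually_mem hp] with q hq
    rw [Matrix.inv_eq_left_inv (hu.invComp_mul_metric ht₀ hq), hu.invComp_mul_metric ht₀ hq]

lemma pd_metric (hu : IsT2Solution t₀ V u) (ht₀ : 0 ≤ t₀) {p : Fin 4 → ℝ} (hp : t₀ < p 0)
    (m i j : Fin 4) :
    pd m (fun q => u.metric q i j) p = dd m (u.comp i j) (p 0) (p 1) := by
  rw [pd_congr m ((eventually_mem hp).mono fun q hq => hu.metric_apply ht₀ hq i j), pd_cylinder]

lemma pd_pd_metric (hu : IsT2Solution t₀ V u) (ht₀ : 0 ≤ t₀) {p : Fin 4 → ℝ} (hp : t₀ < p 0)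
    (m n i j : Fin 4) :
    pd m (pd n fun q => u.metric q i j) p = dd m (dd n (u.comp i j)) (p 0) (p 1) := by
  rw [pd_congr m ((eventually_mem hp).mono fun q hq => hu.pd_metric ht₀ hq n i j), pd_cylinder]

end IsT2Solution

/-- The 2-jet of the fields at a point. -/
noncomputable def Fields.jet (u : Fields) (t θ : ℝ) : T2Jet where
  c e := u.coeff e t θ
  τ := t⁻¹
  l m := dd m u.lam t θ
  a m := dd m (fun t θ => Real.log (u.α t θ)) t θ
  p m := dd m u.P t θ
  q m := dd m u.Q t θ
  γ m := dd m u.G t θ + u.Q t θ * dd m u.H t θ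
  h m := dd m u.H t θ
  l₂ m n := dd m (dd n u.lam) t θ
  a₂ m n := dd m (dd n fun t θ => Real.log (u.α t θ)) t θ
  p₂ m n := dd m (dd n u.P) t θ
  q₂ m n := dd m (dd n u.Q) t θ
  γ₂ m n := dd m (dd n u.G) t θ + u.Q t θ * dd m (dd n u.H) t θ + dd m u.Q t θ * dd n u.H t θ
    + dd n u.Q t θ * dd m u.H t θ
  h₂ m n := dd m (dd n u.H) t θ

namespace IsT2Solution

variable {t₀ t : ℝ} {V : ℝ → ℝ} {u : Fields}

lemma isCylindrical_jet (hu : IsT2Solution t₀ V u) (ht : t₀ < t) (θ : ℝ) :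
    (u.jet t θ).IsCylindrical where
  c e := u.coeff_ne_zero e t θ
  l := by simp [Fields.jet]
  a := by simp [Fields.jet]
  p := by simp [Fields.jet]
  q := by simp [Fields.jet]
  γ := by simp [Fields.jet]
  h := by simp [Fields.jet]
  l₂ m := by simp [Fields.jet, dd_zero_fun]
  a₂ m := by simp [Fields.jet, dd_zero_fun]
  p₂ m := by simp [Fields.jet, dd_zero_fun]
  q₂ m := by simp [Fields.jet, dd_zero_fun]
  γ₂ m := by simp [Fields.jet, dd_zero_fun]
  h₂ m := by simp [Fields.jet, dd_zero_fun]
  symm := by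
    refine ⟨dd_dd_comm 1 0 hu.smlam ht θ, dd_dd_comm 1 0 hu.smlogα ht θ, dd_dd_comm 1 0 hu.smP ht θ,
      dd_dd_comm 1 0 hu.smQ ht θ, ?_, dd_dd_comm 1 0 hu.smH ht θ⟩
    simp only [Fields.jet]
    rw [dd_dd_comm 1 0 hu.smG ht θ, dd_dd_comm 1 0 hu.smH ht θ]
    ring

lemma dd_logCoeff (hu : IsT2Solution t₀ V u) (ht₀ : 0 ≤ t₀) (m e : Fin 4) (ht : t₀ < t) (θ : ℝ) :
    dd m (u.logCoeff e) t θ = (u.jet t θ).f m e := by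
  have hlam := (Sm.const (1 / 2)).mul hu.smlam
  have hlog := Sm.log_time ht₀
  have hlog' := (Sm.const (1 / 2)).mul hlog
  have h1 := hlam.sub hlog'
  have e1 : dd m (fun t θ => (1 / 2) * u.lam t θ - (1 / 2) * Real.log t) t θ
      = dd m u.lam t θ / 2 - ![t⁻¹, 0, 0, 0] m / 2 := by
    rw [dd_sub m hlam hlog' ht, dd_const_mul, dd_const_mul, dd_log_time]; ring
  fin_cases e
  · exact e1
  · exact (dd_sub m h1 hu.smlogα ht θ).trans (by rw [e1]; rfl)
  · exact (dd_add m hlog hu.smP ht θ).trans (by rw [dd_log_time]; rfl)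
  · exact (dd_sub m hlog hu.smP ht θ).trans (by rw [dd_log_time]; rfl)

lemma dd_dd_logCoeff (hu : IsT2Solution t₀ V u) (ht₀ : 0 ≤ t₀) (m n e : Fin 4) (ht : t₀ < t)
    (θ : ℝ) : dd m (dd n (u.logCoeff e)) t θ = (u.jet t θ).f₂ m n e := by
  have hlam := hu.smlam.dd n
  have hlog := (Sm.log_time ht₀).dd n
  have hlam' := (Sm.const (1 / 2)).mul hlam
  have hlog' := (Sm.const (1 / 2)).mul hlog
  have hlogα := hu.smlogα.dd n
  have hP := hu.smP.dd n
  have e0 : ∀ s ϑ, t₀ < s → dd n (u.logCoeff 0) s ϑ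
      = (1 / 2) * dd n u.lam s ϑ - (1 / 2) * dd n (fun t _ => Real.log t) s ϑ := by
    intro s ϑ hs
    exact (dd_sub n ((Sm.const _).mul hu.smlam) ((Sm.const _).mul (Sm.log_time ht₀)) hs ϑ).trans
      (by rw [dd_const_mul, dd_const_mul])
  have e1 : dd m (dd n (u.logCoeff 0)) t θ
      = dd m (dd n u.lam) t θ / 2 - ![![-(t⁻¹) ^ 2, 0, 0, 0], 0, 0, 0] m n / 2 := by
    rw [dd_congr m e0 ht, dd_sub m hlam' hlog' ht, dd_const_mul, dd_const_mul, dd_dd_log_time]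
    ring
  fin_cases e
  · exact e1
  · refine (dd_congr m (fun s ϑ hs => dd_sub n (hu.sm_logCoeff ht₀ 0) hu.smlogα hs ϑ) ht θ).trans ?_
    rw [dd_sub m ((hu.sm_logCoeff ht₀ 0).dd n) hlogα ht, e1]; rfl
  · refine (dd_congr m (fun s ϑ hs => dd_add n (Sm.log_time ht₀) hu.smP hs ϑ) ht θ).trans ?_
    rw [dd_add m hlog hP ht, dd_dd_log_time]; rfl
  · refine (dd_congr m (fun s ϑ hs => dd_sub n (Sm.log_time ht₀) hu.smP hs ϑ) ht θ).trans ?_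
    rw [dd_sub m hlog hP ht, dd_dd_log_time]; rfl

lemma dd_coeff (hu : IsT2Solution t₀ V u) (ht₀ : 0 ≤ t₀) (m e : Fin 4) (ht : t₀ < t) (θ : ℝ) :
    dd m (u.coeff e) t θ = u.coeff e t θ * dd m (u.logCoeff e) t θ := by
  refine (dd_const_mul m _ _ t θ).trans ?_
  rw [dd_exp m (hu.sm_logCoeff ht₀ e) ht, ← mul_assoc]; rfl

lemma dd_dd_coeff (hu : IsT2Solution t₀ V u) (ht₀ : 0 ≤ t₀) (m n e : Fin 4) (ht : t₀ < t)
    (θ : ℝ) : dd m (dd n (u.coeff e)) t θ = (u.jet t θ).ddc m n e := by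
  rw [dd_congr m (fun s ϑ hs => hu.dd_coeff ht₀ n e hs ϑ) ht,
    dd_mul m (hu.sm_coeff ht₀ e) ((hu.sm_logCoeff ht₀ e).dd n) ht, hu.dd_coeff ht₀ m e ht,
    hu.dd_dd_logCoeff ht₀ m n e ht, hu.dd_logCoeff ht₀ m e ht, hu.dd_logCoeff ht₀ n e ht,
    T2Jet.ddc]
  simp only [Fields.jet]
  ring

lemma frameComp_dd_coframe (hu : IsT2Solution t₀ V u) (m e b : Fin 4) (ht : t₀ < t) (θ : ℝ) :
    frameComp (u.frame t θ) b (fun i => dd m (u.coframe e i) t θ)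
      = ![![0, 0, 0, 0], ![0, 0, 0, 0], ![0, (u.jet t θ).γ m, 0, (u.jet t θ).q m],
        ![0, (u.jet t θ).h m, 0, 0]] e b := by
  have h1 : dd m (fun t θ => u.G t θ + u.Q t θ * u.H t θ) t θ = dd m u.G t θ
      + (dd m u.Q t θ * u.H t θ + u.Q t θ * dd m u.H t θ) := by
    rw [dd_add m hu.smG (hu.smQ.mul hu.smH) ht, dd_mul m hu.smQ hu.smH ht]
  fin_cases e <;> fin_cases b <;>
    simp [frameComp, Fin.sum_univ_four, Fields.frame, Fields.coframe, Fields.jet, dd_const, h1]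
  ring

lemma frameComp_dd_dd_coframe (hu : IsT2Solution t₀ V u) (m n e b : Fin 4) (ht : t₀ < t) (θ : ℝ) :
    frameComp (u.frame t θ) b (fun i => dd m (dd n (u.coframe e i)) t θ)
      = ![![0, 0, 0, 0], ![0, 0, 0, 0], ![0, (u.jet t θ).γ₂ m n, 0, (u.jet t θ).q₂ m n],
        ![0, (u.jet t θ).h₂ m n, 0, 0]] e b := by
  have h0 : ∀ c : ℝ, dd n (fun _ _ => c) = fun _ _ => 0 := fun c => by
    ext t θ; exact dd_const n c t θ
  have h1 : ∀ s ϑ, t₀ < s → dd n (fun t θ => u.G t θ + u.Q t θ * u.H t θ) s ϑ = dd n u.G s ϑ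
      + (dd n u.Q s ϑ * u.H s ϑ + u.Q s ϑ * dd n u.H s ϑ) := by
    intro s ϑ hs
    rw [dd_add n hu.smG (hu.smQ.mul hu.smH) hs, dd_mul n hu.smQ hu.smH hs]
  have h2 : dd m (dd n fun t θ => u.G t θ + u.Q t θ * u.H t θ) t θ = dd m (dd n u.G) t θ
      + (dd m (dd n u.Q) t θ * u.H t θ + dd n u.Q t θ * dd m u.H t θ
        + (dd m u.Q t θ * dd n u.H t θ + u.Q t θ * dd m (dd n u.H) t θ)) := by
    rw [dd_congr m h1 ht, dd_add m (hu.smG.dd n) (((hu.smQ.dd n).mul hu.smH).add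
      (hu.smQ.mul (hu.smH.dd n))) ht, dd_add m ((hu.smQ.dd n).mul hu.smH)
      (hu.smQ.mul (hu.smH.dd n)) ht, dd_mul m (hu.smQ.dd n) hu.smH ht,
      dd_mul m hu.smQ (hu.smH.dd n) ht]
  fin_cases e <;> fin_cases b <;>
    simp [frameComp, Fin.sum_univ_four, Fields.frame, Fields.coframe, Fields.jet, dd_const, h0, h2]
  ring

lemma dd_comp (hu : IsT2Solution t₀ V u) (ht₀ : 0 ≤ t₀) (m i j : Fin 4) (ht : t₀ < t) (θ : ℝ) :
    dd m (u.comp i j) t θ = ∑ e, ((dd m (u.coeff e) t θ * u.coframe e i t θ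
      + u.coeff e t θ * dd m (u.coframe e i) t θ) * u.coframe e j t θ
      + u.coeff e t θ * u.coframe e i t θ * dd m (u.coframe e j) t θ) := by
  have hc := hu.sm_coeff ht₀
  have hw := hu.sm_coframe
  refine (dd_sum m _ (fun e => ((hc e).mul (hw e i)).mul (hw e j)) ht θ).trans ?_
  refine Finset.sum_congr rfl fun e _ => ?_
  rw [dd_mul m ((hc e).mul (hw e i)) (hw e j) ht, dd_mul m (hc e) (hw e i) ht]

lemma dd_dd_comp (hu : IsT2Solution t₀ V u) (ht₀ : 0 ≤ t₀) (m n i j : Fin 4) (ht : t₀ < t)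
    (θ : ℝ) : dd m (dd n (u.comp i j)) t θ = ∑ e,
      ((dd m (dd n (u.coeff e)) t θ * u.coframe e i t θ
          + dd n (u.coeff e) t θ * dd m (u.coframe e i) t θ
          + (dd m (u.coeff e) t θ * dd n (u.coframe e i) t θ
            + u.coeff e t θ * dd m (dd n (u.coframe e i)) t θ)) * u.coframe e j t θ
        + (dd n (u.coeff e) t θ * u.coframe e i t θ
          + u.coeff e t θ * dd n (u.coframe e i) t θ) * dd m (u.coframe e j) t θ
        + ((dd m (u.coeff e) t θ * u.coframe e i t θ
          + u.coeff e t θ * dd m (u.coframe e i) t θ) * dd n (u.coframe e j) t θ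
          + u.coeff e t θ * u.coframe e i t θ * dd m (dd n (u.coframe e j)) t θ)) := by
  have hc := hu.sm_coeff ht₀
  have hw := hu.sm_coframe
  have h1 := fun e => ((hc e).dd n).mul (hw e i)
  have h2 := fun e => (hc e).mul ((hw e i).dd n)
  have h3 := fun e => ((h1 e).add (h2 e)).mul (hw e j)
  have h4 := fun e => ((hc e).mul (hw e i)).mul ((hw e j).dd n)
  rw [dd_congr m (fun s ϑ hs => hu.dd_comp ht₀ n i j hs ϑ) ht,
    dd_sum m _ (fun e => (h3 e).add (h4 e)) ht]
  refine Finset.sum_congr rfl fun e _ => ?_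
  rw [dd_add m (h3 e) (h4 e) ht, dd_mul m ((h1 e).add (h2 e)) (hw e j) ht,
    dd_add m (h1 e) (h2 e) ht, dd_mul m ((hc e).dd n) (hw e i) ht,
    dd_mul m (hc e) ((hw e i).dd n) ht, dd_mul m ((hc e).mul (hw e i)) ((hw e j).dd n) ht,
    dd_mul m (hc e) (hw e i) ht]

lemma frameComp_dd_comp (hu : IsT2Solution t₀ V u) (ht₀ : 0 ≤ t₀) (m b d : Fin 4) (ht : t₀ < t)
    (θ : ℝ) : (frameComp (u.frame t θ) b fun i => frameComp (u.frame t θ) d fun j =>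
      dd m (u.comp i j) t θ) = (u.jet t θ).D m b d := by
  simp only [hu.dd_comp ht₀ m _ _ ht, frameComp_sum, frameComp_add, frameComp_const_mul,
    frameComp_mul_const, u.frameComp_coframe, hu.frameComp_dd_coframe _ _ _ ht,
    hu.dd_coeff ht₀ m _ ht, hu.dd_logCoeff ht₀ m _ ht]
  fin_cases b <;> fin_cases d <;>
    simp [Fin.sum_univ_four, T2Jet.D, T2Jet.dc, Fields.jet]

lemma frameComp_dd_dd_comp (hu : IsT2Solution t₀ V u) (ht₀ : 0 ≤ t₀) (m n b d : Fin 4)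
    (ht : t₀ < t) (θ : ℝ) :
    (frameComp (u.frame t θ) b fun i => frameComp (u.frame t θ) d fun j =>
      dd m (dd n (u.comp i j)) t θ) = (u.jet t θ).DD m n b d := by
  simp only [hu.dd_dd_comp ht₀ m n _ _ ht, frameComp_sum, frameComp_add, frameComp_const_mul,
    frameComp_mul_const, u.frameComp_coframe, hu.frameComp_dd_coframe _ _ _ ht,
    hu.frameComp_dd_dd_coframe _ _ _ _ ht, hu.dd_coeff ht₀ _ _ ht, hu.dd_logCoeff ht₀ _ _ ht,
    hu.dd_dd_coeff ht₀ _ _ _ ht]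
  fin_cases b <;> fin_cases d <;>
    simp [Fin.sum_univ_four, T2Jet.DD, T2Jet.dc] <;> simp [Fields.jet] <;> ring

end IsT2Solution

/-! ### The Einstein equations in terms of the fields -/

section FieldEquations

variable {t₀ t : ℝ} {f : ℝ → ℝ → ℝ}

lemma frameComp_dd (u : Fields) (b : Fin 4) (f : ℝ → ℝ → ℝ) (t θ : ℝ) (s ϑ : ℝ) :
    frameComp (u.frame t θ) b (fun m => dd m f s ϑ) = dd b f s ϑ := by
  fin_cases b <;> simp [frameComp, Fin.sum_univ_four, Fields.frame]

lemma exists_eq_const (hf : Sm t₀ f) (h0 : ∀ t θ, t₀ < t → dt f t θ = 0)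
    (h1 : ∀ t θ, t₀ < t → dth f t θ = 0) : ∃ c, ∀ t θ, t₀ < t → f t θ = c := by
  refine ⟨f (t₀ + 1) 0, fun t θ ht => ?_⟩
  have e1 : f t θ = f (t₀ + 1) θ :=
    isOpen_Ioi.is_const_of_deriv_eq_zero isPreconnected_Ioi (f := fun s => f s θ)
      (fun s hs => (hf.hasDerivAt_t hs θ).differentiableAt.differentiableWithinAt)
      (fun s hs => h0 s θ hs) (mem_Ioi.2 ht) (mem_Ioi.2 (lt_add_one t₀))
  have e2 : f (t₀ + 1) θ = f (t₀ + 1) 0 :=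
    is_const_of_deriv_eq_zero
      (fun ϑ => (hf.hasDerivAt_th (lt_add_one t₀) ϑ).differentiableAt)
      (fun ϑ => h1 _ ϑ (lt_add_one t₀)) _ _
  rw [e1, e2]

namespace IsT2Solution

variable {V : ℝ → ℝ} {u : Fields}

lemma frameComp_dd_comp' (hu : IsT2Solution t₀ V u) (ht₀ : 0 ≤ t₀) (ht : t₀ < t) (θ : ℝ)
    (m b d : Fin 4) : (frameComp (u.frame t θ) m fun r => frameComp (u.frame t θ) b fun i =>
      frameComp (u.frame t θ) d fun j => dd r (u.comp i j) t θ) = (u.jet t θ).D m b d := by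
  rw [← hu.frameComp_dd_comp ht₀ m b d ht θ, frameComp_comm]
  refine congrArg _ (funext fun i => ?_)
  rw [frameComp_comm]
  exact congrArg _ (funext fun j => frameComp_dd u m _ t θ t θ)

/-- The Einstein equations in the frame, solved for the Ricci tensor. -/
lemma ric_eq (hu : IsT2Solution t₀ V u) (ht₀ : 0 ≤ t₀) (ht : t₀ < t) (θ : ℝ) (b d : Fin 4) :
    (u.jet t θ).ric b d = dd b u.φ t θ * dd d u.φ t θ
      + V (u.φ t θ) * if b = d then u.coeff b t θ else 0 := by
  set p : Fin 4 → ℝ := ![t, θ, 0, 0] with hp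
  have hp0 : t₀ < p 0 := ht
  have hg := hu.isMetricAt ht₀ hp0
  have e1 : (frameComp (u.frame t θ) b fun i => frameComp (u.frame t θ) d fun j =>
      ricci u.metric i j p) = (u.jet t θ).ric b d := by
    simp only [hg.ricci_eq]
    refine frameComp_ricciAlg (u.frame t θ) (s := fun e => (u.coeff e t θ)⁻¹) ?_ _ _
      (D' := (u.jet t θ).D) (DD' := (u.jet t θ).DD) ?_ ?_ b d
    · intro k l
      exact hu.inv_apply ht₀ hp0 k l
    · intro m b d
      simp only [hu.pd_metric ht₀ hp0]
      exact (hu.frameComp_dd_comp' ht₀ ht θ m b d).symm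
    · intro m n b d
      simp only [hu.pd_pd_metric ht₀ hp0]
      have e2 : ∀ m, (frameComp (u.frame t θ) n fun l => frameComp (u.frame t θ) b fun i =>
          frameComp (u.frame t θ) d fun j => dd m (dd l (u.comp i j)) t θ)
          = frameComp (u.frame t θ) b fun i => frameComp (u.frame t θ) d fun j =>
            dd m (dd n (u.comp i j)) t θ := by
        intro m
        rw [frameComp_comm]
        refine congrArg _ (funext fun i => ?_)
        rw [frameComp_comm]
        refine congrArg _ (funext fun j => ?_)
        simp only [dd_dd_comm m _ (hu.sm_comp ht₀ i j) ht θ]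
        exact frameComp_dd u n _ t θ t θ
      rw [← hu.frameComp_dd_dd_comp ht₀ m n b d ht θ]
      refine Eq.symm ((congrArg _ (funext fun k => e2 k)).trans ?_)
      rw [frameComp_comm]
      refine congrArg _ (funext fun i => ?_)
      rw [frameComp_comm]
      exact congrArg _ (funext fun j => frameComp_dd u m _ t θ t θ)
  have e3 : ∀ i j, ricci u.metric i j p = dd i u.φ t θ * dd j u.φ t θ
      + V (u.φ t θ) * ∑ e, u.coeff e t θ * u.coframe e i t θ * u.coframe e j t θ := by
    intro i j
    rw [ricci_of_einstein hg (hu.solves.einstein p hp0) i j, pd_cylinder, pd_cylinder,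
      hu.metric_apply ht₀ hp0]
    rfl
  rw [← e1]
  simp only [e3, frameComp_add, frameComp_sum, frameComp_const_mul, frameComp_mul_const,
    frameComp_dd, u.frameComp_coframe]
  fin_cases b <;> fin_cases d <;> simp

/-- The equation of motion of the scalar field. -/
lemma wave_eq (hu : IsT2Solution t₀ V u) (ht₀ : 0 ≤ t₀) (ht : t₀ < t) (θ : ℝ) :
    1 / u.coeff 0 t θ * (dd 0 (dd 0 u.φ) t θ + t⁻¹ * dd 0 u.φ t θ
        - (u.jet t θ).a 0 / 2 * dd 0 u.φ t θ
        + u.coeff 0 t θ / u.coeff 1 t θ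
          * (dd 1 (dd 1 u.φ) t θ + (u.jet t θ).a 1 / 2 * dd 1 u.φ t θ)) = deriv V (u.φ t θ) := by
  set p : Fin 4 → ℝ := ![t, θ, 0, 0] with hp
  have hp0 : t₀ < p 0 := ht
  have e0 : ∀ (a : Fin 4) (q : Fin 4 → ℝ),
      pd a (fun q => u.φ (q 0) (q 1)) q = dd a u.φ (q 0) (q 1) := fun a q => pd_cylinder a _ q
  have e1 := waveOperator_eq (u.frame t θ) (φ := fun q => u.φ (q 0) (q 1))
    (s := fun e => (u.coeff e t θ)⁻¹) (hu.inv_apply ht₀ hp0)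
  have e2 : ∀ a m : Fin 4, (frameComp (u.frame t θ) m fun r => frameComp (u.frame t θ) a fun i =>
      frameComp (u.frame t θ) a fun j =>
        gammaLow (fun m i j => pd m (fun q => u.metric q i j) p) r i j)
      = gammaLow (u.jet t θ).D m a a := by
    intro a m
    have h3 := hu.frameComp_dd_comp' ht₀ ht θ
    have h4 : (frameComp (u.frame t θ) m fun r => frameComp (u.frame t θ) a fun i =>
        frameComp (u.frame t θ) a fun j => dd i (u.comp j r) t θ) = (u.jet t θ).D a a m := by
      rw [← h3, frameComp_comm]
      refine congrArg _ (funext fun i => ?_)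
      rw [frameComp_comm]
    have h5 : (frameComp (u.frame t θ) m fun r => frameComp (u.frame t θ) a fun i =>
        frameComp (u.frame t θ) a fun j => dd j (u.comp i r) t θ) = (u.jet t θ).D a a m := by
      rw [← h4]
      exact congrArg _ (funext fun r => frameComp_comm _ _ _ _)
    have hp1 : p 0 = t := rfl
    have hp2 : p 1 = θ := rfl
    simp only [gammaLow, hu.pd_metric ht₀ hp0, hp1, hp2, frameComp_const_mul, frameComp_sub,
      frameComp_add, h3, h4, h5]
  have e3 : ∀ a : Fin 4, (frameComp (u.frame t θ) a fun k => frameComp (u.frame t θ) a fun l =>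
      pd k (pd l fun q => u.φ (q 0) (q 1)) p) = dd a (dd a u.φ) t θ := by
    intro a
    have h6 : ∀ k l, pd k (pd l fun q => u.φ (q 0) (q 1)) p = dd k (dd l u.φ) t θ := by
      intro k l
      rw [funext (e0 l), pd_cylinder]
      rfl
    have h7 : ∀ k, (frameComp (u.frame t θ) a fun l => dd k (dd l u.φ) t θ)
        = dd k (dd a u.φ) t θ := by
      intro k
      rw [dd_dd_comm k a hu.smφ ht, ← frameComp_dd u a _ t θ t θ]
      exact congrArg _ (funext fun l => dd_dd_comm k l hu.smφ ht θ)
    simp only [h6, h7, frameComp_dd]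
  have e4 := hu.solves.motion p hp0
  have e5 : ∀ a : Fin 4, (frameComp (u.frame t θ) a fun r => pd r (fun q => u.φ (q 0) (q 1)) p)
      = dd a u.φ t θ := by
    intro a
    simp only [e0]
    exact frameComp_dd u a _ t θ t θ
  simp only [e2, e3, e5] at e1
  rw [e1] at e4
  have e6 := (hu.isCylindrical_jet ht θ).wave (fun m => dd m u.φ t θ)
    (fun m n => dd m (dd n u.φ) t θ) (by simp [dd_zero_fun]) (by simp [dd_zero_fun]) rfl rfl
  exact e6.symm.trans (sub_eq_zero.1 e4)

end IsT2Solution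

end FieldEquations

/-! ### The field equations in normalized variables -/

section Normalized

/-- The square of the twist `(J, K)` of the Killing fields, `e^{-P} J² + e^P (K - QJ)²`. -/
noncomputable def twist (J K : ℝ) (P Q : ℝ → ℝ → ℝ) (t θ : ℝ) : ℝ :=
  Real.exp (-P t θ) * J ^ 2 + Real.exp (P t θ) * (K - Q t θ * J) ^ 2

/-- The equations satisfied by `P, Q, φ` and the normalized variables `ℓ = ln (t³ α)` and
`Λ = λ + 3 ln t - 2 ln c₀`, where `c₀ = 3 / (4 V)` and `J, K` are the twist constants. -/
structure NormalizedSystem (t₀ c₀ J K : ℝ) (P Q φ ℓ Λ : ℝ → ℝ → ℝ) : Prop where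
  c₀_pos : 0 < c₀
  t₀_nonneg : 0 ≤ t₀
  smP : Sm t₀ P
  smQ : Sm t₀ Q
  smφ : Sm t₀ φ
  smℓ : Sm t₀ ℓ
  smΛ : Sm t₀ Λ
  perP : ∀ t, t₀ < t → Function.Periodic (P t) (2 * Real.pi)
  perQ : ∀ t, t₀ < t → Function.Periodic (Q t) (2 * Real.pi)
  perφ : ∀ t, t₀ < t → Function.Periodic (φ t) (2 * Real.pi)
  perℓ : ∀ t, t₀ < t → Function.Periodic (ℓ t) (2 * Real.pi)
  perΛ : ∀ t, t₀ < t → Function.Periodic (Λ t) (2 * Real.pi)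
  ell_t : ∀ t θ, t₀ < t → dt ℓ t θ = -(3 / t) * (Real.exp (Λ t θ / 2) - 1)
    - c₀ * Real.exp (Λ t θ / 2) * twist J K P Q t θ / t ^ 4
  lam_t : ∀ t θ, t₀ < t → dt Λ t θ = t * (dt P t θ ^ 2 + Real.exp (ℓ t θ) / t ^ 3 * dth P t θ ^ 2
    + Real.exp (P t θ) ^ 2 * (dt Q t θ ^ 2 + Real.exp (ℓ t θ) / t ^ 3 * dth Q t θ ^ 2)
    + 2 * (dt φ t θ ^ 2 + Real.exp (ℓ t θ) / t ^ 3 * dth φ t θ ^ 2)) + dt ℓ t θ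
  lam_th : ∀ t θ, t₀ < t → dth Λ t θ = 2 * t * (dt P t θ * dth P t θ
    + Real.exp (P t θ) ^ 2 * (dt Q t θ * dth Q t θ) + 2 * (dt φ t θ * dth φ t θ))
  P_tt : ∀ t θ, t₀ < t → dt (dt P) t θ = -(dt P t θ / t) + (dt ℓ t θ - 3 / t) / 2 * dt P t θ
    + Real.exp (ℓ t θ) / t ^ 3 * (dth (dth P) t θ + dth ℓ t θ / 2 * dth P t θ)
    + Real.exp (P t θ) ^ 2 * (dt Q t θ ^ 2 - Real.exp (ℓ t θ) / t ^ 3 * dth Q t θ ^ 2)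
    + c₀ * Real.exp (Λ t θ / 2) / (2 * t ^ 5)
      * (Real.exp (-P t θ) * J ^ 2 - Real.exp (P t θ) * (K - Q t θ * J) ^ 2)
  Q_tt : ∀ t θ, t₀ < t → dt (dt Q) t θ = -(dt Q t θ / t) + (dt ℓ t θ - 3 / t) / 2 * dt Q t θ
    + Real.exp (ℓ t θ) / t ^ 3 * (dth (dth Q) t θ + dth ℓ t θ / 2 * dth Q t θ)
    - 2 * (dt P t θ * dt Q t θ - Real.exp (ℓ t θ) / t ^ 3 * (dth P t θ * dth Q t θ))
    + c₀ * Real.exp (Λ t θ / 2) / t ^ 5 * Real.exp (-P t θ) * J * (K - Q t θ * J)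
  φ_tt : ∀ t θ, t₀ < t → dt (dt φ) t θ = -(dt φ t θ / t) + (dt ℓ t θ - 3 / t) / 2 * dt φ t θ
    + Real.exp (ℓ t θ) / t ^ 3 * (dth (dth φ) t θ + dth ℓ t θ / 2 * dth φ t θ)

namespace Fields

variable (u : Fields)

/-- The function `ln (t³ α)`. -/
noncomputable def ell (t θ : ℝ) : ℝ := 3 * Real.log t + Real.log (u.α t θ)

/-- The function `λ + 3 ln t - 2 ln (3 / (4 V))`. -/
noncomputable def lamHat (Vc t θ : ℝ) : ℝ :=
  u.lam t θ + 3 * Real.log t - 2 * Real.log (3 / (4 * Vc))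

end Fields

namespace IsT2Solution

variable {t₀ t Vc : ℝ} {u : Fields}

lemma coeff_zero (hVc : 0 < Vc) (ht : 0 < t) (θ : ℝ) :
    u.coeff 0 t θ = -(3 / (4 * Vc) * Real.exp (u.lamHat Vc t θ / 2) / t ^ 2) := by
  have h1 : u.logCoeff 0 t θ = Real.log (3 / (4 * Vc)) + u.lamHat Vc t θ / 2 - 2 * Real.log t := by
    simp only [Fields.logCoeff, Fields.lamHat, Matrix.cons_val_zero]; ring
  have h2 : Real.exp (2 * Real.log t) = t ^ 2 := by
    rw [two_mul, Real.exp_add, Real.exp_log ht, sq]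
  rw [Fields.coeff, h1, Real.exp_sub, Real.exp_add, Real.exp_log (by positivity), h2]
  simp

lemma coeff_one (hVc : 0 < Vc) (ht : 0 < t)
    (θ : ℝ) : u.coeff 1 t θ
      = 3 / (4 * Vc) * Real.exp (u.lamHat Vc t θ / 2) * t / Real.exp (u.ell t θ) := by
  have h1 : u.logCoeff 1 t θ
      = Real.log (3 / (4 * Vc)) + u.lamHat Vc t θ / 2 + Real.log t - u.ell t θ := by
    simp only [Fields.logCoeff, Fields.lamHat, Fields.ell, Matrix.cons_val_one, Matrix.cons_val_zero]
    ring
  rw [Fields.coeff, h1, Real.exp_sub, Real.exp_add, Real.exp_add, Real.exp_log (by positivity),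
    Real.exp_log ht]
  simp

lemma coeff_two (ht : 0 < t) (θ : ℝ) : u.coeff 2 t θ = t * Real.exp (u.P t θ) := by
  rw [Fields.coeff, show u.logCoeff 2 t θ = Real.log t + u.P t θ from rfl, Real.exp_add,
    Real.exp_log ht]
  simp

lemma coeff_three (ht : 0 < t) (θ : ℝ) : u.coeff 3 t θ = t * Real.exp (-u.P t θ) := by
  rw [Fields.coeff, show u.logCoeff 3 t θ = Real.log t - u.P t θ from rfl, sub_eq_add_neg,
    Real.exp_add, Real.exp_log ht]
  simp

section

variable {V : ℝ → ℝ}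

/-- The derivative of the logarithm of the factor `t^{5/2} α^{1/2} e^{-λ/2 ± P}` of the twist
quantities. -/
lemma dd_log_twist_factor (hu : IsT2Solution t₀ V u) (ht₀ : 0 ≤ t₀) (s : ℝ) (m : Fin 4)
    (ht : t₀ < t) (θ : ℝ) :
    dd m (fun t θ => 5 / 2 * Real.log t + 1 / 2 * Real.log (u.α t θ) - 1 / 2 * u.lam t θ
      + s * u.P t θ) t θ
      = 5 / 2 * ![t⁻¹, 0, 0, 0] m + (u.jet t θ).a m / 2 - (u.jet t θ).l m / 2
        + s * (u.jet t θ).p m := by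
  have h1 := (Sm.const (t₀ := t₀) (5 / 2)).mul (Sm.log_time ht₀)
  have h2 := (Sm.const (t₀ := t₀) (1 / 2)).mul hu.smlogα
  have h3 := (Sm.const (t₀ := t₀) (1 / 2)).mul hu.smlam
  have h4 := (Sm.const (t₀ := t₀) s).mul hu.smP
  rw [dd_add m ((h1.add h2).sub h3) h4 ht, dd_sub m (h1.add h2) h3 ht, dd_add m h1 h2 ht,
    dd_const_mul, dd_const_mul, dd_const_mul, dd_const_mul, dd_log_time]
  simp only [Fields.jet]
  ring

/-- The twist quantities of the Killing fields `∂_x` and `∂_y` are constant. -/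
lemma exists_twist (hu : IsT2Solution t₀ V u) (ht₀ : 0 ≤ t₀) : ∃ J K : ℝ, ∀ t θ, t₀ < t →
    Real.exp (5 / 2 * Real.log t + 1 / 2 * Real.log (u.α t θ) - 1 / 2 * u.lam t θ + 1 * u.P t θ)
      * (dt u.G t θ + u.Q t θ * dt u.H t θ) = J ∧
    Real.exp (5 / 2 * Real.log t + 1 / 2 * Real.log (u.α t θ) - 1 / 2 * u.lam t θ
      + (-1) * u.P t θ) * dt u.H t θ = K - u.Q t θ * J := by
  set L : ℝ → ℝ → ℝ → ℝ := fun s t θ =>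
    5 / 2 * Real.log t + 1 / 2 * Real.log (u.α t θ) - 1 / 2 * u.lam t θ + s * u.P t θ with hL
  have smL : ∀ s, Sm t₀ (L s) := fun s =>
    ((((Sm.const (5 / 2)).mul (Sm.log_time ht₀)).add ((Sm.const (1 / 2)).mul hu.smlogα)).sub
      ((Sm.const (1 / 2)).mul hu.smlam)).add ((Sm.const s).mul hu.smP)
  have hdL : ∀ s m t θ, t₀ < t → dd m (L s) t θ = 5 / 2 * ![t⁻¹, 0, 0, 0] m + (u.jet t θ).a m / 2
      - (u.jet t θ).l m / 2 + s * (u.jet t θ).p m := fun s m t θ ht =>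
    hu.dd_log_twist_factor ht₀ s m ht θ
  have smg : Sm t₀ fun t θ => dt u.G t θ + u.Q t θ * dt u.H t θ :=
    hu.smG.dt.add (hu.smQ.mul hu.smH.dt)
  have hdg : ∀ m t θ, t₀ < t → dd m (fun t θ => dt u.G t θ + u.Q t θ * dt u.H t θ) t θ
      = (u.jet t θ).γ₂ m 0 - (u.jet t θ).q 0 * (u.jet t θ).h m := by
    intro m t θ ht
    rw [dd_add m hu.smG.dt (hu.smQ.mul hu.smH.dt) ht, dd_mul m hu.smQ hu.smH.dt ht]
    simp only [Fields.jet]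
    change _ = dd m (dt u.G) t θ + u.Q t θ * dd m (dt u.H) t θ + dd m u.Q t θ * dt u.H t θ
      + dt u.Q t θ * dd m u.H t θ - dt u.Q t θ * dd m u.H t θ
    ring
  set Jf : ℝ → ℝ → ℝ := fun t θ => Real.exp (L 1 t θ) * (dt u.G t θ + u.Q t θ * dt u.H t θ) with hJf
  have smJ : Sm t₀ Jf := (smL 1).exp.mul smg
  have hdJ : ∀ m t θ, t₀ < t → dd m Jf t θ = Real.exp (L 1 t θ) * ((5 / 2 * ![t⁻¹, 0, 0, 0] m
      + (u.jet t θ).a m / 2 - (u.jet t θ).l m / 2 + (u.jet t θ).p m) * (u.jet t θ).γ 0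
      + ((u.jet t θ).γ₂ m 0 - (u.jet t θ).q 0 * (u.jet t θ).h m)) := by
    intro m t θ ht
    rw [hJf, dd_mul m (smL 1).exp smg ht, hdg m t θ ht, dd_exp m (smL 1) ht, hdL 1 m t θ ht]
    change _ = _ * (_ * (dt u.G t θ + u.Q t θ * dt u.H t θ) + _)
    ring
  set Kf : ℝ → ℝ → ℝ := fun t θ => Real.exp (L (-1) t θ) * dt u.H t θ + u.Q t θ * Jf t θ with hKf
  have smK : Sm t₀ Kf := ((smL (-1)).exp.mul hu.smH.dt).add (hu.smQ.mul smJ)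
  have hexp : ∀ t θ, t₀ < t → Real.exp (L 1 t θ)
      = Real.exp (L (-1) t θ) * (u.coeff 2 t θ / u.coeff 3 t θ) := by
    intro t θ ht
    have h0 : 0 < t := ht₀.trans_lt ht
    rw [coeff_two h0, coeff_three h0, mul_div_mul_left _ _ h0.ne', ← Real.exp_sub, ← Real.exp_add]
    congr 1
    simp only [hL]; ring
  have hdK : ∀ m t θ, t₀ < t → dd m Jf t θ = 0 → dd m Kf t θ = Real.exp (L (-1) t θ) *
      ((5 / 2 * ![t⁻¹, 0, 0, 0] m + (u.jet t θ).a m / 2 - (u.jet t θ).l m / 2 - (u.jet t θ).p m)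
        * (u.jet t θ).h 0 + (u.jet t θ).h₂ m 0 + (u.jet t θ).q m
        * ((u.jet t θ).c 2 / (u.jet t θ).c 3) * (u.jet t θ).γ 0) := by
    intro m t θ ht hJ
    rw [hKf, dd_add m ((smL (-1)).exp.mul hu.smH.dt) (hu.smQ.mul smJ) ht,
      dd_mul m (smL (-1)).exp hu.smH.dt ht, dd_mul m hu.smQ smJ ht, hJ, dd_exp m (smL (-1)) ht,
      hdL (-1) m t θ ht]
    simp only [hJf]
    rw [hexp t θ ht]
    change _ = _ * (_ * dt u.H t θ + dd m (dt u.H) t θ + dd m u.Q t θ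
      * (u.coeff 2 t θ / u.coeff 3 t θ) * (dt u.G t θ + u.Q t θ * dt u.H t θ))
    ring
  have hc := fun t θ => fun e : Fin 4 => u.coeff_ne_zero e t θ
  have hcyl := fun t θ (ht : t₀ < t) => hu.isCylindrical_jet ht θ
  have hφ3 : ∀ t θ, dd 2 u.φ t θ = 0 ∧ dd 3 u.φ t θ = 0 := fun t θ => ⟨rfl, rfl⟩
  -- the components of the Einstein equations along one Killing field are divergences of the twist
  have J1 : ∀ t θ, t₀ < t → dd 1 Jf t θ = 0 := by
    intro t θ ht
    have h1 := (hcyl t θ ht).ric_02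
    rw [hu.ric_eq ht₀ ht, (hφ3 t θ).1, if_neg (by decide), mul_zero, mul_zero, add_zero] at h1
    have h2 : (u.jet t θ).γ₂ 0 1 = (u.jet t θ).γ₂ 1 0 := ((hcyl t θ ht).symm.2.2.2.2.1).symm
    have h3 := (mul_eq_zero.1 h1.symm).resolve_left
      (div_ne_zero (hc t θ 2) (mul_ne_zero two_ne_zero (hc t θ 1)))
    rw [hdJ 1 t θ ht, ← h2, mul_eq_zero]
    right
    simpa using h3
  have J0 : ∀ t θ, t₀ < t → dd 0 Jf t θ = 0 := by
    intro t θ ht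
    have h1 := (hcyl t θ ht).ric_12
    rw [hu.ric_eq ht₀ ht, (hφ3 t θ).1, if_neg (by decide), mul_zero, mul_zero, add_zero] at h1
    have h3 := (mul_eq_zero.1 h1.symm).resolve_left
      (div_ne_zero (neg_ne_zero.2 (hc t θ 2)) (mul_ne_zero two_ne_zero (hc t θ 0)))
    rw [hdJ 0 t θ ht, mul_eq_zero]
    right
    rw [← h3]; simp [Fields.jet]
  have K1 : ∀ t θ, t₀ < t → dd 1 Kf t θ = 0 := by
    intro t θ ht
    have h1 := (hcyl t θ ht).ric_03
    rw [hu.ric_eq ht₀ ht, (hφ3 t θ).2, if_neg (by decide), mul_zero, mul_zero, add_zero] at h1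
    have h2 : (u.jet t θ).h₂ 0 1 = (u.jet t θ).h₂ 1 0 := ((hcyl t θ ht).symm.2.2.2.2.2).symm
    have h3 := (mul_eq_zero.1 h1.symm).resolve_left
      (div_ne_zero (hc t θ 3) (mul_ne_zero two_ne_zero (hc t θ 1)))
    rw [hdK 1 t θ ht (J1 t θ ht), ← h2, mul_eq_zero]
    right
    simpa using h3
  have K0 : ∀ t θ, t₀ < t → dd 0 Kf t θ = 0 := by
    intro t θ ht
    have h1 := (hcyl t θ ht).ric_13
    rw [hu.ric_eq ht₀ ht, (hφ3 t θ).2, if_neg (by decide), mul_zero, mul_zero, add_zero] at h1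
    have h3 := (mul_eq_zero.1 h1.symm).resolve_left
      (div_ne_zero (neg_ne_zero.2 (hc t θ 3)) (mul_ne_zero two_ne_zero (hc t θ 0)))
    rw [hdK 0 t θ ht (J0 t θ ht), mul_eq_zero]
    right
    rw [← h3]; simp [Fields.jet]
  obtain ⟨J, hJ⟩ := exists_eq_const smJ J0 J1
  obtain ⟨K, hK⟩ := exists_eq_const smK K0 K1
  refine ⟨J, K, fun t θ ht => ⟨hJ t θ ht, ?_⟩⟩
  have := hK t θ ht
  simp only [hKf, hJ t θ ht] at this
  linarith

end

/-- The factor of the twist quantities in normalized variables. -/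
lemma exp_twist_factor (hVc : 0 < Vc) (s θ : ℝ) :
    Real.exp (5 / 2 * Real.log t + 1 / 2 * Real.log (u.α t θ) - 1 / 2 * u.lam t θ + s * u.P t θ)
      = Real.exp (5 / 2 * Real.log t) * Real.exp (u.ell t θ / 2) * Real.exp (s * u.P t θ)
        / (3 / (4 * Vc) * Real.exp (u.lamHat Vc t θ / 2)) := by
  have h1 : 5 / 2 * Real.log t + 1 / 2 * Real.log (u.α t θ) - 1 / 2 * u.lam t θ + s * u.P t θ
      = 5 / 2 * Real.log t + u.ell t θ / 2 + s * u.P t θ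
        - (Real.log (3 / (4 * Vc)) + u.lamHat Vc t θ / 2) := by
    simp only [Fields.ell, Fields.lamHat]; ring
  rw [h1, Real.exp_sub, Real.exp_add, Real.exp_add, Real.exp_add, Real.exp_log (by positivity)]

/-- The normalized variables of a solution solve the normalized system, and the time derivatives of
`G` and `H` are determined by the twist constants. -/
theorem exists_normalizedSystem (hu : IsT2Solution t₀ (fun _ => Vc) u) (ht₀ : 0 ≤ t₀)
    (hVc : 0 < Vc) : ∃ J K : ℝ,
      NormalizedSystem t₀ (3 / (4 * Vc)) J K u.P u.Q u.φ u.ell (u.lamHat Vc) ∧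
      (∀ t θ, t₀ < t → dt u.G t θ + u.Q t θ * dt u.H t θ = 3 / (4 * Vc) * t ^ (-(5 / 2) : ℝ)
        * (Real.exp (u.lamHat Vc t θ / 2) * Real.exp (-(u.ell t θ / 2)) * Real.exp (-u.P t θ) * J)) ∧
      (∀ t θ, t₀ < t → dt u.H t θ = 3 / (4 * Vc) * t ^ (-(5 / 2) : ℝ)
        * (Real.exp (u.lamHat Vc t θ / 2) * Real.exp (-(u.ell t θ / 2)) * Real.exp (u.P t θ)
          * (K - u.Q t θ * J))) := by
  obtain ⟨J, K, hJK⟩ := hu.exists_twist ht₀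
  have hlog := Sm.log_time ht₀
  have hlog3 := (Sm.const (t₀ := t₀) 3).mul hlog
  have smℓ : Sm t₀ u.ell := hlog3.add hu.smlogα
  have smΛ : Sm t₀ (u.lamHat Vc) := (hu.smlam.add hlog3).sub (Sm.const _)
  have hG : ∀ t θ, t₀ < t → dt u.G t θ + u.Q t θ * dt u.H t θ = 3 / (4 * Vc) * t ^ (-(5 / 2) : ℝ)
        * (Real.exp (u.lamHat Vc t θ / 2) * Real.exp (-(u.ell t θ / 2)) * Real.exp (-u.P t θ) * J) := by
    intro t θ ht
    have h0 : 0 < t := ht₀.trans_lt ht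
    rw [← (hJK t θ ht).1, exp_twist_factor hVc, Real.rpow_def_of_pos h0,
      show Real.log t * -(5 / 2) = -(5 / 2 * Real.log t) by ring, Real.exp_neg, Real.exp_neg,
      Real.exp_neg, one_mul]
    field_simp
  have hH : ∀ t θ, t₀ < t → dt u.H t θ = 3 / (4 * Vc) * t ^ (-(5 / 2) : ℝ)
        * (Real.exp (u.lamHat Vc t θ / 2) * Real.exp (-(u.ell t θ / 2)) * Real.exp (u.P t θ)
          * (K - u.Q t θ * J)) := by
    intro t θ ht
    have h0 : 0 < t := ht₀.trans_lt ht
    rw [← (hJK t θ ht).2, exp_twist_factor hVc, Real.rpow_def_of_pos h0,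
      show Real.log t * -(5 / 2) = -(5 / 2 * Real.log t) by ring, Real.exp_neg, Real.exp_neg,
      neg_one_mul, Real.exp_neg]
    field_simp
  have hd : ∀ m t θ, t₀ < t → dd m u.ell t θ = 3 * ![t⁻¹, 0, 0, 0] m + (u.jet t θ).a m := by
    intro m t θ ht
    refine (dd_add m hlog3 hu.smlogα ht θ).trans ?_
    rw [dd_const_mul, dd_log_time]; rfl
  have hdΛ : ∀ m t θ, t₀ < t → dd m (u.lamHat Vc) t θ
      = (u.jet t θ).l m + 3 * ![t⁻¹, 0, 0, 0] m := by
    intro m t θ ht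
    refine (dd_sub m (hu.smlam.add hlog3) (Sm.const _) ht θ).trans ?_
    rw [dd_add m hu.smlam hlog3 ht, dd_const_mul, dd_log_time, dd_const, sub_zero]; rfl
  have a0 : ∀ t θ, t₀ < t → (u.jet t θ).a 0 = dt u.ell t θ - 3 / t := by
    intro t θ ht
    have := hd 0 t θ ht
    simp only [Matrix.cons_val_zero] at this
    rw [show dt u.ell t θ = dd 0 u.ell t θ from rfl, this, div_eq_mul_inv]; ring
  have a1 : ∀ t θ, t₀ < t → (u.jet t θ).a 1 = dth u.ell t θ := by
    intro t θ ht
    have := hd 1 t θ ht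
    simp only [Matrix.cons_val_one, Matrix.cons_val_zero] at this
    rw [show dth u.ell t θ = dd 1 u.ell t θ from rfl, this]; ring
  have l0 : ∀ t θ, t₀ < t → (u.jet t θ).l 0 = dt (u.lamHat Vc) t θ - 3 / t := by
    intro t θ ht
    have := hdΛ 0 t θ ht
    simp only [Matrix.cons_val_zero] at this
    rw [show dt (u.lamHat Vc) t θ = dd 0 (u.lamHat Vc) t θ from rfl, this, div_eq_mul_inv]; ring
  have l1 : ∀ t θ, t₀ < t → (u.jet t θ).l 1 = dth (u.lamHat Vc) t θ := by
    intro t θ ht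
    have := hdΛ 1 t θ ht
    simp only [Matrix.cons_val_one, Matrix.cons_val_zero] at this
    rw [show dth (u.lamHat Vc) t θ = dd 1 (u.lamHat Vc) t θ from rfl, this]; ring
  have jc0 : ∀ t θ, t₀ < t → (u.jet t θ).c 0
      = -(3 / (4 * Vc) * Real.exp (u.lamHat Vc t θ / 2) / t ^ 2) := fun t θ ht =>
    coeff_zero hVc (ht₀.trans_lt ht) θ
  have jc1 : ∀ t θ, t₀ < t → (u.jet t θ).c 1
      = 3 / (4 * Vc) * Real.exp (u.lamHat Vc t θ / 2) * t / Real.exp (u.ell t θ) := fun t θ ht =>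
    coeff_one hVc (ht₀.trans_lt ht) θ
  have jc2 : ∀ t θ, t₀ < t → (u.jet t θ).c 2 = t * Real.exp (u.P t θ) := fun t θ ht =>
    coeff_two (ht₀.trans_lt ht) θ
  have jc3 : ∀ t θ, t₀ < t → (u.jet t θ).c 3 = t / Real.exp (u.P t θ) := fun t θ ht => by
    rw [div_eq_mul_inv, ← Real.exp_neg]; exact coeff_three (ht₀.trans_lt ht) θ
  have jγ : ∀ t θ, t₀ < t → (u.jet t θ).γ 0 = 3 / (4 * Vc) * t ^ (-(5 / 2) : ℝ)
        * (Real.exp (u.lamHat Vc t θ / 2) * Real.exp (-(u.ell t θ / 2)) * Real.exp (-u.P t θ) * J) := hG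
  have jh : ∀ t θ, t₀ < t → (u.jet t θ).h 0 = 3 / (4 * Vc) * t ^ (-(5 / 2) : ℝ)
        * (Real.exp (u.lamHat Vc t θ / 2) * Real.exp (-(u.ell t θ / 2)) * Real.exp (u.P t θ)
          * (K - u.Q t θ * J)) := hH
  have hpow : ∀ t : ℝ, t₀ < t → (t ^ (-(5 / 2) : ℝ)) ^ 2 = 1 / t ^ 5 := by
    intro t ht
    have h0 : 0 < t := ht₀.trans_lt ht
    rw [← Real.rpow_natCast, ← Real.rpow_mul h0.le, show (-(5 / 2) : ℝ) * (2 : ℕ) = -(5 : ℕ) by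
      norm_num, Real.rpow_neg h0.le, Real.rpow_natCast, one_div]
  have hhalf : ∀ t θ, (Real.exp (-(u.ell t θ / 2))) ^ 2 = 1 / Real.exp (u.ell t θ) := by
    intro t θ
    rw [← Real.exp_nat_mul, one_div, ← Real.exp_neg]
    congr 1
    push_cast; ring
  have hcyl := fun t θ (ht : t₀ < t) => hu.isCylindrical_jet ht θ
  -- the terms of the twist in the equations
  have hcc : ∀ t θ, t₀ < t → (u.jet t θ).c 2 * (u.jet t θ).γ 0 ^ 2 / (u.jet t θ).c 1
      = 3 / (4 * Vc) * Real.exp (u.lamHat Vc t θ / 2) / t ^ 5 * (Real.exp (-u.P t θ) * J ^ 2) := by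
    intro t θ ht
    have h0 : 0 < t := ht₀.trans_lt ht
    rw [jc2 t θ ht, jc1 t θ ht, jγ t θ ht, mul_pow, mul_pow, mul_pow, mul_pow, mul_pow,
      hpow t ht, hhalf, Real.exp_neg]
    field_simp
  have hcc' : ∀ t θ, t₀ < t → (u.jet t θ).c 3 * (u.jet t θ).h 0 ^ 2 / (u.jet t θ).c 1
      = 3 / (4 * Vc) * Real.exp (u.lamHat Vc t θ / 2) / t ^ 5
        * (Real.exp (u.P t θ) * (K - u.Q t θ * J) ^ 2) := by
    intro t θ ht
    have h0 : 0 < t := ht₀.trans_lt ht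
    rw [jc3 t θ ht, jc1 t θ ht, jh t θ ht, mul_pow, mul_pow, mul_pow, mul_pow, mul_pow,
      hpow t ht, hhalf]
    field_simp
  have hcc'' : ∀ t θ, t₀ < t → (u.jet t θ).c 3 * (u.jet t θ).γ 0 * (u.jet t θ).h 0 / (u.jet t θ).c 1
      = 3 / (4 * Vc) * Real.exp (u.lamHat Vc t θ / 2) / t ^ 5 * Real.exp (-u.P t θ)
        * J * (K - u.Q t θ * J) := by
    intro t θ ht
    have h0 : 0 < t := ht₀.trans_lt ht
    have e : (u.jet t θ).c 3 * (u.jet t θ).γ 0 * (u.jet t θ).h 0 / (u.jet t θ).c 1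
        = (u.jet t θ).c 3 / (u.jet t θ).c 1 * (3 / (4 * Vc)) ^ 2 * (t ^ (-(5 / 2) : ℝ)) ^ 2
          * (Real.exp (-(u.ell t θ / 2))) ^ 2 * Real.exp (u.lamHat Vc t θ / 2) ^ 2
          * Real.exp (-u.P t θ) * Real.exp (u.P t θ) * J * (K - u.Q t θ * J) := by
      rw [jγ t θ ht, jh t θ ht]; ring
    rw [e, jc3 t θ ht, jc1 t θ ht, hpow t ht, hhalf, Real.exp_neg]
    field_simp
  have hc01 : ∀ t θ, t₀ < t → (u.jet t θ).c 0 / (u.jet t θ).c 1 = -(Real.exp (u.ell t θ) / t ^ 3) := by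
    intro t θ ht
    have h0 : 0 < t := ht₀.trans_lt ht
    rw [jc0 t θ ht, jc1 t θ ht]
    field_simp
  have hc23 : ∀ t θ, t₀ < t → (u.jet t θ).c 2 / (u.jet t θ).c 3 = Real.exp (u.P t θ) ^ 2 := by
    intro t θ ht
    have h0 : 0 < t := ht₀.trans_lt ht
    rw [jc2 t θ ht, jc3 t θ ht]
    field_simp
  have hric : ∀ t θ, t₀ < t → ∀ b, (u.jet t θ).ric b b = dd b u.φ t θ ^ 2 + Vc * (u.jet t θ).c b := by
    intro t θ ht b
    rw [hu.ric_eq ht₀ ht, if_pos rfl, sq]; rfl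
  have hne := fun t θ (ht : t₀ < t) => (hcyl t θ ht).c
  refine ⟨J, K, ?_, hG, hH⟩
  refine
    { c₀_pos := by positivity
      t₀_nonneg := ht₀
      smP := hu.smP
      smQ := hu.smQ
      smφ := hu.smφ
      smℓ := smℓ
      smΛ := smΛ
      perP := hu.smooth_P.2
      perQ := hu.smooth_Q.2
      perφ := hu.smooth_φ.2
      perℓ := fun t ht θ => by simp only [Fields.ell]; rw [hu.smooth_α.2 t ht θ]
      perΛ := fun t ht θ => by simp only [Fields.lamHat]; rw [hu.smooth_lam.2 t ht θ]
      ell_t := ?_, lam_t := ?_, lam_th := ?_, P_tt := ?_, Q_tt := ?_, φ_tt := ?_ }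
  · intro t θ ht
    have h0 : 0 < t := ht₀.trans_lt ht
    have h1 := (hcyl t θ ht).ric_22_add_33
    rw [hric t θ ht, hric t θ ht, show dd 2 u.φ t θ = 0 from rfl, show dd 3 u.φ t θ = 0 from rfl,
      add_div (_ * _ ^ 2), hcc t θ ht, hcc' t θ ht, a0 t θ ht] at h1
    have h2 : ((0:ℝ) ^ 2 + Vc * (u.jet t θ).c 2) / (u.jet t θ).c 2
        + (0 ^ 2 + Vc * (u.jet t θ).c 3) / (u.jet t θ).c 3 = 2 * Vc := by
      have := hne t θ ht 2
      have := hne t θ ht 3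
      field_simp; ring
    rw [h2, eq_div_iff (mul_ne_zero two_ne_zero (hne t θ ht 0)), jc0 t θ ht] at h1
    simp only [Fields.jet] at h1
    simp only [twist]
    field_simp at h1 ⊢
    linear_combination (-1) * h1
  · intro t θ ht
    have h0 : 0 < t := ht₀.trans_lt ht
    have h1 := (hcyl t θ ht).ric_00_sub_11
    have h2 : (u.jet t θ).ric 0 0 - (u.jet t θ).c 0 / (u.jet t θ).c 1 * (u.jet t θ).ric 1 1
        = dt u.φ t θ ^ 2 - (u.jet t θ).c 0 / (u.jet t θ).c 1 * dth u.φ t θ ^ 2 := by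
      rw [hric t θ ht, hric t θ ht]
      have := hne t θ ht 1
      change (dt u.φ t θ ^ 2 + _) - _ * (dth u.φ t θ ^ 2 + _) = _
      field_simp; ring
    rw [h2, hc01 t θ ht, hc23 t θ ht, a0 t θ ht, l0 t θ ht] at h1
    change dt u.φ t θ ^ 2 - -(Real.exp (u.ell t θ) / t ^ 3) * dth u.φ t θ ^ 2
      = 1 / 2 * (t⁻¹ * (dt (u.lamHat Vc) t θ - 3 / t) - t⁻¹ * (dt u.ell t θ - 3 / t)
        - (dt u.P t θ ^ 2 - -(Real.exp (u.ell t θ) / t ^ 3) * dth u.P t θ ^ 2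
          + Real.exp (u.P t θ) ^ 2
            * (dt u.Q t θ ^ 2 - -(Real.exp (u.ell t θ) / t ^ 3) * dth u.Q t θ ^ 2))) at h1
    have h3 : dt (u.lamHat Vc) t θ - dt u.ell t θ
        = t * (t⁻¹ * (dt (u.lamHat Vc) t θ - 3 / t) - t⁻¹ * (dt u.ell t θ - 3 / t)) := by
      field_simp; ring
    linear_combination h3 - 2 * t * h1
  · intro t θ ht
    have h0 : 0 < t := ht₀.trans_lt ht
    have h1 := (hcyl t θ ht).ric_01
    rw [hu.ric_eq ht₀ ht, if_neg (by decide), hc23 t θ ht, l1 t θ ht, mul_zero, add_zero] at h1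
    change dt u.φ t θ * dth u.φ t θ = dth (u.lamHat Vc) t θ * t⁻¹ / 4
      - 1 / 2 * (dt u.P t θ * dth u.P t θ + Real.exp (u.P t θ) ^ 2 * (dt u.Q t θ * dth u.Q t θ)) at h1
    have h3 : dth (u.lamHat Vc) t θ = 4 * t * (dth (u.lamHat Vc) t θ * t⁻¹ / 4) := by
      field_simp
    linear_combination h3 - 4 * t * h1
  · intro t θ ht
    have h0 : 0 < t := ht₀.trans_lt ht
    have h1 := (hcyl t θ ht).ric_22_sub_33
    have h4 : ((u.jet t θ).c 2 * (u.jet t θ).γ 0 ^ 2 - (u.jet t θ).c 3 * (u.jet t θ).h 0 ^ 2)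
        / (2 * (u.jet t θ).c 1) = ((u.jet t θ).c 2 * (u.jet t θ).γ 0 ^ 2 / (u.jet t θ).c 1
          - (u.jet t θ).c 3 * (u.jet t θ).h 0 ^ 2 / (u.jet t θ).c 1) / 2 := by
      have := hne t θ ht 1
      field_simp
    have h2 : ((0:ℝ) ^ 2 + Vc * (u.jet t θ).c 2) / (u.jet t θ).c 2
        - (0 ^ 2 + Vc * (u.jet t θ).c 3) / (u.jet t θ).c 3 = 0 := by
      have := hne t θ ht 2
      have := hne t θ ht 3
      field_simp; ring
    rw [hric t θ ht, hric t θ ht, show dd 2 u.φ t θ = 0 from rfl, show dd 3 u.φ t θ = 0 from rfl,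
      h4, hcc t θ ht, hcc' t θ ht, a0 t θ ht, a1 t θ ht, h2, hc01 t θ ht, hc23 t θ ht] at h1
    have h5 := (mul_eq_zero.1 h1.symm).resolve_left
      (neg_ne_zero.2 (one_div_ne_zero (hne t θ ht 0)))
    change dt (dt u.P) t θ + t⁻¹ * dt u.P t θ - (dt u.ell t θ - 3 / t) / 2 * dt u.P t θ
      + -(Real.exp (u.ell t θ) / t ^ 3)
        * (dth (dth u.P) t θ + dth u.ell t θ / 2 * dth u.P t θ)
      - Real.exp (u.P t θ) ^ 2
        * (dt u.Q t θ ^ 2 + -(Real.exp (u.ell t θ) / t ^ 3) * dth u.Q t θ ^ 2) - _ = 0 at h5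
    rw [div_eq_mul_inv (dt u.P t θ) t]
    linear_combination h5
  · intro t θ ht
    have h0 : 0 < t := ht₀.trans_lt ht
    have h1 := (hcyl t θ ht).ric_23
    rw [hu.ric_eq ht₀ ht, if_neg (by decide), show dd 2 u.φ t θ = 0 from rfl, zero_mul, mul_zero,
      add_zero, hcc'' t θ ht, a0 t θ ht, a1 t θ ht, hc01 t θ ht] at h1
    have h5 := (mul_eq_zero.1 h1.symm).resolve_left
      (neg_ne_zero.2 (div_ne_zero (hne t θ ht 2) (mul_ne_zero two_ne_zero (hne t θ ht 0))))
    change dt (dt u.Q) t θ + t⁻¹ * dt u.Q t θ - (dt u.ell t θ - 3 / t) / 2 * dt u.Q t θ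
      + -(Real.exp (u.ell t θ) / t ^ 3)
        * (dth (dth u.Q) t θ + dth u.ell t θ / 2 * dth u.Q t θ)
      + 2 * (dt u.P t θ * dt u.Q t θ + -(Real.exp (u.ell t θ) / t ^ 3)
        * (dth u.P t θ * dth u.Q t θ)) - _ = 0 at h5
    rw [div_eq_mul_inv (dt u.Q t θ) t]
    linear_combination h5
  · intro t θ ht
    have h1 := hu.wave_eq ht₀ ht θ
    rw [deriv_const, a0 t θ ht, a1 t θ ht] at h1
    have h5 := (mul_eq_zero.1 h1).resolve_left (one_div_ne_zero (hne t θ ht 0))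
    have h6 : u.coeff 0 t θ / u.coeff 1 t θ = -(Real.exp (u.ell t θ) / t ^ 3) := hc01 t θ ht
    rw [h6] at h5
    change dt (dt u.φ) t θ + t⁻¹ * dt u.φ t θ - (dt u.ell t θ - 3 / t) / 2 * dt u.φ t θ
      + -(Real.exp (u.ell t θ) / t ^ 3)
        * (dth (dth u.φ) t θ + dth u.ell t θ / 2 * dth u.φ t θ) = 0 at h5
    rw [div_eq_mul_inv (dt u.φ t θ) t]
    linear_combination h5

end IsT2Solution

end Normalized

/-! ### A maximum principle -/

section MaximumPrinciple

variable {t₀ : ℝ} {f : ℝ → ℝ → ℝ}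

lemma Sm.continuousOn (hf : Sm t₀ f) :
    ContinuousOn (fun z : ℝ × ℝ => f z.1 z.2) (Ioi t₀ ×ˢ univ) :=
  ContDiffOn.continuousOn hf

lemma exists_mem_Icc_eq (hper : ∀ t, t₀ < t → Function.Periodic (f t) (2 * Real.pi)) (θ : ℝ) :
    ∃ ϑ ∈ Icc 0 (2 * Real.pi), ∀ (t : ℝ), t₀ < t → f t θ = f t ϑ := by
  refine ⟨toIcoMod Real.two_pi_pos 0 θ, ?_, fun t ht => ?_⟩
  · have := toIcoMod_mem_Ico Real.two_pi_pos 0 θ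
    rw [zero_add] at this
    exact Ico_subset_Icc_self this
  · rw [toIcoMod, (hper t ht).sub_zsmul_eq]

/-- Smooth functions on the cylinder are bounded on compact time intervals. -/
lemma exists_bound_Icc (hf : Sm t₀ f) (hper : ∀ t, t₀ < t → Function.Periodic (f t) (2 * Real.pi))
    {T : ℝ} (hT : t₀ < T) (T₁ : ℝ) : ∃ B, ∀ t θ, T ≤ t → t ≤ T₁ → |f t θ| ≤ B := by
  have hK : IsCompact (Icc T T₁ ×ˢ Icc 0 (2 * Real.pi)) := isCompact_Icc.prod isCompact_Icc
  have hsub : Icc T T₁ ×ˢ Icc 0 (2 * Real.pi) ⊆ Ioi t₀ ×ˢ univ := fun z hz =>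
    ⟨hT.trans_le hz.1.1, mem_univ _⟩
  obtain ⟨B, hB⟩ := hK.exists_bound_of_continuousOn (hf.continuousOn.mono hsub)
  refine ⟨B, fun t θ h1 h2 => ?_⟩
  obtain ⟨ϑ, hϑ, h⟩ := exists_mem_Icc_eq hper θ
  rw [h t (hT.trans_le h1)]
  exact hB (t, ϑ) ⟨⟨h1, h2⟩, hϑ⟩

lemma deriv_nonneg_of_max_left {g : ℝ → ℝ} {g' a b : ℝ} (hg : HasDerivAt g g' b) (hab : a < b)
    (hmax : ∀ s, a ≤ s → s ≤ b → g s ≤ g b) : 0 ≤ g' := by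
  have h1 : Tendsto (slope g b) (𝓝[<] b) (𝓝 g') :=
    (hasDerivAt_iff_tendsto_slope_left_right.1 hg).1
  refine ge_of_tendsto h1 ?_
  filter_upwards [Ioo_mem_nhdsLT hab] with s hs
  rw [slope_def_field]
  exact div_nonneg_of_nonpos (sub_nonpos.2 (hmax s hs.1.le hs.2.le)) (sub_nonpos.2 hs.2.le)

/-- A maximum principle: a finite family of functions is bounded from above if, at each point where
one of them is nonnegative and attains the maximum of the whole family at that time, its time
derivative is bounded by an integrable multiple of its size. -/
theorem maximum_principle {ι : Type*} [Finite ι] {f : ι → ℝ → ℝ → ℝ} (ht₀ : 0 ≤ t₀)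
    (hf : ∀ i, Sm t₀ (f i)) (hper : ∀ i t, t₀ < t → Function.Periodic (f i t) (2 * Real.pi))
    {T C : ℝ} (hT : t₀ < T)
    (h : ∀ i t θ, T ≤ t → (∀ j ϑ, f j t ϑ ≤ f i t θ) → 0 ≤ f i t θ → dth (f i) t θ = 0 →
      dt (f i) t θ ≤ C * t ^ (-(5 / 4) : ℝ) * (1 + f i t θ)) :
    ∃ B, ∀ i t θ, T ≤ t → f i t θ ≤ B := by
  rcases isEmpty_or_nonempty ι with hι | hι
  · exact ⟨0, fun i => isEmptyElim i⟩
  choose B₀ hB₀ using fun i => exists_bound_Icc (hf i) (hper i) hT T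
  obtain ⟨M, hM⟩ : ∃ M, ∀ i, B₀ i ≤ M := by
    obtain ⟨M, hM⟩ := (Set.finite_range B₀).bddAbove
    exact ⟨M, fun i => hM (mem_range_self i)⟩
  have hT0 : 0 < T := ht₀.trans_lt hT
  -- a decreasing weight whose logarithmic derivative dominates the growth rate
  set w : ℝ → ℝ := fun t => Real.exp (4 * (|C| + 1) * t ^ (-(1 / 4) : ℝ)) with hw
  have hwpos : ∀ t, 0 < w t := fun t => Real.exp_pos _
  have hwanti : ∀ s t, T ≤ s → s ≤ t → w t ≤ w s := by
    intro s t hs hst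
    refine Real.exp_le_exp.2 (mul_le_mul_of_nonneg_left ?_ (by positivity))
    exact Real.rpow_le_rpow_of_nonpos (hT0.trans_le hs) hst (by norm_num)
  have hw1 : ∀ t, T ≤ t → 1 ≤ w t := by
    intro t ht
    have : 0 < t := hT0.trans_le ht
    exact Real.one_le_exp (by positivity)
  have hwd : ∀ t, T ≤ t → HasDerivAt w (-(|C| + 1) * t ^ (-(5 / 4) : ℝ) * w t) t := by
    intro t ht
    have h1 := (Real.hasDerivAt_rpow_const (x := t) (p := (-(1 / 4) : ℝ))
      (Or.inl (hT0.trans_le ht).ne')).const_mul (4 * (|C| + 1))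
    refine h1.exp.congr_deriv ?_
    rw [show (-(1 / 4) - 1 : ℝ) = -(5 / 4) by norm_num]
    simp only [hw]; ring
  set g : ι → ℝ → ℝ → ℝ := fun i t θ => (1 + f i t θ) * w t with hg
  set M' := max M 0 with hM'
  have key : ∀ i t θ, T ≤ t → g i t θ ≤ (1 + M') * w T := by
    intro i t θ ht
    by_contra! hlt
    have hK : IsCompact (Icc T t ×ˢ Icc 0 (2 * Real.pi)) := isCompact_Icc.prod isCompact_Icc
    have hKne : (Icc T t ×ˢ Icc 0 (2 * Real.pi)).Nonempty :=
      ⟨(T, 0), ⟨le_refl T, ht⟩, ⟨le_refl 0, Real.two_pi_pos.le⟩⟩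
    have hcont : ∀ j, ContinuousOn (fun z : ℝ × ℝ => g j z.1 z.2)
        (Icc T t ×ˢ Icc 0 (2 * Real.pi)) := by
      intro j
      have h1 : ContinuousOn (fun z : ℝ × ℝ => f j z.1 z.2) (Icc T t ×ˢ Icc 0 (2 * Real.pi)) :=
        (hf j).continuousOn.mono fun z hz => ⟨hT.trans_le hz.1.1, mem_univ _⟩
      have h2 : ContinuousOn (fun z : ℝ × ℝ => w z.1) (Icc T t ×ˢ Icc 0 (2 * Real.pi)) := by
        intro z hz
        exact ((hwd z.1 hz.1.1).continuousAt.comp continuousAt_fst).continuousWithinAt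
      exact (continuousOn_const.add h1).mul h2
    -- the first-derivative test at a maximum of the weighted family on `[T, t] × S¹`
    choose z hzK hz using fun j => hK.exists_isMaxOn hKne (hcont j)
    obtain ⟨j, hj⟩ := Finite.exists_max fun j => g j (z j).1 (z j).2
    have hmax : ∀ k s ϑ, T ≤ s → s ≤ t → g k s ϑ ≤ g j (z j).1 (z j).2 := by
      intro k s ϑ hs hst
      obtain ⟨ϑ', hϑ', he⟩ := exists_mem_Icc_eq (hper k) ϑ
      have h1 : g k s ϑ = g k s ϑ' := by simp only [hg, he s (hT.trans_le hs)]
      rw [h1]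
      exact (hz k (a := (s, ϑ')) ⟨⟨hs, hst⟩, hϑ'⟩).trans (hj k)
    set s := (z j).1 with hs
    set ϑ := (z j).2 with hϑ
    have hTs : T ≤ s := (hzK j).1.1
    have hst : s ≤ t := (hzK j).1.2
    have hs0 : 0 < s := hT0.trans_le hTs
    have hlt' : (1 + M') * w T < (1 + f j s ϑ) * w s :=
      hlt.trans_le (hmax i t θ ht le_rfl)
    have hfM : M' < f j s ϑ := by
      by_contra! hle
      have h1 : 0 ≤ 1 + M' := by positivity
      have := calc (1 + f j s ϑ) * w s ≤ (1 + M') * w s :=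
            mul_le_mul_of_nonneg_right (by linarith) (hwpos s).le
        _ ≤ (1 + M') * w T := mul_le_mul_of_nonneg_left (hwanti T s le_rfl hTs) h1
      linarith
    have hf0 : 0 ≤ f j s ϑ := (le_max_right M 0).trans hfM.le
    have hTs' : T < s := by
      refine lt_of_le_of_ne hTs fun he => ?_
      have h1 := (le_abs_self _).trans (hB₀ j s ϑ hTs he.symm.le)
      have h2 := hM j
      have h3 := le_max_left M 0
      linarith
    have hfmax : ∀ k ϑ', f k s ϑ' ≤ f j s ϑ := by
      intro k ϑ'
      have := le_of_mul_le_mul_right (hmax k s ϑ' hTs hst) (hwpos s)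
      linarith
    have hdth : dth (f j) s ϑ = 0 := by
      have h1 : IsLocalMax (f j s) ϑ := Filter.Eventually.of_forall fun ϑ' => hfmax j ϑ'
      exact h1.deriv_eq_zero
    have h1 := h j s ϑ hTs hfmax hf0 hdth
    have h2 : HasDerivAt (fun s => g j s ϑ)
        (dt (f j) s ϑ * w s + (1 + f j s ϑ) * (-(|C| + 1) * s ^ (-(5 / 4) : ℝ) * w s)) s :=
      (((hf j).hasDerivAt_t (hT.trans_le hTs) ϑ).const_add 1).mul (hwd s hTs)
    have h3 := deriv_nonneg_of_max_left h2 hTs' fun r hr hrs => hmax j r ϑ hr (hrs.trans hst)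
    have h4 : 0 < s ^ (-(5 / 4) : ℝ) * (1 + f j s ϑ) := by positivity
    have h5 : dt (f j) s ϑ < (|C| + 1) * (s ^ (-(5 / 4) : ℝ) * (1 + f j s ϑ)) := by
      have := mul_le_mul_of_nonneg_right (le_abs_self C) h4.le
      linarith
    have h6 := mul_lt_mul_of_pos_right h5 (hwpos s)
    linarith
  refine ⟨(1 + M') * w T, fun i t θ ht => ?_⟩
  have h1 := key i t θ ht
  have h2 := hw1 t ht
  by_cases h3 : 0 ≤ 1 + f i t θ
  · have := le_mul_of_one_le_right h3 h2
    simp only [hg] at h1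
    linarith
  · have h4 : 0 ≤ (1 + M') * w T := by positivity
    linarith

/-- The maximum principle for the absolute values of a finite family of functions. -/
theorem maximum_principle_abs {ι : Type*} [Finite ι] {f : ι → ℝ → ℝ → ℝ} (ht₀ : 0 ≤ t₀)
    (hf : ∀ i, Sm t₀ (f i)) (hper : ∀ i t, t₀ < t → Function.Periodic (f i t) (2 * Real.pi))
    {T C : ℝ} (hT : t₀ < T)
    (h : ∀ i t θ, T ≤ t → (∀ j, |f j t θ| ≤ |f i t θ|) → f i t θ * dth (f i) t θ = 0 →
      f i t θ * dt (f i) t θ ≤ C * t ^ (-(5 / 4) : ℝ) * (1 + f i t θ ^ 2)) :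
    ∃ B, ∀ i t θ, T ≤ t → |f i t θ| ≤ B := by
  have hd : ∀ i t θ, T ≤ t → dt (fun t θ => f i t θ ^ 2) t θ = 2 * (f i t θ * dt (f i) t θ) := by
    intro i t θ ht
    refine (((hf i).hasDerivAt_t (hT.trans_le ht) θ).pow 2).deriv.trans ?_
    push_cast; ring
  have hd' : ∀ i t θ, T ≤ t →
      dth (fun t θ => f i t θ ^ 2) t θ = 2 * (f i t θ * dth (f i) t θ) := by
    intro i t θ ht
    refine (((hf i).hasDerivAt_th (hT.trans_le ht) θ).pow 2).deriv.trans ?_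
    push_cast; ring
  obtain ⟨B, hB⟩ := maximum_principle (f := fun i t θ => f i t θ ^ 2) (C := 2 * C) ht₀
    (fun i => ((hf i).mul (hf i)).congr fun t θ _ => sq _)
    (fun i t ht θ => by simp only [hper i t ht θ]) hT (by
      intro i t θ ht hmax _ h0
      rw [hd' i t θ ht] at h0
      rw [hd i t θ ht]
      have := h i t θ ht (fun j => sq_le_sq.1 (hmax j θ)) (by linarith)
      linarith)
  refine ⟨Real.sqrt B, fun i t θ ht => ?_⟩
  exact Real.abs_le_sqrt (hB i t θ ht)

end MaximumPrinciple

/-! ### First order formulation of the wave equations -/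

section NullDerivative

variable {t₀ t : ℝ} {f h ℓ : ℝ → ℝ → ℝ}

namespace SmoothOnCylinder

lemma sm (hf : SmoothOnCylinder t₀ f) : Sm t₀ f := hf.1

lemma const (c : ℝ) : SmoothOnCylinder t₀ fun _ _ => c := ⟨Sm.const c, fun _ _ _ => rfl⟩

lemma rpow (ht₀ : 0 ≤ t₀) (r : ℝ) : SmoothOnCylinder t₀ fun t _ => t ^ r :=
  ⟨Sm.rpow ht₀ r, fun _ _ _ => rfl⟩

lemma congr (hf : SmoothOnCylinder t₀ f) (hfh : ∀ t θ, t₀ < t → h t θ = f t θ) :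
    SmoothOnCylinder t₀ h :=
  ⟨Sm.congr hf.1 hfh, fun t ht θ => by rw [hfh t _ ht, hfh t _ ht, hf.2 t ht]⟩

lemma add (hf : SmoothOnCylinder t₀ f) (hh : SmoothOnCylinder t₀ h) :
    SmoothOnCylinder t₀ fun t θ => f t θ + h t θ :=
  ⟨Sm.add hf.1 hh.1, fun t ht θ => by simp only [hf.2 t ht θ, hh.2 t ht θ]⟩

lemma sub (hf : SmoothOnCylinder t₀ f) (hh : SmoothOnCylinder t₀ h) :
    SmoothOnCylinder t₀ fun t θ => f t θ - h t θ :=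
  ⟨Sm.sub hf.1 hh.1, fun t ht θ => by simp only [hf.2 t ht θ, hh.2 t ht θ]⟩

lemma mul (hf : SmoothOnCylinder t₀ f) (hh : SmoothOnCylinder t₀ h) :
    SmoothOnCylinder t₀ fun t θ => f t θ * h t θ :=
  ⟨Sm.mul hf.1 hh.1, fun t ht θ => by simp only [hf.2 t ht θ, hh.2 t ht θ]⟩

lemma neg (hf : SmoothOnCylinder t₀ f) : SmoothOnCylinder t₀ fun t θ => -f t θ :=
  ⟨Sm.neg hf.1, fun t ht θ => by simp only [hf.2 t ht θ]⟩

lemma exp (hf : SmoothOnCylinder t₀ f) : SmoothOnCylinder t₀ fun t θ => Real.exp (f t θ) :=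
  ⟨Sm.exp hf.1, fun t ht θ => by simp only [hf.2 t ht θ]⟩

lemma dt (hf : SmoothOnCylinder t₀ f) : SmoothOnCylinder t₀ (dt f) :=
  ⟨Sm.dt hf.1, fun _ ht θ => Filter.EventuallyEq.deriv_eq
    ((eventually_gt_nhds ht).mono fun s hs => hf.2 s hs θ)⟩

lemma dth (hf : SmoothOnCylinder t₀ f) : SmoothOnCylinder t₀ (dth f) := by
  refine ⟨Sm.dth hf.1, fun t ht θ => ?_⟩
  have h1 : (fun x => f t (x + 2 * Real.pi)) = f t := funext fun x => hf.2 t ht x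
  have h2 := deriv_comp_add_const (f t) (2 * Real.pi) θ
  rw [h1] at h2
  exact h2.symm

end SmoothOnCylinder

lemma dt_add (hf : Sm t₀ f) (hh : Sm t₀ h) (ht : t₀ < t) (θ : ℝ) :
    dt (fun t θ => f t θ + h t θ) t θ = dt f t θ + dt h t θ := dd_add 0 hf hh ht θ

lemma dth_add (hf : Sm t₀ f) (hh : Sm t₀ h) (ht : t₀ < t) (θ : ℝ) :
    dth (fun t θ => f t θ + h t θ) t θ = dth f t θ + dth h t θ := dd_add 1 hf hh ht θ

lemma dt_mul (hf : Sm t₀ f) (hh : Sm t₀ h) (ht : t₀ < t) (θ : ℝ) :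
    dt (fun t θ => f t θ * h t θ) t θ = dt f t θ * h t θ + f t θ * dt h t θ := dd_mul 0 hf hh ht θ

lemma dth_mul (hf : Sm t₀ f) (hh : Sm t₀ h) (ht : t₀ < t) (θ : ℝ) :
    dth (fun t θ => f t θ * h t θ) t θ = dth f t θ * h t θ + f t θ * dth h t θ :=
  dd_mul 1 hf hh ht θ

lemma dt_exp (hf : Sm t₀ f) (ht : t₀ < t) (θ : ℝ) :
    dt (fun t θ => Real.exp (f t θ)) t θ = Real.exp (f t θ) * dt f t θ :=
  (hf.hasDerivAt_t ht θ).exp.deriv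

lemma dth_exp (hf : Sm t₀ f) (ht : t₀ < t) (θ : ℝ) :
    dth (fun t θ => Real.exp (f t θ)) t θ = Real.exp (f t θ) * dth f t θ :=
  (hf.hasDerivAt_th ht θ).exp.deriv

lemma dt_rpow (r : ℝ) (ht : 0 < t) (θ : ℝ) : dt (fun t _ => t ^ r) t θ = r * t ^ (r - 1) :=
  (Real.hasDerivAt_rpow_const (Or.inl ht.ne')).deriv

lemma dth_time (g : ℝ → ℝ) (t θ : ℝ) : dth (fun t _ => g t) t θ = 0 := deriv_const _ _

/-- The derivative `t^{3/2} ∂_t + s e^{ℓ/2} ∂_θ`. For `s = ±1` and `ℓ = ln (t³ α)` it is `t^{3/2}`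
times the null derivative `∂_t ± α^{1/2} ∂_θ`. -/
noncomputable def nullD (ℓ : ℝ → ℝ → ℝ) (s : ℝ) (f : ℝ → ℝ → ℝ) (t θ : ℝ) : ℝ :=
  t ^ (3 / 2 : ℝ) * dt f t θ + s * Real.exp (ℓ t θ / 2) * dth f t θ

lemma _root_.Real.rpow_three_halves (ht : 0 < t) : t ^ (3 / 2 : ℝ) = t * t ^ (1 / 2 : ℝ) := by
  rw [show (3 / 2 : ℝ) = 1 + 1 / 2 by norm_num, Real.rpow_add ht, Real.rpow_one]

lemma _root_.Real.rpow_half_sq (ht : 0 < t) : (t ^ (1 / 2 : ℝ)) ^ 2 = t := by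
  rw [← Real.rpow_natCast, ← Real.rpow_mul ht.le]; norm_num

lemma nullD_add {s : ℝ} (hf : Sm t₀ f) (hh : Sm t₀ h) (ht : t₀ < t) (θ : ℝ) :
    nullD ℓ s (fun t θ => f t θ + h t θ) t θ = nullD ℓ s f t θ + nullD ℓ s h t θ := by
  rw [nullD, dt_add hf hh ht, dth_add hf hh ht, nullD, nullD]; ring

lemma nullD_mul {s : ℝ} (hf : Sm t₀ f) (hh : Sm t₀ h) (ht : t₀ < t) (θ : ℝ) :
    nullD ℓ s (fun t θ => f t θ * h t θ) t θ
      = nullD ℓ s f t θ * h t θ + f t θ * nullD ℓ s h t θ := by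
  rw [nullD, dt_mul hf hh ht, dth_mul hf hh ht, nullD, nullD]; ring

lemma nullD_exp {s : ℝ} (hf : Sm t₀ f) (ht : t₀ < t) (θ : ℝ) :
    nullD ℓ s (fun t θ => Real.exp (f t θ)) t θ = Real.exp (f t θ) * nullD ℓ s f t θ := by
  rw [nullD, dt_exp hf ht, dth_exp hf ht, nullD]; ring

lemma nullD_const (s c t θ : ℝ) : nullD ℓ s (fun _ _ => c) t θ = 0 := by
  simp [nullD, dt, dth]

lemma nullD_rpow (s r : ℝ) (ht : 0 < t) (θ : ℝ) :
    nullD ℓ s (fun t _ => t ^ r) t θ = r * t ^ (r + 1 / 2) := by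
  rw [nullD, dt_rpow r ht, dth_time (fun t => t ^ r), mul_zero, add_zero, mul_left_comm,
    ← Real.rpow_add ht]
  congr 2; ring

lemma Sm.half (hf : Sm t₀ f) : Sm t₀ fun t θ => f t θ / 2 :=
  ((Sm.const (2 : ℝ)⁻¹).mul hf).congr fun t θ _ => by ring

lemma dt_half (f : ℝ → ℝ → ℝ) (t θ : ℝ) : dt (fun t θ => f t θ / 2) t θ = dt f t θ / 2 :=
  deriv_div_const _

lemma dth_half (f : ℝ → ℝ → ℝ) (t θ : ℝ) : dth (fun t θ => f t θ / 2) t θ = dth f t θ / 2 :=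
  deriv_div_const _

lemma SmoothOnCylinder.half (hf : SmoothOnCylinder t₀ f) :
    SmoothOnCylinder t₀ fun t θ => f t θ / 2 :=
  ((SmoothOnCylinder.const (2 : ℝ)⁻¹).mul hf).congr fun t θ _ => by ring

lemma nullD_half (s : ℝ) (f : ℝ → ℝ → ℝ) (t θ : ℝ) :
    nullD ℓ s (fun t θ => f t θ / 2) t θ = nullD ℓ s f t θ / 2 := by
  rw [nullD, dt_half, dth_half, nullD]; ring

lemma SmoothOnCylinder.nullD (ht₀ : 0 ≤ t₀) (hℓ : SmoothOnCylinder t₀ ℓ)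
    (hf : SmoothOnCylinder t₀ f) (s : ℝ) : SmoothOnCylinder t₀ (nullD ℓ s f) :=
  ((SmoothOnCylinder.rpow ht₀ _).mul hf.dt).add
    (((SmoothOnCylinder.const s).mul hℓ.half.exp).mul hf.dth)

/-- The wave equation in first order form. -/
lemma nullD_nullD (ht₀ : 0 ≤ t₀) (hℓ : SmoothOnCylinder t₀ ℓ) (hf : SmoothOnCylinder t₀ f) {s : ℝ}
    (hs : s ^ 2 = 1) (ht : t₀ < t) {θ R : ℝ}
    (hw : dt (dt f) t θ = -(dt f t θ / t) + (dt ℓ t θ - 3 / t) / 2 * dt f t θ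
      + Real.exp (ℓ t θ) / t ^ 3 * (dth (dth f) t θ + dth ℓ t θ / 2 * dth f t θ) + R) :
    nullD ℓ (-s) (nullD ℓ s f) t θ
      = -(1 / 2) * t ^ (1 / 2 : ℝ) * (nullD ℓ s f t θ + nullD ℓ (-s) f t θ)
        + t ^ (3 / 2 : ℝ) * dt ℓ t θ / 2 * nullD ℓ s f t θ + t ^ 3 * R := by
  have ht' : 0 < t := ht₀.trans_lt ht
  have s1 := Sm.rpow ht₀ (3 / 2)
  have s2 : Sm t₀ fun t θ => s * Real.exp (ℓ t θ / 2) := (Sm.const s).mul hℓ.sm.half.exp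
  have h1 : dt (nullD ℓ s f) t θ = 3 / 2 * t ^ (1 / 2 : ℝ) * dt f t θ
      + t ^ (3 / 2 : ℝ) * dt (dt f) t θ + s * Real.exp (ℓ t θ / 2)
        * (dt ℓ t θ / 2 * dth f t θ + dt (dth f) t θ) := by
    have := dt_add (s1.mul hf.sm.dt) (s2.mul hf.sm.dth) ht θ
    rw [dt_mul s1 hf.sm.dt ht, dt_mul s2 hf.sm.dth ht, dt_mul (Sm.const s) hℓ.sm.half.exp ht,
      dt_exp hℓ.sm.half ht, dt_half, dt_rpow _ ht'] at this
    refine this.trans ?_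
    rw [show (3 / 2 - 1 : ℝ) = 1 / 2 by norm_num, show dt (fun _ _ => s) t θ = 0 from
      deriv_const _ _]
    ring
  have h2 : dth (nullD ℓ s f) t θ = t ^ (3 / 2 : ℝ) * dt (dth f) t θ + s * Real.exp (ℓ t θ / 2)
        * (dth ℓ t θ / 2 * dth f t θ + dth (dth f) t θ) := by
    have := dth_add (s1.mul hf.sm.dt) (s2.mul hf.sm.dth) ht θ
    rw [dth_mul s1 hf.sm.dt ht, dth_mul s2 hf.sm.dth ht, dth_mul (Sm.const s) hℓ.sm.half.exp ht,
      dth_exp hℓ.sm.half ht, dth_half, dth_time fun t => t ^ (3 / 2 : ℝ)] at this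
    refine this.trans ?_
    rw [show dth (fun _ _ => s) t θ = 0 from deriv_const _ _, hf.sm.dt_dth_comm ht]
    ring
  have h3 : Real.exp (ℓ t θ / 2) ^ 2 = Real.exp (ℓ t θ) := by
    rw [← Real.exp_nat_mul]; congr 1; push_cast; ring
  rw [nullD, h1, h2, hw, nullD, nullD, Real.rpow_three_halves ht']
  have h4 := Real.rpow_half_sq ht'
  rw [← h3]
  set r := t ^ (1 / 2 : ℝ)
  set e := Real.exp (ℓ t θ / 2)
  have hr : r ≠ 0 := by rintro hr; rw [hr] at h4; norm_num at h4; exact ht'.ne h4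
  generalize dt ℓ t θ = lt, dth ℓ t θ = lx, dt f t θ = ft, dth f t θ = fx, dt (dth f) t θ = ftx,
    dth (dth f) t θ = fxx
  rw [← h4]
  field_simp
  linear_combination (-(2 * e ^ 2 * (lx / 2 * fx + fxx))) * hs

end NullDerivative

/-! ### The characteristic variables -/

section Characteristic

variable (P Q φ ℓ : ℝ → ℝ → ℝ)

/-- The null derivative of `Q`, normalized by the length of the corresponding Killing field. -/
noncomputable def nullDQ (s t θ : ℝ) : ℝ := Real.exp (P t θ) * nullD ℓ s Q t θ

/-- The energy density of the waves `P, Q, φ` that travel in one of the two null directions. -/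
noncomputable def nullEnergy (s t θ : ℝ) : ℝ :=
  nullD ℓ s P t θ ^ 2 + nullDQ P Q ℓ s t θ ^ 2 + 2 * nullD ℓ s φ t θ ^ 2

/-- The part of the twist term that is a source for `P`. -/
noncomputable def twistDiff (J K : ℝ) (P Q : ℝ → ℝ → ℝ) (t θ : ℝ) : ℝ :=
  Real.exp (-P t θ) * J ^ 2 - Real.exp (P t θ) * (K - Q t θ * J) ^ 2

/-- The part of the twist term that is a source for `Q`. -/
noncomputable def twistProd (J K : ℝ) (Q : ℝ → ℝ → ℝ) (t θ : ℝ) : ℝ := J * (K - Q t θ * J)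

variable {P Q φ ℓ}

lemma twist_nonneg (J K t θ : ℝ) : 0 ≤ twist J K P Q t θ := by
  unfold twist; positivity

lemma twist_sq (J K t θ : ℝ) :
    twist J K P Q t θ ^ 2 = twistDiff J K P Q t θ ^ 2 + 4 * twistProd J K Q t θ ^ 2 := by
  have h1 : Real.exp (-P t θ) * Real.exp (P t θ) = 1 := by rw [← Real.exp_add]; simp
  rw [twist, twistDiff, twistProd]
  linear_combination (4 * J ^ 2 * (K - Q t θ * J) ^ 2) * h1

lemma nullEnergy_nonneg (s t θ : ℝ) : 0 ≤ nullEnergy P Q φ ℓ s t θ := by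
  unfold nullEnergy; positivity

lemma _root_.Real.rpow_neg_half_mul {t : ℝ} (ht : 0 < t) :
    t ^ (-(1 / 2) : ℝ) * t ^ (1 / 2 : ℝ) = 1 := by
  rw [← Real.rpow_add ht]; norm_num

namespace NormalizedSystem

variable {t₀ c₀ J K t : ℝ} {Λ : ℝ → ℝ → ℝ}

lemma cylP (h : NormalizedSystem t₀ c₀ J K P Q φ ℓ Λ) : SmoothOnCylinder t₀ P := ⟨h.smP, h.perP⟩
lemma cylQ (h : NormalizedSystem t₀ c₀ J K P Q φ ℓ Λ) : SmoothOnCylinder t₀ Q := ⟨h.smQ, h.perQ⟩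
lemma cylφ (h : NormalizedSystem t₀ c₀ J K P Q φ ℓ Λ) : SmoothOnCylinder t₀ φ := ⟨h.smφ, h.perφ⟩
lemma cylℓ (h : NormalizedSystem t₀ c₀ J K P Q φ ℓ Λ) : SmoothOnCylinder t₀ ℓ := ⟨h.smℓ, h.perℓ⟩
lemma cylΛ (h : NormalizedSystem t₀ c₀ J K P Q φ ℓ Λ) : SmoothOnCylinder t₀ Λ := ⟨h.smΛ, h.perΛ⟩

lemma cyl_nullDP (h : NormalizedSystem t₀ c₀ J K P Q φ ℓ Λ) (s : ℝ) :
    SmoothOnCylinder t₀ (nullD ℓ s P) := h.cylℓ.nullD h.t₀_nonneg h.cylP s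

lemma cyl_nullDφ (h : NormalizedSystem t₀ c₀ J K P Q φ ℓ Λ) (s : ℝ) :
    SmoothOnCylinder t₀ (nullD ℓ s φ) := h.cylℓ.nullD h.t₀_nonneg h.cylφ s

lemma cyl_nullDQ (h : NormalizedSystem t₀ c₀ J K P Q φ ℓ Λ) (s : ℝ) :
    SmoothOnCylinder t₀ (nullDQ P Q ℓ s) := h.cylP.exp.mul (h.cylℓ.nullD h.t₀_nonneg h.cylQ s)

lemma cyl_twist (h : NormalizedSystem t₀ c₀ J K P Q φ ℓ Λ) :
    SmoothOnCylinder t₀ (twist J K P Q) := by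
  have h1 := (SmoothOnCylinder.const K).sub (h.cylQ.mul (SmoothOnCylinder.const J))
  exact ((h.cylP.neg.exp.mul (SmoothOnCylinder.const (J ^ 2))).add
    (h.cylP.exp.mul (h1.mul h1))).congr fun t θ _ => by rw [twist]; ring

lemma cyl_nullEnergy (h : NormalizedSystem t₀ c₀ J K P Q φ ℓ Λ) (s : ℝ) :
    SmoothOnCylinder t₀ (nullEnergy P Q φ ℓ s) := by
  have h1 := h.cyl_nullDP s
  have h2 := h.cyl_nullDQ s
  have h3 := h.cyl_nullDφ s
  exact (((h1.mul h1).add (h2.mul h2)).add ((SmoothOnCylinder.const 2).mul (h3.mul h3))).congr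
    fun t θ _ => by rw [nullEnergy]; ring

lemma nullD_ell (h : NormalizedSystem t₀ c₀ J K P Q φ ℓ Λ) (ht : t₀ < t) (θ : ℝ) :
    t ^ (3 / 2 : ℝ) * dt ℓ t θ = -(3 * t ^ (1 / 2 : ℝ) * (Real.exp (Λ t θ / 2) - 1))
      - (t ^ (-(1 / 2) : ℝ)) ^ 5 * (c₀ * Real.exp (Λ t θ / 2) * twist J K P Q t θ) := by
  have ht' : 0 < t := h.t₀_nonneg.trans_lt ht
  have h2 := Real.rpow_half_sq ht'
  have h3 := Real.rpow_neg_half_mul ht'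
  rw [h.ell_t t θ ht, Real.rpow_three_halves ht']
  set r := t ^ (1 / 2 : ℝ)
  set q := t ^ (-(1 / 2) : ℝ)
  have hr : r ≠ 0 := right_ne_zero_of_mul_eq_one h3
  rw [eq_inv_of_mul_eq_one_left h3]
  generalize Real.exp (Λ t θ / 2) = E, twist J K P Q t θ = τ
  rw [← h2]
  field_simp

lemma nullD_ell_add (h : NormalizedSystem t₀ c₀ J K P Q φ ℓ Λ) {s : ℝ} (hs : s ^ 2 = 1)
    (ht : t₀ < t) (θ : ℝ) :
    t ^ (3 / 2 : ℝ) * dt Λ t θ = t ^ (-(1 / 2) : ℝ) / 2 * (nullEnergy P Q φ ℓ s t θ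
      + nullEnergy P Q φ ℓ (-s) t θ) + t ^ (3 / 2 : ℝ) * dt ℓ t θ := by
  have ht' : 0 < t := h.t₀_nonneg.trans_lt ht
  have h2 := Real.rpow_half_sq ht'
  have h3 := Real.rpow_neg_half_mul ht'
  have h4 : Real.exp (ℓ t θ / 2) ^ 2 = Real.exp (ℓ t θ) := by
    rw [← Real.exp_nat_mul]; congr 1; push_cast; ring
  rw [h.lam_t t θ ht, Real.rpow_three_halves ht', nullEnergy, nullEnergy, nullDQ, nullDQ]
  simp only [nullD]
  rw [Real.rpow_three_halves ht', ← h4]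
  set r := t ^ (1 / 2 : ℝ)
  set q := t ^ (-(1 / 2) : ℝ)
  have hr : r ≠ 0 := right_ne_zero_of_mul_eq_one h3
  rw [eq_inv_of_mul_eq_one_left h3]
  generalize Real.exp (ℓ t θ / 2) = e, dt ℓ t θ = lt, dt P t θ = Pt, dth P t θ = Px,
    dt Q t θ = Qt, dth Q t θ = Qx, dt φ t θ = ft, dth φ t θ = fx, Real.exp (P t θ) = p
  rw [← h2]
  field_simp
  linear_combination (-(2 * e ^ 2 * (Px ^ 2 + p ^ 2 * Qx ^ 2 + 2 * fx ^ 2))) * hs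

lemma exp_mul_dth_lam (h : NormalizedSystem t₀ c₀ J K P Q φ ℓ Λ) (s : ℝ) (ht : t₀ < t) (θ : ℝ) :
    s * (Real.exp (ℓ t θ / 2) * dth Λ t θ) = t ^ (-(1 / 2) : ℝ) / 2 *
      (nullEnergy P Q φ ℓ s t θ - nullEnergy P Q φ ℓ (-s) t θ) := by
  have ht' : 0 < t := h.t₀_nonneg.trans_lt ht
  have h2 := Real.rpow_half_sq ht'
  have h3 := Real.rpow_neg_half_mul ht'
  rw [h.lam_th t θ ht, nullEnergy, nullEnergy, nullDQ, nullDQ]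
  simp only [nullD]
  rw [Real.rpow_three_halves ht']
  set r := t ^ (1 / 2 : ℝ)
  set q := t ^ (-(1 / 2) : ℝ)
  have hr : r ≠ 0 := right_ne_zero_of_mul_eq_one h3
  rw [eq_inv_of_mul_eq_one_left h3]
  generalize Real.exp (ℓ t θ / 2) = e, dt P t θ = Pt, dth P t θ = Px,
    dt Q t θ = Qt, dth Q t θ = Qx, dt φ t θ = ft, dth φ t θ = fx, Real.exp (P t θ) = p
  rw [← h2]
  field_simp
  ring

lemma nullD_lam (h : NormalizedSystem t₀ c₀ J K P Q φ ℓ Λ) {s : ℝ} (hs : s ^ 2 = 1)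
    (ht : t₀ < t) (θ : ℝ) :
    nullD ℓ (-s) Λ t θ = t ^ (-(1 / 2) : ℝ) * nullEnergy P Q φ ℓ (-s) t θ
      + t ^ (3 / 2 : ℝ) * dt ℓ t θ := by
  rw [nullD, h.nullD_ell_add hs ht, mul_assoc, neg_mul, h.exp_mul_dth_lam s ht]
  ring

lemma nullD_nullDP (h : NormalizedSystem t₀ c₀ J K P Q φ ℓ Λ) {s : ℝ} (hs : s ^ 2 = 1)
    (ht : t₀ < t) (θ : ℝ) :
    nullD ℓ (-s) (nullD ℓ s P) t θ
      = -(1 / 2) * t ^ (1 / 2 : ℝ) * (nullD ℓ s P t θ + nullD ℓ (-s) P t θ)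
        + (t ^ (3 / 2 : ℝ) * dt ℓ t θ / 2 * nullD ℓ s P t θ
          + nullDQ P Q ℓ s t θ * nullDQ P Q ℓ (-s) t θ
          + (t ^ (-(1 / 2) : ℝ)) ^ 4 * (c₀ * Real.exp (Λ t θ / 2) * twistDiff J K P Q t θ / 2)) := by
  have ht' : 0 < t := h.t₀_nonneg.trans_lt ht
  have h2 := Real.rpow_half_sq ht'
  have h3 := Real.rpow_neg_half_mul ht'
  have h4 : Real.exp (ℓ t θ / 2) ^ 2 = Real.exp (ℓ t θ) := by
    rw [← Real.exp_nat_mul]; congr 1; push_cast; ring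
  rw [nullD_nullD h.t₀_nonneg h.cylℓ h.cylP hs ht ((h.P_tt t θ ht).trans (add_assoc _ _ _)),
    nullDQ, nullDQ]
  rw [add_assoc, add_assoc, add_right_inj, add_right_inj, nullD, nullD, Real.rpow_three_halves ht',
    twistDiff, ← h4]
  set r := t ^ (1 / 2 : ℝ)
  set q := t ^ (-(1 / 2) : ℝ)
  have hr : r ≠ 0 := right_ne_zero_of_mul_eq_one h3
  rw [eq_inv_of_mul_eq_one_left h3]
  generalize Real.exp (ℓ t θ / 2) = e, dt Q t θ = Qt, dth Q t θ = Qx, Real.exp (P t θ) = p,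
    Real.exp (-P t θ) = p', Real.exp (Λ t θ / 2) = E, Q t θ = Q₀
  rw [← h2]
  field_simp
  linear_combination (2 * r ^ 4 * p ^ 2 * e ^ 2 * Qx ^ 2) * hs

lemma nullD_nullDQ (h : NormalizedSystem t₀ c₀ J K P Q φ ℓ Λ) {s : ℝ} (hs : s ^ 2 = 1)
    (ht : t₀ < t) (θ : ℝ) :
    nullD ℓ (-s) (nullDQ P Q ℓ s) t θ
      = -(1 / 2) * t ^ (1 / 2 : ℝ) * (nullDQ P Q ℓ s t θ + nullDQ P Q ℓ (-s) t θ)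
        + (t ^ (3 / 2 : ℝ) * dt ℓ t θ / 2 * nullDQ P Q ℓ s t θ
          - nullD ℓ s P t θ * nullDQ P Q ℓ (-s) t θ
          + (t ^ (-(1 / 2) : ℝ)) ^ 4 * (c₀ * Real.exp (Λ t θ / 2) * twistProd J K Q t θ)) := by
  have ht' : 0 < t := h.t₀_nonneg.trans_lt ht
  have h2 := Real.rpow_half_sq ht'
  have h3 := Real.rpow_neg_half_mul ht'
  have h4 : Real.exp (ℓ t θ / 2) ^ 2 = Real.exp (ℓ t θ) := by
    rw [← Real.exp_nat_mul]; congr 1; push_cast; ring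
  have h1 : Real.exp (-P t θ) * Real.exp (P t θ) = 1 := by rw [← Real.exp_add]; simp
  have h5 := nullD_mul (ℓ := ℓ) (s := -s) h.cylP.exp.sm
    (h.cylℓ.nullD h.t₀_nonneg h.cylQ s).sm ht θ
  have hw : dt (dt Q) t θ = -(dt Q t θ / t) + (dt ℓ t θ - 3 / t) / 2 * dt Q t θ
      + Real.exp (ℓ t θ) / t ^ 3 * (dth (dth Q) t θ + dth ℓ t θ / 2 * dth Q t θ)
      + (-(2 * (dt P t θ * dt Q t θ - Real.exp (ℓ t θ) / t ^ 3 * (dth P t θ * dth Q t θ)))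
      + c₀ * Real.exp (Λ t θ / 2) / t ^ 5 * Real.exp (-P t θ) * J * (K - Q t θ * J)) := by
    rw [h.Q_tt t θ ht]; ring
  refine h5.trans ?_
  rw [nullD_nullD h.t₀_nonneg h.cylℓ h.cylQ hs ht hw, nullD_exp h.smP ht, nullDQ, nullDQ]
  rw [nullD, nullD, nullD, nullD, Real.rpow_three_halves ht', twistProd, ← h4]
  set r := t ^ (1 / 2 : ℝ)
  set q := t ^ (-(1 / 2) : ℝ)
  have hr : r ≠ 0 := right_ne_zero_of_mul_eq_one h3
  rw [eq_inv_of_mul_eq_one_left h3, ← inv_eq_of_mul_eq_one_left h1]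
  have hp := (Real.exp_pos (P t θ)).ne'
  generalize Real.exp (ℓ t θ / 2) = e, dt P t θ = Pt, dth P t θ = Px, dt Q t θ = Qt,
    dth Q t θ = Qx, Real.exp (P t θ) = p, Real.exp (Λ t θ / 2) = E, Q t θ = Q₀, dt ℓ t θ = lt at *
  rw [← h2]
  field_simp
  linear_combination (-(4 * r ^ 4 * p * e ^ 2 * Qx * Px)) * hs

lemma nullD_nullDφ (h : NormalizedSystem t₀ c₀ J K P Q φ ℓ Λ) {s : ℝ} (hs : s ^ 2 = 1)
    (ht : t₀ < t) (θ : ℝ) :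
    nullD ℓ (-s) (nullD ℓ s φ) t θ
      = -(1 / 2) * t ^ (1 / 2 : ℝ) * (nullD ℓ s φ t θ + nullD ℓ (-s) φ t θ)
        + t ^ (3 / 2 : ℝ) * dt ℓ t θ / 2 * nullD ℓ s φ t θ := by
  rw [nullD_nullD (R := 0) h.t₀_nonneg h.cylℓ h.cylφ hs ht (by rw [h.φ_tt t θ ht, add_zero])]
  ring

end NormalizedSystem

end Characteristic

/-! ### Evolution of the energy densities and of the derived quantities -/

namespace NormalizedSystem

variable {P Q φ ℓ Λ : ℝ → ℝ → ℝ} {t₀ c₀ J K t : ℝ}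

lemma nullD_twist (h : NormalizedSystem t₀ c₀ J K P Q φ ℓ Λ) (s : ℝ) (ht : t₀ < t) (θ : ℝ) :
    nullD ℓ s (twist J K P Q) t θ = -(twistDiff J K P Q t θ * nullD ℓ s P t θ
      + 2 * twistProd J K Q t θ * nullDQ P Q ℓ s t θ) := by
  have h1 := (SmoothOnCylinder.const (t₀ := t₀) K).sub (h.cylQ.mul (SmoothOnCylinder.const J))
  have hP : nullD ℓ s (fun t θ => -P t θ) t θ = -nullD ℓ s P t θ := by
    have := nullD_mul (ℓ := ℓ) (s := s) (Sm.const (t₀ := t₀) (-1)) h.smP ht θ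
    simp only [neg_one_mul, nullD_const, zero_mul, zero_add] at this
    exact this
  have hK : nullD ℓ s (fun t θ => K - Q t θ * J) t θ = -(nullD ℓ s Q t θ * J) := by
    have h2 := nullD_mul (ℓ := ℓ) (s := s) (Sm.const (t₀ := t₀) (-J)) h.smQ ht θ
    have h3 := nullD_add (ℓ := ℓ) (s := s) (Sm.const (t₀ := t₀) K)
      ((Sm.const (t₀ := t₀) (-J)).mul h.smQ) ht θ
    rw [h2, nullD_const, nullD_const] at h3
    rw [show (fun t θ => K - Q t θ * J) = fun t θ => K + -J * Q t θ by ext; ring, h3]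
    ring
  have h4 := nullD_add (ℓ := ℓ) (s := s)
    (h.cylP.neg.exp.mul (SmoothOnCylinder.const (J ^ 2))).sm (h.cylP.exp.mul (h1.mul h1)).sm ht θ
  rw [nullD_mul h.cylP.neg.exp.sm (Sm.const _) ht, nullD_mul h.cylP.exp.sm (h1.mul h1).sm ht,
    nullD_mul h1.sm h1.sm ht, nullD_exp h.cylP.neg.sm ht, nullD_exp h.smP ht, nullD_const, hP,
    hK] at h4
  rw [show twist J K P Q = fun t θ => Real.exp (-P t θ) * J ^ 2
    + Real.exp (P t θ) * ((K - Q t θ * J) * (K - Q t θ * J)) by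
      ext t θ; rw [twist]; ring, h4, twistDiff, twistProd, nullDQ]
  ring

lemma exp_mul_dth (f : ℝ → ℝ → ℝ) (t θ : ℝ) :
    Real.exp (ℓ t θ / 2) * dth f t θ = (nullD ℓ 1 f t θ - nullD ℓ (-1) f t θ) / 2 := by
  rw [nullD, nullD]; ring

lemma rpow_mul_dt (f : ℝ → ℝ → ℝ) (t θ : ℝ) :
    t ^ (3 / 2 : ℝ) * dt f t θ = (nullD ℓ 1 f t θ + nullD ℓ (-1) f t θ) / 2 := by
  rw [nullD, nullD]; ring

lemma rpow_mul_dtQ (t θ : ℝ) :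
    t ^ (3 / 2 : ℝ) * dt Q t θ
      = Real.exp (-P t θ) * ((nullDQ P Q ℓ 1 t θ + nullDQ P Q ℓ (-1) t θ) / 2) := by
  have h1 : Real.exp (-P t θ) * Real.exp (P t θ) = 1 := by rw [← Real.exp_add]; simp
  rw [nullDQ, nullDQ, nullD, nullD]
  linear_combination (-(t ^ (3 / 2 : ℝ) * dt Q t θ)) * h1

lemma abs_twist_source_le (s t θ : ℝ) :
    |twistDiff J K P Q t θ * nullD ℓ s P t θ + 2 * twistProd J K Q t θ * nullDQ P Q ℓ s t θ|
      ≤ twist J K P Q t θ * Real.sqrt (nullEnergy P Q φ ℓ s t θ) := by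
  refine abs_le_of_sq_le_sq ?_ (mul_nonneg (twist_nonneg _ _ _ _) (Real.sqrt_nonneg _))
  rw [mul_pow, Real.sq_sqrt (nullEnergy_nonneg _ _ _), twist_sq, nullEnergy]
  nlinarith [sq_nonneg (twistDiff J K P Q t θ * nullDQ P Q ℓ s t θ
    - 2 * twistProd J K Q t θ * nullD ℓ s P t θ), mul_nonneg
    (add_nonneg (sq_nonneg (twistDiff J K P Q t θ))
      (mul_nonneg zero_le_four (sq_nonneg (twistProd J K Q t θ))))
    (mul_nonneg zero_le_two (sq_nonneg (nullD ℓ s φ t θ)))]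

/-- In the equation for the energy density the interaction of `P` and `Q` cancels. -/
lemma nullD_nullEnergy (h : NormalizedSystem t₀ c₀ J K P Q φ ℓ Λ) {s : ℝ} (hs : s ^ 2 = 1)
    (ht : t₀ < t) (θ : ℝ) :
    nullD ℓ (-s) (nullEnergy P Q φ ℓ s) t θ
      = -t ^ (1 / 2 : ℝ) * (nullEnergy P Q φ ℓ s t θ
          + (nullD ℓ s P t θ * nullD ℓ (-s) P t θ + nullDQ P Q ℓ s t θ * nullDQ P Q ℓ (-s) t θ
            + 2 * (nullD ℓ s φ t θ * nullD ℓ (-s) φ t θ)))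
        + t ^ (3 / 2 : ℝ) * dt ℓ t θ * nullEnergy P Q φ ℓ s t θ
        + (t ^ (-(1 / 2) : ℝ)) ^ 4 * (c₀ * Real.exp (Λ t θ / 2)
          * (twistDiff J K P Q t θ * nullD ℓ s P t θ
            + 2 * twistProd J K Q t θ * nullDQ P Q ℓ s t θ)) := by
  have h1 := (h.cyl_nullDP s).sm
  have h2 := (h.cyl_nullDQ s).sm
  have h3 := (h.cyl_nullDφ s).sm
  have h4 := nullD_add (ℓ := ℓ) (s := -s) ((h1.mul h1).add (h2.mul h2))
    ((Sm.const 2).mul (h3.mul h3)) ht θ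
  rw [nullD_add (h1.mul h1) (h2.mul h2) ht, nullD_mul h1 h1 ht, nullD_mul h2 h2 ht,
    nullD_mul (Sm.const 2) (h3.mul h3) ht, nullD_mul h3 h3 ht, nullD_const, h.nullD_nullDP hs ht,
    h.nullD_nullDQ hs ht, h.nullD_nullDφ hs ht] at h4
  rw [show nullEnergy P Q φ ℓ s = fun t θ => nullD ℓ s P t θ * nullD ℓ s P t θ
    + nullDQ P Q ℓ s t θ * nullDQ P Q ℓ s t θ + 2 * (nullD ℓ s φ t θ * nullD ℓ s φ t θ) by
      ext t θ; rw [nullEnergy]; ring, h4]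
  ring

/-- The evolution of `Λ`: a restoring term, and a remainder given by the energy densities and the
twist. -/
lemma rpow_mul_dt_lam (h : NormalizedSystem t₀ c₀ J K P Q φ ℓ Λ) (ht : t₀ < t) (θ : ℝ) :
    t ^ (3 / 2 : ℝ) * dt Λ t θ = -(3 * t ^ (1 / 2 : ℝ) * (Real.exp (Λ t θ / 2) - 1))
      + (t ^ (-(1 / 2) : ℝ) / 2 * (nullEnergy P Q φ ℓ 1 t θ + nullEnergy P Q φ ℓ (-1) t θ)
        - (t ^ (-(1 / 2) : ℝ)) ^ 5 * (c₀ * Real.exp (Λ t θ / 2) * twist J K P Q t θ)) := by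
  rw [h.nullD_ell_add (one_pow 2) ht, h.nullD_ell ht]; ring

/-- The evolution of `t^δ (e^{-Λ/2} - 1)`. -/
lemma rpow_mul_dt_weighted (h : NormalizedSystem t₀ c₀ J K P Q φ ℓ Λ) (δ : ℝ) (ht : t₀ < t)
    (θ : ℝ) :
    t ^ (3 / 2 : ℝ) * dt (fun t θ => t ^ δ * (Real.exp (-Λ t θ / 2) - 1)) t θ
      = -((3 / 2 - δ) * t ^ (1 / 2 : ℝ) * (t ^ δ * (Real.exp (-Λ t θ / 2) - 1)))
        - t ^ δ * Real.exp (-Λ t θ / 2) / 2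
          * (t ^ (-(1 / 2) : ℝ) / 2 * (nullEnergy P Q φ ℓ 1 t θ + nullEnergy P Q φ ℓ (-1) t θ)
            - (t ^ (-(1 / 2) : ℝ)) ^ 5 * (c₀ * Real.exp (Λ t θ / 2) * twist J K P Q t θ)) := by
  have ht' : 0 < t := h.t₀_nonneg.trans_lt ht
  have h1 : Real.exp (-Λ t θ / 2) * Real.exp (Λ t θ / 2) = 1 := by
    rw [← Real.exp_add, neg_div, neg_add_cancel, Real.exp_zero]
  have h2 : dt (fun t θ => t ^ δ * (Real.exp (-Λ t θ / 2) - 1)) t θ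
      = δ * t ^ (δ - 1) * (Real.exp (-Λ t θ / 2) - 1)
        + t ^ δ * (Real.exp (-Λ t θ / 2) * (-dt Λ t θ / 2)) :=
    ((Real.hasDerivAt_rpow_const (Or.inl ht'.ne')).mul
      (((h.smΛ.hasDerivAt_t ht θ).neg.div_const 2).exp.sub_const 1)).deriv
  have h3 : t ^ (3 / 2 : ℝ) * t ^ (δ - 1) = t ^ (1 / 2 : ℝ) * t ^ δ := by
    rw [← Real.rpow_add ht', ← Real.rpow_add ht']; congr 1; ring
  have h4 := h.rpow_mul_dt_lam ht θ
  rw [h2]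
  set e := Real.exp (-Λ t θ / 2)
  set E := Real.exp (Λ t θ / 2)
  linear_combination (δ * (e - 1)) * h3 + (-(t ^ δ * e / 2)) * h4
    + (3 / 2 * t ^ δ * t ^ (1 / 2 : ℝ)) * h1

lemma exp_neg_mul_exp (t θ : ℝ) : Real.exp (-ℓ t θ / 2) * Real.exp (ℓ t θ / 2) = 1 := by
  rw [← Real.exp_add, neg_div, neg_add_cancel, Real.exp_zero]

lemma dth_lam (h : NormalizedSystem t₀ c₀ J K P Q φ ℓ Λ) (ht : t₀ < t) (θ : ℝ) :
    dth Λ t θ = t ^ (-(1 / 2) : ℝ) * (Real.exp (-ℓ t θ / 2)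
      * ((nullEnergy P Q φ ℓ 1 t θ - nullEnergy P Q φ ℓ (-1) t θ) / 2)) := by
  have h1 := h.exp_mul_dth_lam 1 ht θ
  have h2 := exp_neg_mul_exp (ℓ := ℓ) t θ
  linear_combination (-dth Λ t θ) * h2 + Real.exp (-ℓ t θ / 2) * h1

lemma dth_twist (h : NormalizedSystem t₀ c₀ J K P Q φ ℓ Λ) (ht : t₀ < t) (θ : ℝ) :
    dth (twist J K P Q) t θ = -(Real.exp (-ℓ t θ / 2)
      * (twistDiff J K P Q t θ * (nullD ℓ 1 P t θ - nullD ℓ (-1) P t θ)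
        + 2 * twistProd J K Q t θ * (nullDQ P Q ℓ 1 t θ - nullDQ P Q ℓ (-1) t θ)) / 2) := by
  have h1 := exp_mul_dth (ℓ := ℓ) (twist J K P Q) t θ
  rw [h.nullD_twist 1 ht, h.nullD_twist (-1) ht] at h1
  have h2 := exp_neg_mul_exp (ℓ := ℓ) t θ
  linear_combination (-dth (twist J K P Q) t θ) * h2 + Real.exp (-ℓ t θ / 2) * h1

/-- The evolution of `∂_θ ℓ`: the derivative `∂_θ Λ` can be eliminated. -/
lemma rpow_mul_dt_dth_ell (h : NormalizedSystem t₀ c₀ J K P Q φ ℓ Λ) (ht : t₀ < t) (θ : ℝ) :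
    t ^ (3 / 2 : ℝ) * dt (dth ℓ) t θ
      = Real.exp (Λ t θ / 2) * Real.exp (-ℓ t θ / 2) *
        (-(3 / 4) * (nullEnergy P Q φ ℓ 1 t θ - nullEnergy P Q φ ℓ (-1) t θ)
        - (t ^ (-(1 / 2) : ℝ)) ^ 6 * (c₀ * twist J K P Q t θ / 4)
          * (nullEnergy P Q φ ℓ 1 t θ - nullEnergy P Q φ ℓ (-1) t θ)
        + (t ^ (-(1 / 2) : ℝ)) ^ 5 * (c₀ / 2)
          * (twistDiff J K P Q t θ * (nullD ℓ 1 P t θ - nullD ℓ (-1) P t θ)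
        + 2 * twistProd J K Q t θ * (nullDQ P Q ℓ 1 t θ - nullDQ P Q ℓ (-1) t θ))) := by
  have ht' : 0 < t := h.t₀_nonneg.trans_lt ht
  have h1 : dth (fun t θ => t ^ (3 / 2 : ℝ) * dt ℓ t θ) t θ
      = -(3 * t ^ (1 / 2 : ℝ) * (Real.exp (Λ t θ / 2) * (dth Λ t θ / 2)))
      - (t ^ (-(1 / 2) : ℝ)) ^ 5 * (c₀ * (Real.exp (Λ t θ / 2) * (dth Λ t θ / 2))
          * twist J K P Q t θ + c₀ * Real.exp (Λ t θ / 2) * dth (twist J K P Q) t θ) := by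
    have h2 := ((h.smΛ.hasDerivAt_th ht θ).div_const 2).exp
    have h3 := h.cyl_twist.sm.hasDerivAt_th ht θ
    exact (congrArg (deriv · θ) (funext fun θ => h.nullD_ell ht θ)).trans
      (((h2.sub_const 1).const_mul (3 * t ^ (1 / 2 : ℝ))).neg.sub
      (((h2.const_mul c₀).mul h3).const_mul ((t ^ (-(1 / 2) : ℝ)) ^ 5))).deriv
  have h2 : dth (fun t θ => t ^ (3 / 2 : ℝ) * dt ℓ t θ) t θ
      = t ^ (3 / 2 : ℝ) * dt (dth ℓ) t θ := by
    rw [h.smℓ.dt_dth_comm ht]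
    exact ((h.smℓ.dt.hasDerivAt_th ht θ).const_mul _).deriv
  have h3 := Real.rpow_neg_half_mul ht'
  rw [← h2, h1, h.dth_lam ht, h.dth_twist ht]
  linear_combination (-(3 / 4) * Real.exp (Λ t θ / 2) * Real.exp (-ℓ t θ / 2) *
    (nullEnergy P Q φ ℓ 1 t θ - nullEnergy P Q φ ℓ (-1) t θ)) * h3

end NormalizedSystem

/-! ### Uniform estimates of the unknowns -/

section IsOrd

/-- `f = O(t^r)`, uniformly in `θ`, for `t ≥ T`. -/
def IsOrd (T r : ℝ) (f : ℝ → ℝ → ℝ) : Prop := ∃ C, ∀ t θ, T ≤ t → |f t θ| ≤ C * t ^ r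

namespace IsOrd

variable {T r s q : ℝ} {f h : ℝ → ℝ → ℝ}

lemma congr (hf : IsOrd T r f) (hfh : ∀ t θ, T ≤ t → h t θ = f t θ) : IsOrd T r h := by
  obtain ⟨C, hC⟩ := hf
  exact ⟨C, fun t θ ht => by rw [hfh t θ ht]; exact hC t θ ht⟩

lemma of_le (hf : IsOrd T r f) (hfh : ∀ t θ, T ≤ t → |h t θ| ≤ |f t θ|) : IsOrd T r h := by
  obtain ⟨C, hC⟩ := hf
  exact ⟨C, fun t θ ht => (hfh t θ ht).trans (hC t θ ht)⟩

lemma of_bound {B : ℝ} (hB : ∀ t θ, T ≤ t → |f t θ| ≤ B) : IsOrd T 0 f :=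
  ⟨B, fun t θ ht => by rw [Real.rpow_zero, mul_one]; exact hB t θ ht⟩

lemma exists_bound (hf : IsOrd T 0 f) : ∃ B, ∀ t θ, T ≤ t → |f t θ| ≤ B := by
  obtain ⟨C, hC⟩ := hf
  exact ⟨C, fun t θ ht => by simpa using hC t θ ht⟩

lemma const (c : ℝ) : IsOrd T 0 fun _ _ => c := of_bound fun _ _ _ => le_refl |c|

lemma rpow (hT : 0 < T) (r : ℝ) : IsOrd T r fun t _ => t ^ r :=
  ⟨1, fun t θ ht => by rw [one_mul, abs_of_pos (Real.rpow_pos_of_pos (hT.trans_le ht) r)]⟩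

lemma add (hf : IsOrd T r f) (hh : IsOrd T r h) : IsOrd T r fun t θ => f t θ + h t θ := by
  obtain ⟨C, hC⟩ := hf
  obtain ⟨D, hD⟩ := hh
  refine ⟨C + D, fun t θ ht => (abs_add_le _ _).trans ?_⟩
  linarith [hC t θ ht, hD t θ ht]

lemma neg (hf : IsOrd T r f) : IsOrd T r fun t θ => -f t θ := by
  obtain ⟨C, hC⟩ := hf
  exact ⟨C, fun t θ ht => by rw [abs_neg]; exact hC t θ ht⟩

lemma sub (hf : IsOrd T r f) (hh : IsOrd T r h) : IsOrd T r fun t θ => f t θ - h t θ := by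
  simpa only [sub_eq_add_neg] using hf.add hh.neg

lemma mul (hT : 0 < T) (hf : IsOrd T r f) (hh : IsOrd T s h) :
    IsOrd T (r + s) fun t θ => f t θ * h t θ := by
  obtain ⟨C, hC⟩ := hf
  obtain ⟨D, hD⟩ := hh
  refine ⟨C * D, fun t θ ht => ?_⟩
  rw [abs_mul, Real.rpow_add (hT.trans_le ht)]
  calc |f t θ| * |h t θ| ≤ (C * t ^ r) * (D * t ^ s) :=
        mul_le_mul (hC t θ ht) (hD t θ ht) (abs_nonneg _) ((abs_nonneg _).trans (hC t θ ht))
    _ = C * D * (t ^ r * t ^ s) := by ring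

lemma mono (hT : 1 ≤ T) (hrs : r ≤ s) (hf : IsOrd T r f) : IsOrd T s f := by
  obtain ⟨C, hC⟩ := hf
  refine ⟨|C|, fun t θ ht => (hC t θ ht).trans ?_⟩
  have h1 : 1 ≤ t := hT.trans ht
  exact mul_le_mul (le_abs_self C) (Real.rpow_le_rpow_of_exponent_le h1 hrs) (by positivity)
    (abs_nonneg C)

lemma mul_le (hT : 1 ≤ T) (hf : IsOrd T r f) (hh : IsOrd T s h) (hq : r + s ≤ q) :
    IsOrd T q fun t θ => f t θ * h t θ := (hf.mul (by linarith) hh).mono hT hq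

lemma const_mul (c : ℝ) (hf : IsOrd T r f) : IsOrd T r fun t θ => c * f t θ := by
  obtain ⟨C, hC⟩ := hf
  refine ⟨|c| * C, fun t θ ht => ?_⟩
  rw [abs_mul, mul_assoc]
  exact mul_le_mul_of_nonneg_left (hC t θ ht) (abs_nonneg c)

lemma div_const (hf : IsOrd T r f) (c : ℝ) : IsOrd T r fun t θ => f t θ / c :=
  (hf.const_mul c⁻¹).congr fun t θ _ => by ring

lemma exp (hf : IsOrd T 0 f) : IsOrd T 0 fun t θ => Real.exp (f t θ) := by
  obtain ⟨B, hB⟩ := hf.exists_bound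
  refine of_bound (B := Real.exp B) fun t θ ht => ?_
  rw [Real.abs_exp]
  exact Real.exp_le_exp.2 ((le_abs_self _).trans (hB t θ ht))

lemma rpow_pow_le (hT : 1 ≤ T) {q r : ℝ} (n : ℕ) (h : q * n ≤ r) :
    IsOrd T r fun t _ => (t ^ q) ^ n := by
  refine ((rpow (by linarith) (q * n)).mono hT h).congr fun t _ ht => ?_
  rw [Real.rpow_mul_natCast (by linarith)]

lemma sqrt (hT : 0 < T) (hf : IsOrd T r f) : IsOrd T (r / 2) fun t θ => Real.sqrt (f t θ) := by
  obtain ⟨C, hC⟩ := hf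
  refine ⟨Real.sqrt C, fun t θ ht => ?_⟩
  have ht' : 0 < t := hT.trans_le ht
  have h1 : 0 ≤ C := by
    have h2 := (abs_nonneg _).trans (hC t θ ht)
    exact nonneg_of_mul_nonneg_left h2 (Real.rpow_pos_of_pos ht' r)
  rw [abs_of_nonneg (Real.sqrt_nonneg _), show t ^ (r / 2) = Real.sqrt (t ^ r) by
    rw [Real.sqrt_eq_rpow, ← Real.rpow_mul ht'.le]; congr 1; ring, ← Real.sqrt_mul h1]
  exact Real.sqrt_le_sqrt ((le_abs_self _).trans (hC t θ ht))

end IsOrd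

/-- A function with a damped evolution equation and a source whose time integral converges is
bounded. -/
theorem isOrd_of_damped {t₀ T d : ℝ} {f S : ℝ → ℝ → ℝ} (ht₀ : 0 ≤ t₀)
    (hf : SmoothOnCylinder t₀ f) (hT : t₀ < T) (hd : 0 ≤ d)
    (h : ∀ t θ, T ≤ t → t ^ (3 / 2 : ℝ) * dt f t θ = -(d * t ^ (1 / 2 : ℝ) * f t θ) + S t θ)
    (hS : IsOrd T (1 / 4) S) : IsOrd T 0 f := by
  obtain ⟨C, hC⟩ := hS
  obtain ⟨B, hB⟩ := maximum_principle_abs (ι := Unit) (f := fun _ => f) (C := C) ht₀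
    (fun _ => hf.1) (fun _ => hf.2) hT (by
      intro _ t θ ht _ _
      have ht' : 0 < t := (ht₀.trans_lt hT).trans_le ht
      have h1 : t ^ (-(3 / 2) : ℝ) * t ^ (3 / 2 : ℝ) = 1 := by
        rw [← Real.rpow_add ht']; norm_num
      have h2 : t ^ (-(3 / 2) : ℝ) * t ^ (1 / 4 : ℝ) = t ^ (-(5 / 4) : ℝ) := by
        rw [← Real.rpow_add ht']; norm_num
      have h3 : dt f t θ = t ^ (-(3 / 2) : ℝ) * (-(d * t ^ (1 / 2 : ℝ) * f t θ) + S t θ) := by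
        rw [← h t θ ht, ← mul_assoc, h1, one_mul]
      have h4 : f t θ * S t θ ≤ C * t ^ (1 / 4 : ℝ) * (1 + f t θ ^ 2) := by
        have h5 : |f t θ| ≤ 1 + f t θ ^ 2 := by
          have := sq_abs (f t θ)
          nlinarith [sq_nonneg (|f t θ| - 1 / 2)]
        have h6 := (abs_nonneg _).trans (hC t θ ht)
        calc f t θ * S t θ ≤ |f t θ| * |S t θ| := by rw [← abs_mul]; exact le_abs_self _
          _ ≤ (1 + f t θ ^ 2) * (C * t ^ (1 / 4 : ℝ)) :=
            mul_le_mul h5 (hC t θ ht) (abs_nonneg _) (by positivity)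
          _ = _ := by ring
      have h7 : 0 ≤ d * t ^ (1 / 2 : ℝ) * f t θ ^ 2 := by positivity
      have h8 : 0 ≤ t ^ (-(3 / 2) : ℝ) := by positivity
      calc f t θ * dt f t θ
          = t ^ (-(3 / 2) : ℝ) * (-(d * t ^ (1 / 2 : ℝ) * f t θ ^ 2) + f t θ * S t θ) := by
            rw [h3]; ring
        _ ≤ t ^ (-(3 / 2) : ℝ) * (C * t ^ (1 / 4 : ℝ) * (1 + f t θ ^ 2)) :=
            mul_le_mul_of_nonneg_left (by linarith) h8
        _ = _ := by rw [← h2]; ring)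
  exact IsOrd.of_bound fun t θ ht => hB () t θ ht

end IsOrd

namespace NormalizedSystem

variable {P Q φ ℓ Λ : ℝ → ℝ → ℝ} {t₀ c₀ J K T : ℝ}

lemma energy_add_inner_nonneg {x y z x' y' z' a a' : ℝ} (ha : x ^ 2 + y ^ 2 + 2 * z ^ 2 = a)
    (ha' : x' ^ 2 + y' ^ 2 + 2 * z' ^ 2 = a') (h : a' ≤ a) :
    0 ≤ a + (x * x' + y * y' + 2 * (z * z')) := by
  nlinarith [sq_nonneg (x + x'), sq_nonneg (y + y'), sq_nonneg (z + z')]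

/-- The inequality behind the energy estimate: `a, a'` are the energy densities, `y` is the twist
term, `L` stands for `t^{3/2} ∂_t ℓ` and `S₁, S₂` for the twist sources. -/
lemma energy_inequality {r q y a a' g L S₁ S₂ : ℝ} (hq : 0 < q) (hqr : q * r = 1) (hy : 0 ≤ y)
    (ha : 0 ≤ a) (haa : a' ≤ a) (hg : 0 ≤ a + g) (hL : L ≤ r / 2 - q * y)
    (hS₁ : S₁ ≤ y * Real.sqrt a) (hS₂ : S₂ ≤ y * Real.sqrt a) :
    -r * (a + g) + L * a + S₁ - 2 * r * y + (y * ((q * a' + L) / 2) + S₂)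
      ≤ r / 2 * (a + y) := by
  have hr : 0 < r := pos_of_mul_pos_right (by rw [hqr]; exact one_pos) hq.le
  have h1 : 0 ≤ r * (a + g) := mul_nonneg hr.le hg
  have h2 : L * a ≤ (r / 2 - q * y) * a := mul_le_mul_of_nonneg_right hL ha
  have h3 : y * (q * a' + L) ≤ y * (q * a + (r / 2 - q * y)) := by
    refine mul_le_mul_of_nonneg_left ?_ hy
    have := mul_le_mul_of_nonneg_left haa hq.le
    linarith
  have h4 : 2 * Real.sqrt a ≤ q * a / 2 + 2 * r := by
    have h5 := Real.sq_sqrt ha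
    have h6 : 0 ≤ q * (Real.sqrt a - 2 * r) ^ 2 := by positivity
    have h7 : q * (Real.sqrt a - 2 * r) ^ 2 = q * a - 4 * Real.sqrt a + 4 * r := by
      linear_combination q * h5 + (4 * r - 4 * Real.sqrt a) * hqr
    linarith
  have h5 := mul_le_mul_of_nonneg_left h4 hy
  have h6 : 0 ≤ q * y ^ 2 := by positivity
  have h7 : 0 ≤ r * y := by positivity
  nlinarith

/-- The energy densities grow at most like `t^{1/2}` as soon as `Λ` is almost nonnegative. At a
maximum over both null directions the interaction with the opposite direction has a favorable sign,
and `e^{Λ/2} ≥ 5/6` bounds the growth rate `t^{3/2} ∂_t ℓ` by `t^{1/2} / 2`. -/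
theorem exists_energy_bound (h : NormalizedSystem t₀ c₀ J K P Q φ ℓ Λ) (hT : t₀ < T)
    (hΛ : ∀ t θ, T ≤ t → 5 / 6 ≤ Real.exp (Λ t θ / 2)) :
    ∃ B, ∀ s t θ, s ^ 2 = 1 → T ≤ t → nullEnergy P Q φ ℓ s t θ ≤ B * t ^ (1 / 2 : ℝ) := by
  have ht₀ := h.t₀_nonneg
  set w : ℝ → ℝ → ℝ := fun t θ => c₀ * Real.exp (Λ t θ / 2) * twist J K P Q t θ with hw
  have cw0 : SmoothOnCylinder t₀ fun t θ => c₀ * Real.exp (Λ t θ / 2) :=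
    (SmoothOnCylinder.const c₀).mul h.cylΛ.half.exp
  have cw : SmoothOnCylinder t₀ w := cw0.mul h.cyl_twist
  have cy : SmoothOnCylinder t₀ fun t θ => t ^ (-2 : ℝ) * w t θ :=
    (SmoothOnCylinder.rpow ht₀ _).mul cw
  -- `F i t` is `t^{-1/2}` times the energy density in the direction `i`, to which the twist term
  -- `t⁻² w` is added in order to compensate the twist sources in its evolution equation
  set F : ℤˣ → ℝ → ℝ → ℝ := fun i t θ => t ^ (-(1 / 2) : ℝ) *
    (nullEnergy P Q φ ℓ ((i : ℤ) : ℝ) t θ + t ^ (-2 : ℝ) * w t θ) with hF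
  have cF : ∀ i, SmoothOnCylinder t₀ (F i) := fun i =>
    (SmoothOnCylinder.rpow ht₀ _).mul ((h.cyl_nullEnergy _).add cy)
  have hwnn : ∀ t θ, 0 ≤ w t θ := fun t θ =>
    mul_nonneg (mul_nonneg h.c₀_pos.le (Real.exp_pos _).le) (twist_nonneg _ _ _ _)
  obtain ⟨B, hB⟩ := maximum_principle (f := F) (C := 0) ht₀ (fun i => (cF i).1)
    (fun i => (cF i).2) hT (by
    intro i t θ ht hmax _ hth
    have ht1 : t₀ < t := hT.trans_le ht
    have ht' : 0 < t := ht₀.trans_lt ht1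
    have hqr := Real.rpow_neg_half_mul ht'
    have hqpos : 0 < t ^ (-(1 / 2) : ℝ) := by positivity
    have hs : ((i : ℤ) : ℝ) ^ 2 = 1 := by
      rcases Int.units_eq_one_or i with hi | hi <;> simp [hi]
    have hneg : (((-i : ℤˣ) : ℤ) : ℝ) = -((i : ℤ) : ℝ) := by push_cast; rfl
    set s : ℝ := ((i : ℤ) : ℝ) with hs_def
    have hAA : nullEnergy P Q φ ℓ (-s) t θ ≤ nullEnergy P Q φ ℓ s t θ := by
      have := le_of_mul_le_mul_left (hmax (-i) θ) hqpos
      rw [hneg] at this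
      linarith
    -- the evolution of the quantity along the null direction
    have e1 : nullD ℓ (-s) (F i) t θ = t ^ (3 / 2 : ℝ) * dt (F i) t θ := by
      rw [nullD, hth, mul_zero, add_zero]
    have e2 : nullD ℓ (-s) w t θ = w t θ * ((t ^ (-(1 / 2) : ℝ) * nullEnergy P Q φ ℓ (-s) t θ
        + t ^ (3 / 2 : ℝ) * dt ℓ t θ) / 2) - c₀ * Real.exp (Λ t θ / 2) *
        (twistDiff J K P Q t θ * nullD ℓ (-s) P t θ
          + 2 * twistProd J K Q t θ * nullDQ P Q ℓ (-s) t θ) := by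
      rw [nullD_mul cw0.sm h.cyl_twist.sm ht1, nullD_mul (Sm.const _) h.cylΛ.half.exp.sm ht1,
        nullD_exp h.cylΛ.half.sm ht1, nullD_half, nullD_const, h.nullD_lam hs ht1,
        h.nullD_twist _ ht1]
      ring
    have e3 : nullD ℓ (-s) (F i) t θ
        = -(1 / 2) * (nullEnergy P Q φ ℓ s t θ + t ^ (-2 : ℝ) * w t θ)
        + t ^ (-(1 / 2) : ℝ) * (nullD ℓ (-s) (nullEnergy P Q φ ℓ s) t θ
          - 2 * t ^ (-(3 / 2) : ℝ) * w t θ + t ^ (-2 : ℝ) * nullD ℓ (-s) w t θ) := by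
      rw [nullD_mul (Sm.rpow ht₀ _) ((h.cyl_nullEnergy _).add cy).sm ht1,
        nullD_add (h.cyl_nullEnergy _).sm cy.sm ht1, nullD_mul (Sm.rpow ht₀ _) cw.sm ht1,
        nullD_rpow _ _ ht', nullD_rpow _ _ ht']
      norm_num
      ring
    have p4 : (t ^ (-(1 / 2) : ℝ)) ^ 4 = t ^ (-2 : ℝ) := by
      rw [← Real.rpow_mul_natCast ht'.le]; norm_num
    have p5 : (t ^ (-(1 / 2) : ℝ)) ^ 5 = t ^ (-(1 / 2) : ℝ) * t ^ (-2 : ℝ) := by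
      rw [← p4]; ring
    have p3 : t ^ (-(3 / 2) : ℝ) = t ^ (1 / 2 : ℝ) * t ^ (-2 : ℝ) := by
      rw [← Real.rpow_add ht']; norm_num
    have hy : 0 ≤ t ^ (-2 : ℝ) * w t θ := mul_nonneg (by positivity) (hwnn t θ)
    -- here `5/6` enters: `-3 (5/6 - 1) = 1/2`
    have hL : t ^ (3 / 2 : ℝ) * dt ℓ t θ
        ≤ t ^ (1 / 2 : ℝ) / 2 - t ^ (-(1 / 2) : ℝ) * (t ^ (-2 : ℝ) * w t θ) := by
      rw [h.nullD_ell ht1, p5]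
      have h1 := mul_le_mul_of_nonneg_left (hΛ t θ ht) (by positivity : 0 ≤ t ^ (1 / 2 : ℝ))
      simp only [hw]
      linarith
    have hS : ∀ σ : ℝ, nullEnergy P Q φ ℓ σ t θ ≤ nullEnergy P Q φ ℓ s t θ →
        |t ^ (-2 : ℝ) * (c₀ * Real.exp (Λ t θ / 2) * (twistDiff J K P Q t θ * nullD ℓ σ P t θ
          + 2 * twistProd J K Q t θ * nullDQ P Q ℓ σ t θ))|
        ≤ t ^ (-2 : ℝ) * w t θ * Real.sqrt (nullEnergy P Q φ ℓ s t θ) := by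
      intro σ hσ
      have h1 : 0 ≤ t ^ (-2 : ℝ) * (c₀ * Real.exp (Λ t θ / 2)) := by
        have := h.c₀_pos
        positivity
      rw [← mul_assoc, abs_mul, abs_of_nonneg h1]
      have h2 := abs_twist_source_le (J := J) (K := K) (P := P) (Q := Q) (φ := φ) (ℓ := ℓ) σ t θ
      have h3 := h2.trans (mul_le_mul_of_nonneg_left (Real.sqrt_le_sqrt hσ)
        (twist_nonneg (P := P) (Q := Q) J K t θ))
      have h4 := mul_le_mul_of_nonneg_left h3 h1
      simp only [hw]
      linarith
    have hS₁ := (le_abs_self _).trans (hS s le_rfl)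
    have hS₂ := (neg_le_abs _).trans (hS (-s) hAA)
    have key := energy_inequality hqpos hqr hy (nullEnergy_nonneg s t θ) hAA
      (energy_add_inner_nonneg rfl rfl hAA) hL hS₁ hS₂
    have h5 : nullD ℓ (-s) (F i) t θ ≤ 0 := by
      rw [e3, h.nullD_nullEnergy hs ht1, e2, p3, p4]
      have h6 := mul_le_mul_of_nonneg_left key hqpos.le
      rw [← mul_assoc _ (t ^ (1 / 2 : ℝ) / 2),
        ← mul_div_assoc (t ^ (-(1 / 2) : ℝ)) (t ^ (1 / 2 : ℝ)) 2, hqr] at h6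
      refine le_trans (le_of_eq ?_) (sub_nonpos.2 h6)
      ring
    rw [e1] at h5
    rw [zero_mul, zero_mul]
    exact nonpos_of_mul_nonpos_right h5 (by positivity))
  refine ⟨B, fun s t θ hs ht => ?_⟩
  have ht' : 0 < t := ht₀.trans_lt (hT.trans_le ht)
  obtain ⟨i, hi⟩ : ∃ i : ℤˣ, ((i : ℤ) : ℝ) = s := by
    rcases eq_or_eq_neg_of_sq_eq_sq s 1 (by rw [hs, one_pow]) with h1 | h1
    · exact ⟨1, by simp [h1]⟩
    · exact ⟨-1, by simp [h1]⟩
  have h1 := hB i t θ ht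
  have h2 : 0 ≤ t ^ (-2 : ℝ) * w t θ := mul_nonneg (by positivity) (hwnn t θ)
  have h3 : 0 < t ^ (1 / 2 : ℝ) := by positivity
  have h4 := mul_le_mul_of_nonneg_right h1 h3.le
  simp only [hF, hi] at h4
  rw [mul_right_comm, Real.rpow_neg_half_mul ht', one_mul] at h4
  linarith

end NormalizedSystem

section

variable {P Q φ ℓ Λ : ℝ → ℝ → ℝ} {t₀ c₀ J K T : ℝ}

lemma IsOrd.extend {f : ℝ → ℝ → ℝ} (hf : IsOrd T 0 f) (hs : SmoothOnCylinder t₀ f) {t₁ : ℝ}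
    (ht₁ : t₀ < t₁) : IsOrd t₁ 0 f := by
  obtain ⟨B, hB⟩ := hf.exists_bound
  obtain ⟨D, hD⟩ := exists_bound_Icc hs.1 hs.2 ht₁ T
  refine IsOrd.of_bound (B := max B D) fun t θ ht => ?_
  rcases le_total T t with h | h
  · exact (hB t θ h).trans (le_max_left _ _)
  · exact (hD t θ ht h).trans (le_max_right _ _)

lemma IsOrd.twist (hT : 1 ≤ T) (hP : IsOrd T 0 P) (hQ : IsOrd T 0 Q) (J K : ℝ) :
    IsOrd T 0 (twist J K P Q) := by
  have h1 : IsOrd T 0 fun t θ => K - Q t θ * J :=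
    (IsOrd.const K).sub (hQ.mul_le hT (IsOrd.const J) (by norm_num))
  exact ((hP.neg.exp.mul_le hT (IsOrd.const (J ^ 2)) (by norm_num)).add
    (hP.exp.mul_le hT (h1.mul_le hT h1 (by norm_num)) (by norm_num : (0 : ℝ) + 0 ≤ 0))).congr
    fun t θ _ => by rw [T2Sym.twist]; ring

lemma IsOrd.twistDiff (hT : 1 ≤ T) (hP : IsOrd T 0 P) (hQ : IsOrd T 0 Q) (J K : ℝ) :
    IsOrd T 0 (twistDiff J K P Q) := by
  refine (IsOrd.twist hT hP hQ J K).of_le fun t θ _ => ?_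
  refine sq_le_sq.1 ?_
  rw [twist_sq]
  nlinarith [sq_nonneg (twistProd J K Q t θ)]

lemma IsOrd.twistProd (hT : 1 ≤ T) (hQ : IsOrd T 0 Q) (J K : ℝ) :
    IsOrd T 0 (twistProd J K Q) :=
  ((IsOrd.const K).sub (hQ.mul_le hT (IsOrd.const J) (by norm_num))).const_mul J

namespace NormalizedSystem

/-- The unknowns of the first order system for which all estimates are derived: the characteristic
variables, `P`, `Q`, `φ`, `ℓ`, `Λ`, the quantity `t^{1/2} (e^{-Λ/2} - 1)`, and `∂_θ ℓ`. -/
noncomputable def unknowns (P Q φ ℓ Λ : ℝ → ℝ → ℝ) : Fin 13 → ℝ → ℝ → ℝ :=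
  ![nullD ℓ 1 P, nullD ℓ (-1) P, nullDQ P Q ℓ 1, nullDQ P Q ℓ (-1), nullD ℓ 1 φ, nullD ℓ (-1) φ,
    P, Q, φ, ℓ, Λ, fun t θ => t ^ (1 / 2 : ℝ) * (Real.exp (-Λ t θ / 2) - 1), dth ℓ]

lemma cyl_expΛ (h : NormalizedSystem t₀ c₀ J K P Q φ ℓ Λ) (δ : ℝ) :
    SmoothOnCylinder t₀ fun t θ => t ^ δ * (Real.exp (-Λ t θ / 2) - 1) :=
  (SmoothOnCylinder.rpow h.t₀_nonneg δ).mul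
    (h.cylΛ.neg.half.exp.sub (SmoothOnCylinder.const 1))

lemma cyl_unknowns (h : NormalizedSystem t₀ c₀ J K P Q φ ℓ Λ) (i : Fin 13) :
    SmoothOnCylinder t₀ (unknowns P Q φ ℓ Λ i) := by
  fin_cases i
  exacts [h.cyl_nullDP 1, h.cyl_nullDP (-1), h.cyl_nullDQ 1, h.cyl_nullDQ (-1), h.cyl_nullDφ 1,
    h.cyl_nullDφ (-1), h.cylP, h.cylQ, h.cylφ, h.cylℓ, h.cylΛ, h.cyl_expΛ _, h.cylℓ.dth]

/-- All the unknowns are bounded. -/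
theorem isOrd_unknowns (h : NormalizedSystem t₀ c₀ J K P Q φ ℓ Λ)
    (hlam : ∀ ε : ℝ, 0 < ε → ∃ T : ℝ, t₀ < T ∧ ∀ t θ : ℝ, T ≤ t → -ε ≤ Λ t θ) {t₁ : ℝ}
    (ht₁ : t₀ < t₁) (i : Fin 13) : IsOrd t₁ 0 (unknowns P Q φ ℓ Λ i) := by
  have ht₀ := h.t₀_nonneg
  obtain ⟨T₀, hT₀, hT₀'⟩ := hlam (1 / 3) (by norm_num)
  obtain ⟨T, hT1, hT, hTΛ⟩ : ∃ T, 1 ≤ T ∧ t₀ < T ∧ ∀ t θ, T ≤ t → -(1 / 3) ≤ Λ t θ :=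
    ⟨max T₀ 1, le_max_right _ _, hT₀.trans_le (le_max_left _ _),
      fun t θ ht => hT₀' t θ ((le_max_left _ _).trans ht)⟩
  have hT0 : 0 < T := by linarith
  have hpos : ∀ t, T ≤ t → 0 < t := fun t ht => hT0.trans_le ht
  suffices hmain : ∀ i, IsOrd T 0 (unknowns P Q φ ℓ Λ i) from
    (hmain i).extend (h.cyl_unknowns i) ht₁
  have one_sq : (1 : ℝ) ^ 2 = 1 := one_pow 2
  have neg_one_sq : (-1 : ℝ) ^ 2 = 1 := by norm_num
  have ord_q : IsOrd T (-(1 / 2)) fun t _ => t ^ (-(1 / 2) : ℝ) := IsOrd.rpow hT0 _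
  have ord_q5 : ∀ n : ℕ, IsOrd T 0 fun t _ => (t ^ (-(1 / 2) : ℝ)) ^ n := fun n =>
    IsOrd.rpow_pow_le hT1 n (mul_nonpos_of_nonpos_of_nonneg (by norm_num) n.cast_nonneg)
  -- the preliminary estimate of the energy densities applies since `1 + Λ / 2 ≥ 5/6`; it makes the
  -- time derivatives of `P, Q, φ` integrable
  obtain ⟨B, hB⟩ := h.exists_energy_bound hT fun t θ ht => by
    have h1 := Real.add_one_le_exp (Λ t θ / 2)
    linarith [hTΛ t θ ht]
  have ordA : ∀ s : ℝ, s ^ 2 = 1 → IsOrd T (1 / 2) (nullEnergy P Q φ ℓ s) := fun s hs =>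
    ⟨B, fun t θ ht => by rw [abs_of_nonneg (nullEnergy_nonneg _ _ _)]; exact hB s t θ hs ht⟩
  have ord_chars : ∀ r s : ℝ, IsOrd T r (nullEnergy P Q φ ℓ s) →
      IsOrd T (r / 2) (nullD ℓ s P) ∧ IsOrd T (r / 2) (nullDQ P Q ℓ s) ∧
        IsOrd T (r / 2) (nullD ℓ s φ) := by
    intro r s hs
    have h1 := hs.sqrt hT0
    refine ⟨h1.of_le fun t θ _ => ?_, h1.of_le fun t θ _ => ?_, h1.of_le fun t θ _ => ?_⟩ <;>
    · rw [abs_of_nonneg (Real.sqrt_nonneg _)]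
      refine Real.abs_le_sqrt ?_
      rw [nullEnergy]
      nlinarith [sq_nonneg (nullD ℓ s P t θ), sq_nonneg (nullDQ P Q ℓ s t θ),
        sq_nonneg (nullD ℓ s φ t θ)]
  obtain ⟨x1, y1, z1⟩ := ord_chars _ _ (ordA 1 one_sq)
  obtain ⟨x2, y2, z2⟩ := ord_chars _ _ (ordA (-1) neg_one_sq)
  have quarter : (1 / 2 / 2 : ℝ) ≤ 1 / 4 := by norm_num
  have ordP : IsOrd T 0 P := isOrd_of_damped ht₀ h.cylP hT le_rfl (fun t θ _ => by
    rw [rpow_mul_dt (ℓ := ℓ), zero_mul, zero_mul, neg_zero, zero_add])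
    (((x1.add x2).div_const 2).mono hT1 quarter)
  have ordφ : IsOrd T 0 φ := isOrd_of_damped ht₀ h.cylφ hT le_rfl (fun t θ _ => by
    rw [rpow_mul_dt (ℓ := ℓ), zero_mul, zero_mul, neg_zero, zero_add])
    (((z1.add z2).div_const 2).mono hT1 quarter)
  have ordQ : IsOrd T 0 Q := isOrd_of_damped ht₀ h.cylQ hT le_rfl (fun t θ _ => by
    rw [rpow_mul_dtQ (ℓ := ℓ) (P := P), zero_mul, zero_mul, neg_zero, zero_add])
    (ordP.neg.exp.mul_le hT1 ((y1.add y2).div_const 2) (by norm_num))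
  -- the upper bound of `Λ`: where `Λ` is nonnegative, its restoring term has a favorable sign
  have ordΛ : IsOrd T 0 Λ := by
    obtain ⟨D, hD⟩ := maximum_principle (ι := Unit) (f := fun _ => Λ) (C := |B|) ht₀
      (fun _ => h.smΛ) (fun _ => h.perΛ) hT (by
      intro _ t θ ht _ hΛ _
      have ht' := hpos t ht
      have e1 := h.rpow_mul_dt_lam (hT.trans_le ht) θ
      have hqr := Real.rpow_neg_half_mul ht'
      have h1 := hB 1 t θ one_sq ht
      have h2 := hB (-1) t θ neg_one_sq ht
      have h3 : 0 ≤ 3 * t ^ (1 / 2 : ℝ) * (Real.exp (Λ t θ / 2) - 1) := by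
        have := Real.one_le_exp (show 0 ≤ Λ t θ / 2 by linarith)
        exact mul_nonneg (by positivity) (by linarith)
      have h4 : 0 ≤ (t ^ (-(1 / 2) : ℝ)) ^ 5 * (c₀ * Real.exp (Λ t θ / 2) * twist J K P Q t θ) := by
        have := h.c₀_pos
        have := twist_nonneg (P := P) (Q := Q) J K t θ
        positivity
      have h5 : t ^ (-(1 / 2) : ℝ) / 2
          * (nullEnergy P Q φ ℓ 1 t θ + nullEnergy P Q φ ℓ (-1) t θ) ≤ B := by
        have := mul_le_mul_of_nonneg_left (add_le_add h1 h2)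
          (by positivity : 0 ≤ t ^ (-(1 / 2) : ℝ) / 2)
        refine this.trans (le_of_eq ?_)
        linear_combination B * hqr
      have h6 : t ^ (3 / 2 : ℝ) * dt Λ t θ ≤ |B| := by linarith [le_abs_self B]
      have h7 : t ^ (-(3 / 2) : ℝ) * t ^ (3 / 2 : ℝ) = 1 := by
        rw [← Real.rpow_add ht']; norm_num
      have h8 : t ^ (-(3 / 2) : ℝ) ≤ t ^ (-(5 / 4) : ℝ) :=
        Real.rpow_le_rpow_of_exponent_le (hT1.trans ht) (by norm_num)
      calc dt Λ t θ = t ^ (-(3 / 2) : ℝ) * (t ^ (3 / 2 : ℝ) * dt Λ t θ) := by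
            rw [← mul_assoc, h7, one_mul]
        _ ≤ t ^ (-(3 / 2) : ℝ) * |B| := mul_le_mul_of_nonneg_left h6 (by positivity)
        _ ≤ t ^ (-(5 / 4) : ℝ) * |B| := mul_le_mul_of_nonneg_right h8 (abs_nonneg B)
        _ ≤ |B| * t ^ (-(5 / 4) : ℝ) * (1 + Λ t θ) := by
            rw [mul_comm]
            exact le_mul_of_one_le_right (by positivity) (by linarith))
    refine IsOrd.of_bound (B := max D (1 / 3)) fun t θ ht => abs_le.2 ⟨?_, ?_⟩
    · linarith [hTΛ t θ ht, le_max_right D (1 / 3)]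
    · exact (hD () t θ ht).trans (le_max_left _ _)
  have ordE : IsOrd T 0 fun t θ => Real.exp (Λ t θ / 2) := (ordΛ.div_const 2).exp
  have orde : IsOrd T 0 fun t θ => Real.exp (-Λ t θ / 2) := (ordΛ.neg.div_const 2).exp
  have ordw : IsOrd T 0 fun t θ => c₀ * Real.exp (Λ t θ / 2) * twist J K P Q t θ :=
    (ordE.const_mul c₀).mul_le hT1 (IsOrd.twist hT1 ordP ordQ J K) (by norm_num)
  have zero_add_le : (0 : ℝ) + 0 ≤ 0 := by norm_num
  have ordw5 := (ord_q5 5).mul_le hT1 ordw zero_add_le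
  -- a first decay estimate of `Λ`: any rate makes `t^{-3/2} (t^{3/2} ∂_t ℓ)` integrable
  have ordν : IsOrd T 0 fun t θ => t ^ (1 / 4 : ℝ) * (Real.exp (-Λ t θ / 2) - 1) := by
    have h1 := (((ord_q.div_const 2).mul_le hT1 ((ordA 1 one_sq).add (ordA (-1) neg_one_sq))
      (show -(1 / 2) + 1 / 2 ≤ (0 : ℝ) by norm_num)).sub ordw5)
    have h2 := ((((IsOrd.rpow hT0 (1 / 4)).mul_le hT1 orde
      (show (1 / 4 + 0 : ℝ) ≤ 1 / 4 by norm_num)).div_const 2).mul_le hT1 h1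
      (show (1 / 4 + 0 : ℝ) ≤ 1 / 4 by norm_num)).neg
    refine isOrd_of_damped ht₀ (h.cyl_expΛ _) hT (d := 3 / 2 - 1 / 4) (by norm_num)
      (fun t θ ht => ?_) h2
    rw [h.rpow_mul_dt_weighted _ (hT.trans_le ht), sub_eq_add_neg]
  have ordL : IsOrd T (1 / 4) fun t θ => t ^ (3 / 2 : ℝ) * dt ℓ t θ := by
    have h1 := ((((IsOrd.rpow hT0 (1 / 4)).const_mul 3).mul_le hT1 (ordE.mul_le hT1 ordν
      zero_add_le) (show (1 / 4 + 0 : ℝ) ≤ 1 / 4 by norm_num)).sub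
        (ordw5.mono hT1 (show (0 : ℝ) ≤ 1 / 4 by norm_num)))
    refine h1.congr fun t θ ht => ?_
    have ht' := hpos t ht
    have h2 : t ^ (1 / 4 : ℝ) * t ^ (1 / 4 : ℝ) = t ^ (1 / 2 : ℝ) := by
      rw [← Real.rpow_add ht']; norm_num
    rw [h.nullD_ell (hT.trans_le ht)]
    linear_combination (-3 * Real.exp (Λ t θ / 2) * (Real.exp (-Λ t θ / 2) - 1)) * h2
      - 3 * t ^ (1 / 2 : ℝ) * exp_neg_mul_exp (ℓ := Λ) t θ
  -- the energy densities are bounded, since their growth rate `∂_t ℓ` is now integrable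
  have ordA' : ∀ s : ℝ, s ^ 2 = 1 → IsOrd T 0 (nullEnergy P Q φ ℓ s) := by
    obtain ⟨C₁, hC₁⟩ := ordL
    obtain ⟨C₂, hC₂⟩ := ordw.exists_bound
    obtain ⟨D, hD⟩ := maximum_principle (f := fun i : ℤˣ => nullEnergy P Q φ ℓ ((i : ℤ) : ℝ))
      (C := |C₁| + |C₂|) ht₀ (fun i => (h.cyl_nullEnergy _).1) (fun i => (h.cyl_nullEnergy _).2)
      hT (by
      intro i t θ ht hmax _ hth
      have ht1 := hT.trans_le ht
      have ht' := hpos t ht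
      have hs : ((i : ℤ) : ℝ) ^ 2 = 1 := by
        rcases Int.units_eq_one_or i with hi | hi <;> simp [hi]
      have hneg : (((-i : ℤˣ) : ℤ) : ℝ) = -((i : ℤ) : ℝ) := by push_cast; rfl
      have hAA := hmax (-i) θ
      simp only [hneg] at hAA
      set s : ℝ := ((i : ℤ) : ℝ)
      have hA := nullEnergy_nonneg (P := P) (Q := Q) (φ := φ) (ℓ := ℓ) s t θ
      have e1 : t ^ (3 / 2 : ℝ) * dt (nullEnergy P Q φ ℓ s) t θ
          = nullD ℓ (-s) (nullEnergy P Q φ ℓ s) t θ := by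
        rw [nullD, hth, mul_zero, add_zero]
      rw [h.nullD_nullEnergy hs ht1] at e1
      have h1 : 0 ≤ t ^ (1 / 2 : ℝ) * (nullEnergy P Q φ ℓ s t θ
          + (nullD ℓ s P t θ * nullD ℓ (-s) P t θ + nullDQ P Q ℓ s t θ * nullDQ P Q ℓ (-s) t θ
            + 2 * (nullD ℓ s φ t θ * nullD ℓ (-s) φ t θ))) :=
        mul_nonneg (by positivity) (energy_add_inner_nonneg rfl rfl hAA)
      have hr1 : 1 ≤ t ^ (1 / 4 : ℝ) := Real.one_le_rpow (hT1.trans ht) (by norm_num)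
      have h2 : t ^ (3 / 2 : ℝ) * dt ℓ t θ * nullEnergy P Q φ ℓ s t θ
          ≤ |C₁| * t ^ (1 / 4 : ℝ) * (1 + nullEnergy P Q φ ℓ s t θ) := by
        refine mul_le_mul ?_ (by linarith) hA (by positivity)
        exact (le_abs_self _).trans ((hC₁ t θ ht).trans
          (mul_le_mul_of_nonneg_right (le_abs_self C₁) (by positivity)))
      have h3 : (t ^ (-(1 / 2) : ℝ)) ^ 4 * (c₀ * Real.exp (Λ t θ / 2)
          * (twistDiff J K P Q t θ * nullD ℓ s P t θ
            + 2 * twistProd J K Q t θ * nullDQ P Q ℓ s t θ))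
          ≤ |C₂| * t ^ (1 / 4 : ℝ) * (1 + nullEnergy P Q φ ℓ s t θ) := by
        have a1 : (t ^ (-(1 / 2) : ℝ)) ^ 4 ≤ 1 := pow_le_one₀ (by positivity)
          (Real.rpow_le_one_of_one_le_of_nonpos (hT1.trans ht) (by norm_num))
        have a2 := (abs_twist_source_le (J := J) (K := K) (P := P) (Q := Q) (φ := φ) (ℓ := ℓ) s t θ)
        have a3 : 0 ≤ c₀ * Real.exp (Λ t θ / 2) := by
          have := h.c₀_pos
          positivity
        have a4 : Real.sqrt (nullEnergy P Q φ ℓ s t θ) ≤ 1 + nullEnergy P Q φ ℓ s t θ := by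
          refine Real.sqrt_le_iff.2 ⟨by linarith, ?_⟩
          nlinarith
        have a5 : c₀ * Real.exp (Λ t θ / 2) * twist J K P Q t θ ≤ |C₂| * t ^ (1 / 4 : ℝ) :=
          ((le_abs_self _).trans (hC₂ t θ ht)).trans ((le_abs_self C₂).trans
            (le_mul_of_one_le_right (abs_nonneg _) hr1))
        have a6 := mul_nonneg a3 (twist_nonneg (P := P) (Q := Q) J K t θ)
        calc _ ≤ 1 * (c₀ * Real.exp (Λ t θ / 2)
              * (twist J K P Q t θ * Real.sqrt (nullEnergy P Q φ ℓ s t θ))) := by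
              refine (mul_le_mul_of_nonneg_left (mul_le_mul_of_nonneg_left
                ((le_abs_self _).trans a2) a3) (by positivity)).trans
                (mul_le_mul_of_nonneg_right a1 ?_)
              exact mul_nonneg a3 (mul_nonneg (twist_nonneg _ _ _ _) (Real.sqrt_nonneg _))
          _ = c₀ * Real.exp (Λ t θ / 2) * twist J K P Q t θ
              * Real.sqrt (nullEnergy P Q φ ℓ s t θ) := by ring
          _ ≤ _ := mul_le_mul a5 a4 (Real.sqrt_nonneg _) (by positivity)
      have h7 : t ^ (-(3 / 2) : ℝ) * t ^ (3 / 2 : ℝ) = 1 := by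
        rw [← Real.rpow_add ht']; norm_num
      have h8 : t ^ (-(3 / 2) : ℝ) * t ^ (1 / 4 : ℝ) = t ^ (-(5 / 4) : ℝ) := by
        rw [← Real.rpow_add ht']; norm_num
      calc dt (nullEnergy P Q φ ℓ s) t θ
          = t ^ (-(3 / 2) : ℝ) * (t ^ (3 / 2 : ℝ) * dt (nullEnergy P Q φ ℓ s) t θ) := by
            rw [← mul_assoc, h7, one_mul]
        _ ≤ t ^ (-(3 / 2) : ℝ)
            * ((|C₁| + |C₂|) * t ^ (1 / 4 : ℝ) * (1 + nullEnergy P Q φ ℓ s t θ)) := by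
            refine mul_le_mul_of_nonneg_left ?_ (by positivity)
            rw [e1]
            linarith
        _ = _ := by rw [← h8]; ring)
    intro s hs
    refine IsOrd.of_bound (B := D) fun t θ ht => ?_
    rw [abs_of_nonneg (nullEnergy_nonneg _ _ _)]
    rcases eq_or_eq_neg_of_sq_eq_sq s 1 (by rw [hs, one_pow]) with h1 | h1
    · simpa [h1] using hD 1 t θ ht
    · simpa [h1] using hD (-1) t θ ht
  obtain ⟨x1, y1, z1⟩ := ord_chars _ _ (ordA' 1 one_sq)
  obtain ⟨x2, y2, z2⟩ := ord_chars _ _ (ordA' (-1) neg_one_sq)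
  rw [zero_div] at x1 y1 z1 x2 y2 z2
  -- the optimal decay of `Λ`
  have ordμ : IsOrd T 0 fun t θ => t ^ (1 / 2 : ℝ) * (Real.exp (-Λ t θ / 2) - 1) := by
    have h1 := ((ord_q.div_const 2).mul_le hT1 ((ordA' 1 one_sq).add (ordA' (-1) neg_one_sq))
      (show -(1 / 2) + 0 ≤ (-(1 / 2) : ℝ) by norm_num)).sub
      ((IsOrd.rpow_pow_le hT1 (n := 5) (show (-(1 / 2) : ℝ) * (5 : ℕ) ≤ -(1 / 2) by
        norm_num)).mul_le hT1 ordw (show -(1 / 2) + 0 ≤ (-(1 / 2) : ℝ) by norm_num))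
    have h2 := ((((IsOrd.rpow hT0 (1 / 2)).mul_le hT1 orde
      (show (1 / 2 + 0 : ℝ) ≤ 1 / 2 by norm_num)).div_const 2).mul_le hT1 h1
      (show (1 / 2 + -(1 / 2) : ℝ) ≤ 1 / 4 by norm_num)).neg
    refine isOrd_of_damped ht₀ (h.cyl_expΛ _) hT (d := 3 / 2 - 1 / 2) (by norm_num)
      (fun t θ ht => ?_) h2
    rw [h.rpow_mul_dt_weighted _ (hT.trans_le ht), sub_eq_add_neg]
  have ordℓ : IsOrd T 0 ℓ := by
    have h1 := (((ordE.mul_le hT1 ordμ zero_add_le).const_mul 3).sub ordw5).mono hT1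
      (show (0 : ℝ) ≤ 1 / 4 by norm_num)
    refine isOrd_of_damped ht₀ h.cylℓ hT le_rfl (fun t θ ht => ?_) h1
    rw [h.nullD_ell (hT.trans_le ht)]
    linear_combination (-3 * t ^ (1 / 2 : ℝ)) * exp_neg_mul_exp (ℓ := Λ) t θ
  have ordβ : IsOrd T 0 (dth ℓ) := by
    have eA := (ordA' 1 one_sq).sub (ordA' (-1) neg_one_sq)
    have h1 := (ordE.mul_le hT1 (ordℓ.neg.div_const 2).exp zero_add_le).mul_le hT1
      (((eA.const_mul (-(3 / 4))).sub (((ord_q5 6).mul_le hT1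
        (((IsOrd.twist hT1 ordP ordQ J K).const_mul c₀).div_const 4) zero_add_le).mul_le hT1 eA
          zero_add_le)).add (((ord_q5 5).mul_le hT1 (IsOrd.const (c₀ / 2)) zero_add_le).mul_le hT1
        (((IsOrd.twistDiff hT1 ordP ordQ J K).mul_le hT1 (x1.sub x2) zero_add_le).add
          (((IsOrd.twistProd hT1 ordQ J K).const_mul 2).mul_le hT1 (y1.sub y2) zero_add_le))
        zero_add_le)) (show (0 + 0 : ℝ) ≤ 1 / 4 by norm_num)
    refine isOrd_of_damped ht₀ h.cylℓ.dth hT le_rfl (fun t θ ht => ?_) h1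
    rw [h.rpow_mul_dt_dth_ell (hT.trans_le ht), zero_mul, zero_mul, neg_zero, zero_add]
  intro i
  fin_cases i
  exacts [x1, x2, y1, y2, z1, z2, ordP, ordQ, ordφ, ordℓ, ordΛ, ordμ, ordβ]

end NormalizedSystem

end

/-! ### Estimates of the spatial derivatives -/

section Bd

/-- The derivatives `∂_θ^j f` of a smooth function are `O(t^r)` for `j < k`, and `∂_θ^k f` is
`O(t^r (1 + m))`. The weight `m` keeps track of the linear dependence on top order derivatives which
have not been estimated yet. -/
def Bd (t₀ T : ℝ) (m : ℝ → ℝ → ℝ) (r : ℝ) : ℕ → (ℝ → ℝ → ℝ) → Prop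
  | 0, f => SmoothOnCylinder t₀ f ∧ ∃ C, ∀ t θ, T ≤ t → |f t θ| ≤ C * (t ^ r * (1 + m t θ))
  | k + 1, f => SmoothOnCylinder t₀ f ∧ IsOrd T r f ∧ Bd t₀ T m r k (dth f)

namespace Bd

variable {t₀ T r s q : ℝ} {m f h : ℝ → ℝ → ℝ} {k : ℕ}

lemma smooth (hf : Bd t₀ T m r k f) : SmoothOnCylinder t₀ f := by
  cases k <;> exact hf.1

lemma dth (hf : Bd t₀ T m r (k + 1) f) : Bd t₀ T m r k (dth f) := hf.2.2

lemma isOrd (hf : Bd t₀ T m r (k + 1) f) : IsOrd T r f := hf.2.1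

lemma congr (hT : t₀ < T) (hf : Bd t₀ T m r k f) (hfh : ∀ t θ, t₀ < t → h t θ = f t θ) :
    Bd t₀ T m r k h := by
  induction k generalizing f h with
  | zero =>
    obtain ⟨h1, C, hC⟩ := hf
    exact ⟨h1.congr hfh, C, fun t θ ht => by rw [hfh t θ (hT.trans_le ht)]; exact hC t θ ht⟩
  | succ k ih =>
    exact ⟨hf.1.congr hfh, hf.2.1.congr fun t θ ht => hfh t θ (hT.trans_le ht),
      ih hf.2.2 fun t θ ht => dth_congr (fun θ => hfh t θ ht) θ⟩

lemma of_succ (hT : 0 < T) (hm : ∀ t θ, 0 ≤ m t θ) (hf : Bd t₀ T m r (k + 1) f) :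
    Bd t₀ T m r k f := by
  induction k generalizing f with
  | zero =>
    obtain ⟨h1, ⟨C, hC⟩, -⟩ := hf
    refine ⟨h1, C, fun t θ ht => (hC t θ ht).trans ?_⟩
    have ht' : 0 < t ^ r := Real.rpow_pos_of_pos (hT.trans_le ht) r
    have h2 : 0 ≤ C * t ^ r := (abs_nonneg _).trans (hC t θ ht)
    rw [← mul_assoc]
    exact le_mul_of_one_le_right h2 (by linarith [hm t θ])
  | succ k ih => exact ⟨hf.1, hf.2.1, ih hf.2.2⟩

lemma add (hT : t₀ < T) (hf : Bd t₀ T m r k f) (hh : Bd t₀ T m r k h) :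
    Bd t₀ T m r k fun t θ => f t θ + h t θ := by
  induction k generalizing f h with
  | zero =>
    obtain ⟨h1, C, hC⟩ := hf
    obtain ⟨h2, D, hD⟩ := hh
    refine ⟨h1.add h2, C + D, fun t θ ht => (abs_add_le _ _).trans ?_⟩
    linarith [hC t θ ht, hD t θ ht]
  | succ k ih =>
    exact ⟨hf.1.add hh.1, hf.2.1.add hh.2.1, (ih hf.2.2 hh.2.2).congr hT fun t θ ht =>
      dth_add hf.1.1 hh.1.1 ht θ⟩

lemma mono (hT : 1 ≤ T) (hm : ∀ t θ, 0 ≤ m t θ) (hrs : r ≤ s) (hf : Bd t₀ T m r k f) :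
    Bd t₀ T m s k f := by
  induction k generalizing f with
  | zero =>
    obtain ⟨h1, C, hC⟩ := hf
    refine ⟨h1, |C|, fun t θ ht => (hC t θ ht).trans ?_⟩
    have h2 : 1 ≤ t := hT.trans ht
    have h3 := hm t θ
    exact mul_le_mul (le_abs_self C) (mul_le_mul_of_nonneg_right
      (Real.rpow_le_rpow_of_exponent_le h2 hrs) (by positivity)) (by positivity) (abs_nonneg C)
  | succ k ih => exact ⟨hf.1, hf.2.1.mono hT hrs, ih hf.2.2⟩

lemma zero (r : ℝ) (k : ℕ) : Bd t₀ T m r k fun _ _ => 0 := by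
  induction k with
  | zero =>
    refine ⟨SmoothOnCylinder.const 0, 0, fun t θ ht => by simp⟩
  | succ k ih =>
    refine ⟨SmoothOnCylinder.const 0, ⟨0, fun t θ ht => by simp⟩, ?_⟩
    rwa [show T2Sym.dth (fun _ _ => (0 : ℝ)) = fun _ _ => 0 by
      ext t θ; exact dth_time (fun _ => 0) t θ]

lemma rpow (ht₀ : 0 ≤ t₀) (hT : t₀ < T) (hm : ∀ t θ, 0 ≤ m t θ) (r : ℝ) (k : ℕ) :
    Bd t₀ T m r k fun t _ => t ^ r := by
  have hT' : 0 < T := ht₀.trans_lt hT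
  refine of_succ hT' hm ⟨SmoothOnCylinder.rpow ht₀ r, IsOrd.rpow hT' r, ?_⟩
  rw [show T2Sym.dth (fun t _ => t ^ r) = fun _ _ => 0 by
      ext t θ; exact dth_time (fun t => t ^ r) t θ]
  exact zero r k

lemma const (ht₀ : 0 ≤ t₀) (hT : t₀ < T) (hm : ∀ t θ, 0 ≤ m t θ) (c : ℝ) (k : ℕ) :
    Bd t₀ T m 0 k fun _ _ => c := by
  have hT' : 0 < T := ht₀.trans_lt hT
  refine of_succ hT' hm ⟨SmoothOnCylinder.const c, IsOrd.const c, ?_⟩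
  rw [show T2Sym.dth (fun _ _ => c) = fun _ _ => 0 by
      ext t θ; exact dth_time (fun _ => c) t θ]
  exact zero 0 k

/-- Only one of two factors may be of top order. -/
lemma mul_aux (hT : t₀ < T) (hT0 : 0 < T) (hm : ∀ t θ, 0 ≤ m t θ) (hf : Bd t₀ T m r (k + 1) f)
    (hh : Bd t₀ T m s k h) : Bd t₀ T m (r + s) k fun t θ => f t θ * h t θ := by
  induction k generalizing f h r s with
  | zero =>
    obtain ⟨h1, ⟨C, hC⟩, -⟩ := hf
    obtain ⟨h2, D, hD⟩ := hh
    refine ⟨h1.mul h2, C * D, fun t θ ht => ?_⟩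
    rw [abs_mul, Real.rpow_add (hT0.trans_le ht)]
    calc |f t θ| * |h t θ| ≤ (C * t ^ r) * (D * (t ^ s * (1 + m t θ))) :=
          mul_le_mul (hC t θ ht) (hD t θ ht) (abs_nonneg _) ((abs_nonneg _).trans (hC t θ ht))
      _ = C * D * (t ^ r * t ^ s * (1 + m t θ)) := by ring
  | succ k ih =>
    refine ⟨hf.1.mul hh.1, hf.2.1.mul hT0 hh.2.1, ?_⟩
    have h1 := ih hf.2.2 (of_succ hT0 hm hh)
    have h2 := ih (of_succ hT0 hm hf) hh.2.2
    exact (h1.add hT h2).congr hT fun t θ ht => dth_mul hf.1.1 hh.1.1 ht θ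

lemma mul (hT : t₀ < T) (hT0 : 0 < T) (hm : ∀ t θ, 0 ≤ m t θ) (hf : Bd t₀ T m r (k + 1) f)
    (hh : Bd t₀ T m s (k + 1) h) : Bd t₀ T m (r + s) (k + 1) fun t θ => f t θ * h t θ := by
  refine ⟨hf.1.mul hh.1, hf.2.1.mul hT0 hh.2.1, ?_⟩
  have h1 := mul_aux hT hT0 hm hh hf.2.2
  have h2 := mul_aux hT hT0 hm hf hh.2.2
  rw [add_comm s r] at h1
  exact (h1.add hT h2).congr hT fun t θ ht => by
    rw [dth_mul hf.1.1 hh.1.1 ht θ, mul_comm (h t θ)]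

lemma mul_le (hT : t₀ < T) (hT1 : 1 ≤ T) (hm : ∀ t θ, 0 ≤ m t θ) (hf : Bd t₀ T m r (k + 1) f)
    (hh : Bd t₀ T m s (k + 1) h) (hq : r + s ≤ q) :
    Bd t₀ T m q (k + 1) fun t θ => f t θ * h t θ :=
  (mul hT (by linarith) hm hf hh).mono hT1 hm hq

lemma const_mul (ht₀ : 0 ≤ t₀) (hT : t₀ < T) (hm : ∀ t θ, 0 ≤ m t θ) (c : ℝ)
    (hf : Bd t₀ T m r k f) : Bd t₀ T m r k fun t θ => c * f t θ := by
  have := mul_aux hT (ht₀.trans_lt hT) hm (const ht₀ hT hm c (k + 1)) hf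
  rwa [zero_add] at this

lemma div_const (ht₀ : 0 ≤ t₀) (hT : t₀ < T) (hm : ∀ t θ, 0 ≤ m t θ)
    (hf : Bd t₀ T m r k f) (c : ℝ) : Bd t₀ T m r k fun t θ => f t θ / c :=
  (hf.const_mul ht₀ hT hm c⁻¹).congr hT fun t θ _ => by ring

lemma neg (ht₀ : 0 ≤ t₀) (hT : t₀ < T) (hm : ∀ t θ, 0 ≤ m t θ)
    (hf : Bd t₀ T m r k f) : Bd t₀ T m r k fun t θ => -f t θ :=
  (hf.const_mul ht₀ hT hm (-1)).congr hT fun t θ _ => by ring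

lemma sub (ht₀ : 0 ≤ t₀) (hT : t₀ < T) (hm : ∀ t θ, 0 ≤ m t θ)
    (hf : Bd t₀ T m r k f) (hh : Bd t₀ T m r k h) : Bd t₀ T m r k fun t θ => f t θ - h t θ :=
  (hf.add hT (hh.neg ht₀ hT hm)).congr hT fun t θ _ => by ring

lemma exp (hT : t₀ < T) (hT0 : 0 < T) (hm : ∀ t θ, 0 ≤ m t θ) (hf : Bd t₀ T m 0 (k + 1) f) :
    Bd t₀ T m 0 (k + 1) fun t θ => Real.exp (f t θ) := by
  induction k with
  | zero =>
    refine ⟨hf.1.exp, hf.2.1.exp, ?_⟩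
    obtain ⟨B, hB⟩ := hf.2.1.exp.exists_bound
    obtain ⟨h1, D, hD⟩ := hf.2.2
    refine ⟨hf.1.exp.dth, B * D, fun t θ ht => ?_⟩
    rw [dth_exp hf.1.1 (hT.trans_le ht), abs_mul, mul_assoc]
    exact mul_le_mul (hB t θ ht) (hD t θ ht) (abs_nonneg _) ((abs_nonneg _).trans (hB t θ ht))
  | succ k ih =>
    refine ⟨hf.1.exp, hf.2.1.exp, ?_⟩
    have h1 := mul hT hT0 hm (ih (of_succ hT0 hm hf)) hf.2.2
    rw [zero_add] at h1
    exact h1.congr hT fun t θ ht => dth_exp hf.1.1 ht θ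

/-- Estimates of the derivatives of order at most `k` and of the derivative of order `k + 1`. -/
lemma succ_of_iterate (hf : Bd t₀ T (fun _ _ => 0) r k f)
    (hC : ∃ C, ∀ t θ, T ≤ t → |T2Sym.dth^[k + 1] f t θ| ≤ C * (t ^ r * (1 + m t θ))) :
    Bd t₀ T m r (k + 1) f := by
  induction k generalizing f with
  | zero =>
    obtain ⟨h1, C, hC'⟩ := hf
    exact ⟨h1, ⟨C, fun t θ ht => by simpa using hC' t θ ht⟩, h1.dth, hC⟩
  | succ k ih => exact ⟨hf.1, hf.2.1, ih hf.2.2 hC⟩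

lemma iterate (hf : Bd t₀ T m r k f) :
    ∃ C, ∀ t θ, T ≤ t → |T2Sym.dth^[k] f t θ| ≤ C * (t ^ r * (1 + m t θ)) := by
  induction k generalizing f with
  | zero => exact hf.2
  | succ k ih => exact ih hf.2.2

end Bd

end Bd

section HigherOrder

variable {t₀ T : ℝ} {ℓ : ℝ → ℝ → ℝ}

lemma SmoothOnCylinder.iterate {f : ℝ → ℝ → ℝ} (hf : SmoothOnCylinder t₀ f) (k : ℕ) :
    SmoothOnCylinder t₀ (T2Sym.dth^[k] f) := by
  induction k generalizing f with
  | zero => exact hf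
  | succ k ih => exact ih hf.dth

/-- The equation satisfied by `∂_θ U`. -/
lemma nullD_dth (hℓ : SmoothOnCylinder t₀ ℓ) {σ d : ℝ} {U U' S : ℝ → ℝ → ℝ}
    (hU : SmoothOnCylinder t₀ U) (hU' : SmoothOnCylinder t₀ U') (hS : SmoothOnCylinder t₀ S)
    (heq : ∀ t θ, t₀ < t →
      nullD ℓ σ U t θ = -(d * t ^ (1 / 2 : ℝ) * (U t θ + U' t θ)) + S t θ) {t : ℝ} (ht : t₀ < t)
    (θ : ℝ) :
    nullD ℓ σ (dth U) t θ = -(d * t ^ (1 / 2 : ℝ) * (dth U t θ + dth U' t θ))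
      + (dth S t θ - σ / 2 * (Real.exp (ℓ t θ / 2) * (dth ℓ t θ * dth U t θ))) := by
  have h1 : dth (nullD ℓ σ U) t θ
      = -(d * t ^ (1 / 2 : ℝ) * (dth U t θ + dth U' t θ)) + dth S t θ :=
    (congrArg (deriv · θ) (funext fun θ => heq t θ ht)).trans
      ((((hU.sm.hasDerivAt_th ht θ).add (hU'.sm.hasDerivAt_th ht θ)).const_mul
        (d * t ^ (1 / 2 : ℝ))).neg.add (hS.sm.hasDerivAt_th ht θ)).deriv
  have h2 : dth (nullD ℓ σ U) t θ = t ^ (3 / 2 : ℝ) * dth (dt U) t θ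
      + (σ * (Real.exp (ℓ t θ / 2) * (dth ℓ t θ / 2)) * dth U t θ
        + σ * Real.exp (ℓ t θ / 2) * dth (dth U) t θ) :=
    (((hU.dt.sm.hasDerivAt_th ht θ).const_mul _).add
      ((((hℓ.sm.hasDerivAt_th ht θ).div_const 2).exp.const_mul σ).mul
        (hU.dth.sm.hasDerivAt_th ht θ))).deriv
  rw [nullD, hU.sm.dt_dth_comm ht]
  linear_combination h1 - h2

/-- The equation satisfied by `∂_θ^k U`; the coefficient `e^{ℓ/2}` loses no derivative since `∂_θ ℓ`
is estimated along with `ℓ`. -/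
lemma exists_iterate_source (ht₀ : 0 ≤ t₀) (hT : t₀ < T) {m : ℝ → ℝ → ℝ}
    (hm : ∀ t θ, 0 ≤ m t θ) {σ d : ℝ} {k : ℕ} {U U' S : ℝ → ℝ → ℝ}
    (hℓ : Bd t₀ T m 0 k fun t θ => Real.exp (ℓ t θ / 2) * dth ℓ t θ)
    (hℓs : SmoothOnCylinder t₀ ℓ) (hU : Bd t₀ T m 0 k U) (hU' : SmoothOnCylinder t₀ U')
    (hS : Bd t₀ T m 0 k S)
    (heq : ∀ t θ, t₀ < t →
      nullD ℓ σ U t θ = -(d * t ^ (1 / 2 : ℝ) * (U t θ + U' t θ)) + S t θ) :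
    ∃ S' : ℝ → ℝ → ℝ, (∀ t θ, t₀ < t → nullD ℓ σ (dth^[k] U) t θ
      = -(d * t ^ (1 / 2 : ℝ) * (dth^[k] U t θ + dth^[k] U' t θ)) + S' t θ) ∧
      ∃ C, ∀ t θ, T ≤ t → |S' t θ| ≤ C * (1 + m t θ) := by
  have hT0 : 0 < T := ht₀.trans_lt hT
  induction k generalizing U U' S with
  | zero =>
    obtain ⟨-, C, hC⟩ := hS
    exact ⟨S, heq, C, fun t θ ht => by simpa using hC t θ ht⟩
  | succ k ih =>
    refine ih (hℓ.of_succ hT0 hm) hU.dth hU'.dth (S := fun t θ => dth S t θ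
      - σ / 2 * (Real.exp (ℓ t θ / 2) * (dth ℓ t θ * dth U t θ))) ?_
      fun t θ ht => nullD_dth hℓs hU.smooth hU' hS.smooth heq ht θ
    have h1 := Bd.mul_aux hT hT0 hm hℓ hU.dth
    rw [zero_add] at h1
    exact (hS.dth.sub ht₀ hT hm (h1.const_mul ht₀ hT hm (σ / 2))).congr hT fun t θ _ => by ring

/-- Boundedness of all spatial derivatives of the solutions of a semilinear symmetric hyperbolic
system: in the equations for the derivatives of order `k + 1` the sources are linear in these
derivatives, with bounded coefficients, so that the maximum principle applies. -/
theorem bd_of_system {ι : Type*} [Fintype ι] (ht₀ : 0 ≤ t₀) (hT : t₀ < T) (hT1 : 1 ≤ T)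
    {U : ι → ℝ → ℝ → ℝ} (hU : ∀ i, SmoothOnCylinder t₀ (U i)) (h0 : ∀ i, IsOrd T 0 (U i))
    (hℓs : SmoothOnCylinder t₀ ℓ)
    (hℓ : ∀ (k : ℕ) (m : ℝ → ℝ → ℝ), (∀ t θ, 0 ≤ m t θ) → (∀ j, Bd t₀ T m 0 (k + 1) (U j)) →
      Bd t₀ T m 0 (k + 1) fun t θ => Real.exp (ℓ t θ / 2) * dth ℓ t θ)
    (heq : ∀ i, ∃ (σ d : ℝ) (j : ι) (S : ℝ → ℝ → ℝ), 0 ≤ d ∧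
      (∀ t θ, t₀ < t →
        nullD ℓ σ (U i) t θ = -(d * t ^ (1 / 2 : ℝ) * (U i t θ + U j t θ)) + S t θ) ∧
      ∀ (k : ℕ) (m : ℝ → ℝ → ℝ), (∀ t θ, 0 ≤ m t θ) → (∀ j, Bd t₀ T m 0 (k + 1) (U j)) →
        Bd t₀ T m 0 (k + 1) S) (k : ℕ) (i : ι) :
    Bd t₀ T (fun _ _ => 0) 0 k (U i) := by
  induction k generalizing i with
  | zero =>
    obtain ⟨B, hB⟩ := (h0 i).exists_bound
    exact ⟨hU i, B, fun t θ ht => by simpa using hB t θ ht⟩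
  | succ k ih =>
    -- the weight measures the derivatives of order `k + 1`, which are not yet estimated
    set m : ℝ → ℝ → ℝ := fun t θ => ∑ j, |dth^[k + 1] (U j) t θ| with hm_def
    have hm : ∀ t θ, 0 ≤ m t θ := fun t θ => Finset.sum_nonneg fun j _ => abs_nonneg _
    have hB : ∀ j, Bd t₀ T m 0 (k + 1) (U j) := by
      refine fun j => (ih j).succ_of_iterate ⟨1, fun t θ _ => ?_⟩
      have h1 : |dth^[k + 1] (U j) t θ| ≤ m t θ :=
        Finset.single_le_sum (f := fun j => |dth^[k + 1] (U j) t θ|)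
          (fun j _ => abs_nonneg _) (Finset.mem_univ j)
      rw [Real.rpow_zero]
      linarith
    choose σ d j S hd heq' hS using heq
    choose S' hS'eq C hC using fun i => exists_iterate_source ht₀ hT hm (hℓ k m hm hB) hℓs (hB i)
      (hU (j i)) (hS i k m hm hB) (heq' i)
    obtain ⟨D, hD⟩ := (Set.finite_range fun i => |C i|).bddAbove
    have hD' : ∀ i, |C i| ≤ D := fun i => hD (mem_range_self i)
    obtain ⟨B, hB'⟩ := maximum_principle_abs (f := fun i => dth^[k + 1] (U i))
      (C := D * (1 + Fintype.card ι)) ht₀ (fun i => ((hU i).iterate _).1)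
      (fun i => ((hU i).iterate _).2) hT (by
      intro i t θ ht hmax hzero
      have ht1 := hT.trans_le ht
      have ht' : 0 < t := ht₀.trans_lt ht1
      have e1 := hS'eq i t θ ht1
      have h1 := hC i t θ ht
      have hD0 : 0 ≤ D := (abs_nonneg _).trans (hD' i)
      set v := dth^[k + 1] (U i) t θ
      set v' := dth^[k + 1] (U (j i)) t θ with hv'
      have h2 : m t θ ≤ Fintype.card ι * |v| := by
        rw [hm_def, ← nsmul_eq_mul, ← Finset.card_univ, ← Finset.sum_const]
        exact Finset.sum_le_sum fun j _ => hmax j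
      -- the damping term has a sign at a maximum of the whole family
      have h3 : 0 ≤ d i * t ^ (1 / 2 : ℝ) * (v * (v + v')) := by
        have h4 : |v * v'| ≤ v ^ 2 := by
          rw [abs_mul, ← sq_abs v, sq]
          exact mul_le_mul_of_nonneg_left (hmax (j i)) (abs_nonneg v)
        have := hd i
        refine mul_nonneg (by positivity) ?_
        nlinarith [neg_le_of_abs_le h4]
      have h5 : v * S' i t θ ≤ D * (1 + Fintype.card ι) * (1 + v ^ 2) := by
        have h6 : |S' i t θ| ≤ D * (1 + Fintype.card ι * |v|) :=
          h1.trans (mul_le_mul ((le_abs_self _).trans (hD' i)) (by linarith)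
            (by linarith [hm t θ]) hD0)
        have h7 : |v| ≤ 1 + v ^ 2 := by
          have := sq_abs v
          nlinarith [sq_nonneg (|v| - 1 / 2)]
        have h8 : |v| * (1 + Fintype.card ι * |v|) ≤ (1 + Fintype.card ι) * (1 + v ^ 2) := by
          have := sq_abs v
          have hn : (0 : ℝ) ≤ Fintype.card ι := Nat.cast_nonneg _
          nlinarith
        calc v * S' i t θ ≤ |v| * |S' i t θ| := by rw [← abs_mul]; exact le_abs_self _
          _ ≤ |v| * (D * (1 + Fintype.card ι * |v|)) :=
            mul_le_mul_of_nonneg_left h6 (abs_nonneg v)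
          _ = D * (|v| * (1 + Fintype.card ι * |v|)) := by ring
          _ ≤ D * ((1 + Fintype.card ι) * (1 + v ^ 2)) := mul_le_mul_of_nonneg_left h8 hD0
          _ = _ := by ring
      have h7 : t ^ (-(3 / 2) : ℝ) * t ^ (3 / 2 : ℝ) = 1 := by
        rw [← Real.rpow_add ht']; norm_num
      have h8 : t ^ (-(3 / 2) : ℝ) ≤ t ^ (-(5 / 4) : ℝ) :=
        Real.rpow_le_rpow_of_exponent_le (hT1.trans ht) (by norm_num)
      have e2 : t ^ (3 / 2 : ℝ) * (v * dt (dth^[k + 1] (U i)) t θ)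
          = -(d i * t ^ (1 / 2 : ℝ) * (v * (v + v'))) + v * S' i t θ := by
        rw [nullD] at e1
        linear_combination v * e1 - σ i * Real.exp (ℓ t θ / 2) * hzero
      calc v * dt (dth^[k + 1] (U i)) t θ
          = t ^ (-(3 / 2) : ℝ) * (t ^ (3 / 2 : ℝ) * (v * dt (dth^[k + 1] (U i)) t θ)) := by
            rw [← mul_assoc, h7, one_mul]
        _ ≤ t ^ (-(3 / 2) : ℝ) * (D * (1 + Fintype.card ι) * (1 + v ^ 2)) :=
            mul_le_mul_of_nonneg_left (by rw [e2]; linarith) (by positivity)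
        _ ≤ t ^ (-(5 / 4) : ℝ) * (D * (1 + Fintype.card ι) * (1 + v ^ 2)) :=
            mul_le_mul_of_nonneg_right h8 (by positivity)
        _ = _ := by ring)
    exact (ih i).succ_of_iterate ⟨B, fun t θ ht => by simpa using hB' i t θ ht⟩

end HigherOrder

namespace NormalizedSystem

variable {P Q φ ℓ Λ : ℝ → ℝ → ℝ} {t₀ c₀ J K T : ℝ} {m : ℝ → ℝ → ℝ} {k : ℕ}

/-- Estimates of the unknowns give estimates of all the coefficients of the system. -/
lemma bd_coefficients (h : NormalizedSystem t₀ c₀ J K P Q φ ℓ Λ) (hT : t₀ < T) (hT1 : 1 ≤ T)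
    (hm : ∀ t θ, 0 ≤ m t θ) (hB : ∀ j, Bd t₀ T m 0 (k + 1) (unknowns P Q φ ℓ Λ j)) :
    (∀ s : ℝ, s ^ 2 = 1 → Bd t₀ T m 0 (k + 1) (nullD ℓ s P) ∧
      Bd t₀ T m 0 (k + 1) (nullDQ P Q ℓ s) ∧ Bd t₀ T m 0 (k + 1) (nullD ℓ s φ) ∧
      Bd t₀ T m 0 (k + 1) (nullEnergy P Q φ ℓ s)) ∧
    Bd t₀ T m 0 (k + 1) (fun t θ => Real.exp (-P t θ)) ∧
    Bd t₀ T m 0 (k + 1) (fun t θ => Real.exp (Λ t θ / 2)) ∧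
    Bd t₀ T m 0 (k + 1) (fun t θ => Real.exp (-Λ t θ / 2)) ∧
    Bd t₀ T m 0 (k + 1) (fun t θ => Real.exp (ℓ t θ / 2)) ∧
    Bd t₀ T m 0 (k + 1) (fun t θ => Real.exp (-ℓ t θ / 2)) ∧
    Bd t₀ T m 0 (k + 1) (twist J K P Q) ∧ Bd t₀ T m 0 (k + 1) (twistDiff J K P Q) ∧
    Bd t₀ T m 0 (k + 1) (twistProd J K Q) := by
  have ht₀ := h.t₀_nonneg
  have hT0 : 0 < T := by linarith
  have z : (0 : ℝ) + 0 ≤ 0 := by norm_num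
  have bP : Bd t₀ T m 0 (k + 1) P := hB 6
  have bQ : Bd t₀ T m 0 (k + 1) Q := hB 7
  have bℓ : Bd t₀ T m 0 (k + 1) ℓ := hB 9
  have bΛ : Bd t₀ T m 0 (k + 1) Λ := hB 10
  have chars : ∀ s : ℝ, s ^ 2 = 1 → Bd t₀ T m 0 (k + 1) (nullD ℓ s P) ∧
      Bd t₀ T m 0 (k + 1) (nullDQ P Q ℓ s) ∧ Bd t₀ T m 0 (k + 1) (nullD ℓ s φ) := by
    intro s hs
    rcases eq_or_eq_neg_of_sq_eq_sq s 1 (by rw [hs, one_pow]) with rfl | rfl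
    exacts [⟨hB 0, hB 2, hB 4⟩, ⟨hB 1, hB 3, hB 5⟩]
  have bexpP := bP.exp hT hT0 hm
  have bexpnP := (bP.neg ht₀ hT hm).exp hT hT0 hm
  have bK : Bd t₀ T m 0 (k + 1) fun t θ => K - Q t θ * J :=
    ((Bd.const ht₀ hT hm K _).sub ht₀ hT hm (bQ.const_mul ht₀ hT hm J)).congr hT
      fun t θ _ => by ring
  have bp := bexpnP.const_mul ht₀ hT hm (J ^ 2)
  have bq := bexpP.mul_le hT hT1 hm (bK.mul_le hT hT1 hm bK z) z
  refine ⟨fun s hs => ⟨(chars s hs).1, (chars s hs).2.1, (chars s hs).2.2, ?_⟩, bexpnP,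
    (bΛ.div_const ht₀ hT hm 2).exp hT hT0 hm,
    ((bΛ.neg ht₀ hT hm).div_const ht₀ hT hm 2).exp hT hT0 hm,
    (bℓ.div_const ht₀ hT hm 2).exp hT hT0 hm,
    ((bℓ.neg ht₀ hT hm).div_const ht₀ hT hm 2).exp hT hT0 hm, ?_, ?_, ?_⟩
  · obtain ⟨x, y, z'⟩ := chars s hs
    refine (((x.mul_le hT hT1 hm x z).add hT (y.mul_le hT hT1 hm y z)).add hT
      ((z'.mul_le hT hT1 hm z' z).const_mul ht₀ hT hm 2)).congr hT fun t θ _ => ?_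
    rw [nullEnergy]; ring
  · exact (bp.add hT bq).congr hT fun t θ _ => by rw [twist]; ring
  · exact (bp.sub ht₀ hT hm bq).congr hT fun t θ _ => by rw [twistDiff]; ring
  · exact bK.const_mul ht₀ hT hm J

lemma bd_rpow_pow (ht₀ : 0 ≤ t₀) (hT : t₀ < T) (hm : ∀ t θ, 0 ≤ m t θ) (n : ℕ) :
    Bd t₀ T m (-(n / 2)) (k + 1) fun t _ => (t ^ (-(1 / 2) : ℝ)) ^ n := by
  refine (Bd.rpow ht₀ hT hm (-(n / 2)) (k + 1)).congr hT fun t _ ht => ?_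
  rw [← Real.rpow_mul_natCast (ht₀.trans ht.le)]
  congr 1; ring

/-- The coefficient `t^{3/2} ∂_t ℓ`. -/
lemma bd_ell_t (h : NormalizedSystem t₀ c₀ J K P Q φ ℓ Λ) (hT : t₀ < T) (hT1 : 1 ≤ T)
    (hm : ∀ t θ, 0 ≤ m t θ) (hB : ∀ j, Bd t₀ T m 0 (k + 1) (unknowns P Q φ ℓ Λ j)) :
    Bd t₀ T m 0 (k + 1) fun t θ => t ^ (3 / 2 : ℝ) * dt ℓ t θ := by
  have ht₀ := h.t₀_nonneg
  obtain ⟨-, -, bE, -, -, -, bτ, -⟩ := h.bd_coefficients hT hT1 hm hB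
  have bμ : Bd t₀ T m 0 (k + 1) fun t θ => t ^ (1 / 2 : ℝ) * (Real.exp (-Λ t θ / 2) - 1) := hB 11
  have b5 := (bd_rpow_pow (k := k) ht₀ hT hm 5).mul_le hT hT1 hm
    ((bE.const_mul ht₀ hT hm c₀).mul_le hT hT1 hm bτ (by norm_num : (0 : ℝ) + 0 ≤ 0))
    (by norm_num : -((5 : ℕ) / 2 : ℝ) + 0 ≤ 0)
  refine (((bE.mul_le hT hT1 hm bμ (by norm_num : (0 : ℝ) + 0 ≤ 0)).const_mul ht₀ hT hm 3).sub
    ht₀ hT hm b5).congr hT fun t θ ht => ?_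
  rw [h.nullD_ell ht]
  linear_combination (-3 * t ^ (1 / 2 : ℝ)) * exp_neg_mul_exp (ℓ := Λ) t θ

lemma nullD_zero (f : ℝ → ℝ → ℝ) (t θ : ℝ) :
    nullD ℓ 0 f t θ = t ^ (3 / 2 : ℝ) * dt f t θ := by
  rw [nullD]; ring

lemma exists_source_P (h : NormalizedSystem t₀ c₀ J K P Q φ ℓ Λ) (hT : t₀ < T) (hT1 : 1 ≤ T)
    {s : ℝ} (hs : s ^ 2 = 1) : ∃ S : ℝ → ℝ → ℝ, (∀ t θ, t₀ < t →
      nullD ℓ (-s) (nullD ℓ s P) t θ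
        = -(1 / 2 * t ^ (1 / 2 : ℝ) * (nullD ℓ s P t θ + nullD ℓ (-s) P t θ)) + S t θ) ∧
      ∀ (k : ℕ) (m : ℝ → ℝ → ℝ), (∀ t θ, 0 ≤ m t θ) →
        (∀ j, Bd t₀ T m 0 (k + 1) (unknowns P Q φ ℓ Λ j)) → Bd t₀ T m 0 (k + 1) S := by
  have ht₀ := h.t₀_nonneg
  have z : (0 : ℝ) + 0 ≤ 0 := by norm_num
  refine ⟨_, fun t θ ht => (h.nullD_nullDP hs ht θ).trans (by
    rw [neg_mul, neg_mul]), fun k m hm hB => ?_⟩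
  obtain ⟨bA, -, bE, -, -, -, -, bD, -⟩ := h.bd_coefficients hT hT1 hm hB
  have hs' : (-s) ^ 2 = 1 := by rw [neg_sq, hs]
  exact ((((h.bd_ell_t hT hT1 hm hB).div_const ht₀ hT hm 2).mul_le hT hT1 hm (bA s hs).1 z).add
    hT ((bA s hs).2.1.mul_le hT hT1 hm (bA (-s) hs').2.1 z)).add hT
    ((bd_rpow_pow ht₀ hT hm 4).mul_le hT hT1 hm (((bE.const_mul ht₀ hT hm c₀).mul_le hT hT1
      hm bD z).div_const ht₀ hT hm 2) (by norm_num))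

lemma exists_source_Q (h : NormalizedSystem t₀ c₀ J K P Q φ ℓ Λ) (hT : t₀ < T) (hT1 : 1 ≤ T)
    {s : ℝ} (hs : s ^ 2 = 1) : ∃ S : ℝ → ℝ → ℝ, (∀ t θ, t₀ < t →
      nullD ℓ (-s) (nullDQ P Q ℓ s) t θ
        = -(1 / 2 * t ^ (1 / 2 : ℝ) * (nullDQ P Q ℓ s t θ + nullDQ P Q ℓ (-s) t θ)) + S t θ) ∧
      ∀ (k : ℕ) (m : ℝ → ℝ → ℝ), (∀ t θ, 0 ≤ m t θ) →
        (∀ j, Bd t₀ T m 0 (k + 1) (unknowns P Q φ ℓ Λ j)) → Bd t₀ T m 0 (k + 1) S := by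
  have ht₀ := h.t₀_nonneg
  have z : (0 : ℝ) + 0 ≤ 0 := by norm_num
  refine ⟨_, fun t θ ht => (h.nullD_nullDQ hs ht θ).trans (by
    rw [neg_mul, neg_mul]), fun k m hm hB => ?_⟩
  obtain ⟨bA, -, bE, -, -, -, -, -, bJK⟩ := h.bd_coefficients hT hT1 hm hB
  have hs' : (-s) ^ 2 = 1 := by rw [neg_sq, hs]
  exact ((((h.bd_ell_t hT hT1 hm hB).div_const ht₀ hT hm 2).mul_le hT hT1 hm
    (bA s hs).2.1 z).sub ht₀ hT hm ((bA s hs).1.mul_le hT hT1 hm (bA (-s) hs').2.1 z)).add hT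
    ((bd_rpow_pow ht₀ hT hm 4).mul_le hT hT1 hm ((bE.const_mul ht₀ hT hm c₀).mul_le hT hT1
      hm bJK z) (by norm_num))

lemma exists_source_phi (h : NormalizedSystem t₀ c₀ J K P Q φ ℓ Λ) (hT : t₀ < T) (hT1 : 1 ≤ T)
    {s : ℝ} (hs : s ^ 2 = 1) : ∃ S : ℝ → ℝ → ℝ, (∀ t θ, t₀ < t →
      nullD ℓ (-s) (nullD ℓ s φ) t θ
        = -(1 / 2 * t ^ (1 / 2 : ℝ) * (nullD ℓ s φ t θ + nullD ℓ (-s) φ t θ)) + S t θ) ∧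
      ∀ (k : ℕ) (m : ℝ → ℝ → ℝ), (∀ t θ, 0 ≤ m t θ) →
        (∀ j, Bd t₀ T m 0 (k + 1) (unknowns P Q φ ℓ Λ j)) → Bd t₀ T m 0 (k + 1) S := by
  have ht₀ := h.t₀_nonneg
  have z : (0 : ℝ) + 0 ≤ 0 := by norm_num
  refine ⟨_, fun t θ ht => (h.nullD_nullDφ hs ht θ).trans (by
    rw [neg_mul, neg_mul]), fun k m hm hB => ?_⟩
  obtain ⟨bA, -⟩ := h.bd_coefficients hT hT1 hm hB
  exact ((h.bd_ell_t hT hT1 hm hB).div_const ht₀ hT hm 2).mul_le hT hT1 hm (bA s hs).2.2.1 z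

/-- The evolution of `t^{1/2} (e^{-Λ/2} - 1)` is damped. -/
lemma exists_source_weighted (h : NormalizedSystem t₀ c₀ J K P Q φ ℓ Λ) (hT : t₀ < T)
    (hT1 : 1 ≤ T) : ∃ S : ℝ → ℝ → ℝ, (∀ t θ, t₀ < t →
      t ^ (3 / 2 : ℝ) * dt (fun t θ => t ^ (1 / 2 : ℝ) * (Real.exp (-Λ t θ / 2) - 1)) t θ
        = -(t ^ (1 / 2 : ℝ) * (t ^ (1 / 2 : ℝ) * (Real.exp (-Λ t θ / 2) - 1))) + S t θ) ∧
      ∀ (k : ℕ) (m : ℝ → ℝ → ℝ), (∀ t θ, 0 ≤ m t θ) →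
        (∀ j, Bd t₀ T m 0 (k + 1) (unknowns P Q φ ℓ Λ j)) → Bd t₀ T m 0 (k + 1) S := by
  have ht₀ := h.t₀_nonneg
  have z : (0 : ℝ) + 0 ≤ 0 := by norm_num
  refine ⟨fun t θ => -(Real.exp (-Λ t θ / 2) / 2
    * ((nullEnergy P Q φ ℓ 1 t θ + nullEnergy P Q φ ℓ (-1) t θ) / 2
      - (t ^ (-(1 / 2) : ℝ)) ^ 4 * (c₀ * Real.exp (Λ t θ / 2) * twist J K P Q t θ))),
    fun t θ ht => ?_, fun k m hm hB => ?_⟩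
  · have h1 := h.rpow_mul_dt_weighted (1 / 2) ht θ
    have h2 := Real.rpow_neg_half_mul (ht₀.trans_lt ht)
    refine h1.trans ?_
    linear_combination (-(Real.exp (-Λ t θ / 2) / 2
      * ((nullEnergy P Q φ ℓ 1 t θ + nullEnergy P Q φ ℓ (-1) t θ) / 2
        - (t ^ (-(1 / 2) : ℝ)) ^ 4 * (c₀ * Real.exp (Λ t θ / 2) * twist J K P Q t θ)))) * h2
  · obtain ⟨bA, -, bE, be, -, -, bτ, -⟩ := h.bd_coefficients hT hT1 hm hB
    exact ((be.div_const ht₀ hT hm 2).mul_le hT hT1 hm ((((bA 1 (one_pow 2)).2.2.2.add hT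
      (bA (-1) (by norm_num)).2.2.2).div_const ht₀ hT hm 2).sub ht₀ hT hm
      ((bd_rpow_pow ht₀ hT hm 4).mul_le hT hT1 hm ((bE.const_mul ht₀ hT hm c₀).mul_le hT hT1
        hm bτ z) (by norm_num))) z).neg ht₀ hT hm

/-- All the unknowns are bounded together with all their spatial derivatives. -/
theorem bd_unknowns (h : NormalizedSystem t₀ c₀ J K P Q φ ℓ Λ)
    (hlam : ∀ ε : ℝ, 0 < ε → ∃ T : ℝ, t₀ < T ∧ ∀ t θ : ℝ, T ≤ t → -ε ≤ Λ t θ)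
    (hT : t₀ < T) (hT1 : 1 ≤ T) (k : ℕ) (i : Fin 13) :
    Bd t₀ T (fun _ _ => 0) 0 k (unknowns P Q φ ℓ Λ i) := by
  have ht₀ := h.t₀_nonneg
  have z : (0 : ℝ) + 0 ≤ 0 := by norm_num
  have one_sq : (1 : ℝ) ^ 2 = 1 := one_pow 2
  have neg_one_sq : (-1 : ℝ) ^ 2 = 1 := by norm_num
  refine bd_of_system ht₀ hT hT1 h.cyl_unknowns (h.isOrd_unknowns hlam hT) h.cylℓ
    (fun k m hm hB => ?_) (fun i => ?_) k i
  · obtain ⟨-, -, -, -, be, -⟩ := h.bd_coefficients hT hT1 hm hB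
    exact be.mul_le hT hT1 hm (hB 12) z
  fin_cases i
  · obtain ⟨S, h2, h3⟩ := h.exists_source_P hT hT1 one_sq
    exact ⟨_, 1 / 2, 1, S, by norm_num, h2, h3⟩
  · obtain ⟨S, h2, h3⟩ := h.exists_source_P hT hT1 neg_one_sq
    rw [neg_neg] at h2
    exact ⟨_, 1 / 2, 0, S, by norm_num, h2, h3⟩
  · obtain ⟨S, h2, h3⟩ := h.exists_source_Q hT hT1 one_sq
    exact ⟨_, 1 / 2, 3, S, by norm_num, h2, h3⟩
  · obtain ⟨S, h2, h3⟩ := h.exists_source_Q hT hT1 neg_one_sq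
    rw [neg_neg] at h2
    exact ⟨_, 1 / 2, 2, S, by norm_num, h2, h3⟩
  · obtain ⟨S, h2, h3⟩ := h.exists_source_phi hT hT1 one_sq
    exact ⟨_, 1 / 2, 5, S, by norm_num, h2, h3⟩
  · obtain ⟨S, h2, h3⟩ := h.exists_source_phi hT hT1 neg_one_sq
    rw [neg_neg] at h2
    exact ⟨_, 1 / 2, 4, S, by norm_num, h2, h3⟩
  · refine ⟨0, 0, 6, _, le_rfl, fun t θ _ => ?_, fun k m hm hB =>
      ((hB 0).add hT (hB 1)).div_const ht₀ hT hm 2⟩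
    rw [nullD_zero, zero_mul, zero_mul, neg_zero, zero_add]
    exact rpow_mul_dt P t θ
  · refine ⟨0, 0, 7, _, le_rfl, fun t θ _ => ?_, fun k m hm hB =>
      (h.bd_coefficients hT hT1 hm hB).2.1.mul_le hT hT1 hm
        (((hB 2).add hT (hB 3)).div_const ht₀ hT hm 2) z⟩
    rw [nullD_zero, zero_mul, zero_mul, neg_zero, zero_add]
    exact rpow_mul_dtQ t θ
  · refine ⟨0, 0, 8, _, le_rfl, fun t θ _ => ?_, fun k m hm hB =>
      ((hB 4).add hT (hB 5)).div_const ht₀ hT hm 2⟩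
    rw [nullD_zero, zero_mul, zero_mul, neg_zero, zero_add]
    exact rpow_mul_dt φ t θ
  · refine ⟨0, 0, 9, _, le_rfl, fun t θ _ => ?_, fun k m hm hB => h.bd_ell_t hT hT1 hm hB⟩
    rw [nullD_zero, zero_mul, zero_mul, neg_zero, zero_add]
    rfl
  · refine ⟨0, 0, 10, _, le_rfl, fun t θ ht => ?_, fun k m hm hB =>
      (((bd_rpow_pow ht₀ hT hm 1).div_const ht₀ hT hm 2).mul_le hT hT1 hm
        (((h.bd_coefficients hT hT1 hm hB).1 1 one_sq).2.2.2.add hT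
        ((h.bd_coefficients hT hT1 hm hB).1 (-1) neg_one_sq).2.2.2) (by norm_num)).add hT
        (h.bd_ell_t hT hT1 hm hB)⟩
    rw [nullD_zero, zero_mul, zero_mul, neg_zero, zero_add, pow_one]
    exact h.nullD_ell_add one_sq ht θ
  · obtain ⟨S, h2, h3⟩ := h.exists_source_weighted hT hT1
    exact ⟨0, 1 / 2, 11, S, by norm_num, fun t θ ht => (nullD_zero _ t θ).trans
      ((h2 t θ ht).trans (by change _ = -(1 / 2 * t ^ (1 / 2 : ℝ) * (t ^ (1 / 2 : ℝ)
        * (Real.exp (-Λ t θ / 2) - 1) + t ^ (1 / 2 : ℝ) * (Real.exp (-Λ t θ / 2) - 1))) + _; ring)),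
      h3⟩
  · refine ⟨0, 0, 12, _, le_rfl, fun t θ ht => (nullD_zero _ t θ).trans
      ((h.rpow_mul_dt_dth_ell ht θ).trans (by rw [zero_mul, zero_mul, neg_zero, zero_add])),
      fun k m hm hB => ?_⟩
    · obtain ⟨bA, -, bE, -, -, be, bτ, bD, bJK⟩ := h.bd_coefficients hT hT1 hm hB
      have bdA := (bA 1 one_sq).2.2.2.sub ht₀ hT hm (bA (-1) neg_one_sq).2.2.2
      exact (bE.mul_le hT hT1 hm be z).mul_le hT hT1 hm
        (((bdA.const_mul ht₀ hT hm _).sub ht₀ hT hm (((bd_rpow_pow ht₀ hT hm 6).mul_le hT hT1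
          hm ((bτ.const_mul ht₀ hT hm c₀).div_const ht₀ hT hm 4) (by norm_num)).mul_le hT hT1 hm
          bdA z)).add hT (((bd_rpow_pow ht₀ hT hm 5).mul_le hT hT1 hm
            (Bd.const ht₀ hT hm (c₀ / 2) _) (by norm_num)).mul_le hT hT1 hm
            ((bD.mul_le hT hT1 hm ((bA 1 one_sq).1.sub ht₀ hT hm (bA (-1) neg_one_sq).1) z).add hT
              ((bJK.const_mul ht₀ hT hm 2).mul_le hT hT1 hm ((bA 1 one_sq).2.1.sub ht₀ hT hm
                (bA (-1) neg_one_sq).2.1) z)) z)) z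

end NormalizedSystem

/-! ### Decay with all spatial derivatives, and limits at infinity -/

section SmoothOrd

lemma dth_iterate (f : ℝ → ℝ → ℝ) (k : ℕ) (t : ℝ) : dth^[k] f t = iteratedDeriv k (f t) := by
  induction k generalizing f with
  | zero => simp
  | succ k ih => rw [Function.iterate_succ_apply, ih, iteratedDeriv_succ']; rfl

/-- `∂_θ^k f = O(t^r)` for all `k`, uniformly in `θ`, for `t ≥ T`. -/
def SmoothOrd (t₀ T r : ℝ) (f : ℝ → ℝ → ℝ) : Prop := ∀ k, Bd t₀ T (fun _ _ => 0) r k f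

variable {t₀ T r s q : ℝ} {f h : ℝ → ℝ → ℝ}

lemma smoothOrd_iff : SmoothOrd t₀ T r f ↔
    SmoothOnCylinder t₀ f ∧ ∀ k, ∃ C, ∀ t θ, T ≤ t → |iteratedDeriv k (f t) θ| ≤ C * t ^ r := by
  constructor
  · refine fun hf => ⟨(hf 0).smooth, fun k => ?_⟩
    obtain ⟨C, hC⟩ := (hf k).iterate
    exact ⟨C, fun t θ ht => by simpa [dth_iterate] using hC t θ ht⟩
  · rintro ⟨h1, h2⟩ k
    induction k with
    | zero =>
      obtain ⟨C, hC⟩ := h2 0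
      exact ⟨h1, C, fun t θ ht => by simpa using hC t θ ht⟩
    | succ k ih =>
      obtain ⟨C, hC⟩ := h2 (k + 1)
      refine ih.succ_of_iterate ⟨C, fun t θ ht => ?_⟩
      simpa only [dth_iterate, add_zero, mul_one] using hC t θ ht

namespace SmoothOrd

lemma smooth (hf : SmoothOrd t₀ T r f) : SmoothOnCylinder t₀ f := (hf 0).smooth

lemma isOrd (hf : SmoothOrd t₀ T r f) : IsOrd T r f := (hf 1).isOrd

lemma congr (hT : t₀ < T) (hf : SmoothOrd t₀ T r f) (hfh : ∀ t θ, t₀ < t → h t θ = f t θ) :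
    SmoothOrd t₀ T r h := fun k => (hf k).congr hT hfh

lemma add (hT : t₀ < T) (hf : SmoothOrd t₀ T r f) (hh : SmoothOrd t₀ T r h) :
    SmoothOrd t₀ T r fun t θ => f t θ + h t θ := fun k => (hf k).add hT (hh k)

lemma sub (ht₀ : 0 ≤ t₀) (hT : t₀ < T) (hf : SmoothOrd t₀ T r f) (hh : SmoothOrd t₀ T r h) :
    SmoothOrd t₀ T r fun t θ => f t θ - h t θ := fun k =>
  (hf k).sub ht₀ hT (fun _ _ => le_rfl) (hh k)

lemma const_mul (ht₀ : 0 ≤ t₀) (hT : t₀ < T) (c : ℝ) (hf : SmoothOrd t₀ T r f) :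
    SmoothOrd t₀ T r fun t θ => c * f t θ := fun k =>
  (hf k).const_mul ht₀ hT (fun _ _ => le_rfl) c

lemma mul (hT : t₀ < T) (hT1 : 1 ≤ T) (hf : SmoothOrd t₀ T r f) (hh : SmoothOrd t₀ T s h)
    (hq : r + s ≤ q) : SmoothOrd t₀ T q fun t θ => f t θ * h t θ := fun k =>
  ((hf (k + 1)).mul_le hT hT1 (fun _ _ => le_rfl) (hh (k + 1)) hq).of_succ (by linarith)
    fun _ _ => le_rfl

lemma exp (hT : t₀ < T) (hT1 : 1 ≤ T) (hf : SmoothOrd t₀ T 0 f) :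
    SmoothOrd t₀ T 0 fun t θ => Real.exp (f t θ) := fun k =>
  ((hf (k + 1)).exp hT (by linarith) fun _ _ => le_rfl).of_succ (by linarith) fun _ _ => le_rfl

lemma mono (hT1 : 1 ≤ T) (hrs : r ≤ s) (hf : SmoothOrd t₀ T r f) : SmoothOrd t₀ T s f :=
  fun k => (hf k).mono hT1 (fun _ _ => le_rfl) hrs

lemma rpow (ht₀ : 0 ≤ t₀) (hT : t₀ < T) (r : ℝ) : SmoothOrd t₀ T r fun t _ => t ^ r :=
  fun k => Bd.rpow ht₀ hT (fun _ _ => le_rfl) r k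

lemma const (ht₀ : 0 ≤ t₀) (hT : t₀ < T) (c : ℝ) : SmoothOrd t₀ T 0 fun _ _ => c :=
  fun k => Bd.const ht₀ hT (fun _ _ => le_rfl) c k

lemma spaceDeriv (hf : SmoothOrd t₀ T r f) : SmoothOrd t₀ T r (dth f) := fun k => (hf (k + 1)).dth

end SmoothOrd

lemma dt_iterate (hf : SmoothOnCylinder t₀ f) (k : ℕ) {t : ℝ} (ht : t₀ < t) (θ : ℝ) :
    dt (dth^[k] f) t θ = dth^[k] (dt f) t θ := by
  induction k generalizing f with
  | zero => rfl
  | succ k ih =>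
    rw [Function.iterate_succ_apply, ih hf.dth, Function.iterate_succ_apply, dth_iterate,
      dth_iterate]
    congr 1
    exact funext fun θ => hf.sm.dt_dth_comm ht θ

/-- Integration in time of a power law. -/
lemma abs_sub_le_of_dt (ht₀ : 0 ≤ t₀) (hf : Sm t₀ f) (hT : t₀ < T) {C : ℝ} (hr : r ≠ 0)
    (h : ∀ t θ, T ≤ t → |dt f t θ| ≤ C * t ^ (r - 1)) {s t : ℝ} (hs : T ≤ s) (hst : s ≤ t)
    (θ : ℝ) : |f t θ - f s θ| ≤ C / r * (t ^ r - s ^ r) := by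
  have key : ∀ σ : ℝ, |σ| = 1 →
      C / r * s ^ r + σ * f s θ ≤ C / r * t ^ r + σ * f t θ := by
    intro σ hσ
    have hd : ∀ x, T ≤ x → HasDerivAt (fun x => C / r * x ^ r + σ * f x θ)
        (C / r * (r * x ^ (r - 1)) + σ * dt f x θ) x := fun x hx =>
      ((Real.hasDerivAt_rpow_const (Or.inl (ht₀.trans_lt (hT.trans_le hx)).ne')).const_mul _).add
        ((hf.hasDerivAt_t (hT.trans_le hx) θ).const_mul σ)
    have hmono : MonotoneOn (fun x => C / r * x ^ r + σ * f x θ) (Ici T) := by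
      refine monotoneOn_of_deriv_nonneg (convex_Ici T)
        (fun x hx => (hd x hx).continuousAt.continuousWithinAt)
        (fun x hx => (hd x (interior_subset hx)).differentiableAt.differentiableWithinAt)
        fun x hx => ?_
      have hx' : T ≤ x := interior_subset hx
      rw [(hd x hx').deriv]
      have h1 : C / r * (r * x ^ (r - 1)) = C * x ^ (r - 1) := by field_simp
      have h2 : |σ * dt f x θ| ≤ C * x ^ (r - 1) := by
        rw [abs_mul, hσ, one_mul]; exact h x θ hx'
      rw [h1]
      linarith [neg_le_of_abs_le h2]
    exact hmono hs (hs.trans hst) hst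
  have h1 := key 1 (by simp)
  have h2 := key (-1) (by simp)
  rw [abs_le]
  constructor <;> linarith

/-- Integration of a growing time derivative. -/
lemma SmoothOrd.of_dt (ht₀ : 0 ≤ t₀) (hT : t₀ < T) (hT1 : 1 ≤ T) (hf : SmoothOnCylinder t₀ f)
    (hr : 0 < r) (h : SmoothOrd t₀ T (r - 1) (dt f)) : SmoothOrd t₀ T r f := by
  refine smoothOrd_iff.2 ⟨hf, fun k => ?_⟩
  obtain ⟨C, hC⟩ := (smoothOrd_iff.1 h).2 k
  have hi := hf.iterate k
  obtain ⟨B, hB⟩ := exists_bound_Icc hi.1 hi.2 hT T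
  refine ⟨|B| + |C / r|, fun t θ ht => ?_⟩
  rw [← dth_iterate]
  have h1 := abs_sub_le_of_dt ht₀ hi.1 hT hr.ne' (fun t θ ht => by
    rw [dt_iterate hf k (hT.trans_le ht), dth_iterate]; exact hC t θ ht) le_rfl ht θ
  have h2 : 1 ≤ t ^ r := Real.one_le_rpow (hT1.trans ht) hr.le
  have h3 : 0 < T ^ r := Real.rpow_pos_of_pos (ht₀.trans_lt hT) r
  have h4 : T ^ r ≤ t ^ r := Real.rpow_le_rpow (ht₀.trans hT.le) ht hr.le
  have h5 : C / r * (t ^ r - T ^ r) ≤ |C / r| * t ^ r :=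
    mul_le_mul (le_abs_self _) (by linarith) (by linarith) (abs_nonneg _)
  have h6 : |B| ≤ |B| * t ^ r := le_mul_of_one_le_right (abs_nonneg B) h2
  have h7 := (hB T θ le_rfl le_rfl).trans (le_abs_self B)
  have h8 := abs_add_le (dth^[k] f t θ - dth^[k] f T θ) (dth^[k] f T θ)
  rw [sub_add_cancel] at h8
  linarith

/-- A function with an integrable time derivative converges to a smooth function, together with all
spatial derivatives. -/
theorem SmoothOrd.exists_limit (ht₀ : 0 ≤ t₀) (hT : t₀ < T)
    (hf : SmoothOnCylinder t₀ f) (hr : 0 < r) (h : SmoothOrd t₀ T (-r - 1) (dt f)) :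
    ∃ g : ℝ → ℝ, SmoothOnCircle g ∧ SmoothOrd t₀ T (-r) (fun t θ => f t θ - g θ) := by
  choose C hC using (smoothOrd_iff.1 h).2
  have hT0 : 0 < T := ht₀.trans_lt hT
  have h1 : ∀ k s t θ, T ≤ s → s ≤ t →
      |dth^[k] f t θ - dth^[k] f s θ| ≤ C k / r * (s ^ (-r) - t ^ (-r)) := by
    intro k s t θ hs hst
    have := abs_sub_le_of_dt ht₀ (hf.iterate k).1 hT (neg_ne_zero.2 hr.ne') (fun t θ ht => by
      rw [dt_iterate hf k (hT.trans_le ht), dth_iterate]; exact hC k t θ ht) hs hst θ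
    refine this.trans (le_of_eq ?_)
    rw [div_neg]; ring
  have hC0 : ∀ k, 0 ≤ C k := fun k => nonneg_of_mul_nonneg_left
    ((abs_nonneg _).trans (hC k T 0 le_rfl)) (Real.rpow_pos_of_pos hT0 _)
  have h2 : ∀ k s t θ, T ≤ s → s ≤ t → |dth^[k] f t θ - dth^[k] f s θ| ≤ C k / r * s ^ (-r) := by
    intro k s t θ hs hst
    refine (h1 k s t θ hs hst).trans (mul_le_mul_of_nonneg_left ?_ (div_nonneg (hC0 k) hr.le))
    have := Real.rpow_pos_of_pos (hT0.trans_le (hs.trans hst)) (-r)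
    linarith
  have hlim0 : ∀ k, Tendsto (fun s : ℝ => C k / r * s ^ (-r)) atTop (𝓝 0) := fun k => by
    simpa using (tendsto_rpow_neg_atTop hr).const_mul (C k / r)
  have hnat : Tendsto (fun n : ℕ => T + n) atTop atTop :=
    tendsto_atTop_add_const_left _ _ tendsto_natCast_atTop_atTop
  have hex : ∀ k θ, ∃ l, Tendsto (fun n : ℕ => dth^[k] f (T + n) θ) atTop (𝓝 l) := by
    intro k θ
    refine cauchySeq_tendsto_of_complete (cauchySeq_of_le_tendsto_0'
      (fun n : ℕ => C k / r * (T + n) ^ (-r)) (fun n m hnm => ?_) ((hlim0 k).comp hnat))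
    rw [dist_comm, Real.dist_eq]
    have : (n : ℝ) ≤ m := Nat.cast_le.2 hnm
    exact h2 k _ _ θ (by simp) (by linarith)
  choose g hg using hex
  have h3 : ∀ k s θ, T ≤ s → |dth^[k] f s θ - g k θ| ≤ C k / r * s ^ (-r) := by
    intro k s θ hs
    rw [abs_sub_comm]
    refine le_of_tendsto ((hg k θ).sub_const (dth^[k] f s θ)).abs ?_
    filter_upwards [hnat.eventually_ge_atTop s] with n hn
    exact h2 k s _ θ hs hn
  have hunif : ∀ k, TendstoUniformly (fun (n : ℕ) θ => dth^[k] f (T + n) θ) (g k) atTop := by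
    intro k
    rw [Metric.tendstoUniformly_iff]
    intro ε hε
    filter_upwards [((hlim0 k).comp hnat).eventually (gt_mem_nhds hε)] with n hn θ
    rw [dist_comm, Real.dist_eq]
    exact (h3 k _ θ (by simp)).trans_lt hn
  have hder : ∀ k θ, HasDerivAt (g k) (g (k + 1) θ) θ := fun k =>
    hasDerivAt_of_tendstoUniformly (hunif (k + 1)) (Eventually.of_forall fun n θ => by
      have := (hf.iterate k).sm.hasDerivAt_th (t := T + n)
        (hT.trans_le (by simp)) θ
      rwa [← Function.iterate_succ_apply' T2Sym.dth] at this) (hg k)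
  have hiter : ∀ k, iteratedDeriv k (g 0) = g k := by
    intro k
    induction k with
    | zero => simp
    | succ k ih => rw [iteratedDeriv_succ, ih]; exact funext fun θ => (hder k θ).deriv
  have hsmooth : ContDiff ℝ ∞ (g 0) := by
    refine contDiff_of_differentiable_iteratedDeriv fun k _ => ?_
    rw [hiter]
    exact fun θ => (hder k θ).differentiableAt
  have hper : Function.Periodic (g 0) (2 * Real.pi) := by
    intro θ
    refine tendsto_nhds_unique (hg 0 (θ + 2 * Real.pi)) ((hg 0 θ).congr fun n => ?_)
    exact (hf.2 (T + n) (hT.trans_le (by simp)) θ).symm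
  refine ⟨g 0, ⟨hsmooth, hper⟩, smoothOrd_iff.2 ⟨?_, fun k => ⟨C k / r, fun t θ ht => ?_⟩⟩⟩
  · exact hf.sub ⟨(hsmooth.comp contDiff_snd).contDiffOn, fun _ _ => hper⟩
  · have hft : ContDiffAt ℝ k (f t) θ := by
      have h4 : ContDiffAt ℝ ∞ (fun z : ℝ × ℝ => f z.1 z.2) (t, θ) :=
        hf.sm.contDiffAt (hT.trans_le ht) θ
      have h5 : ContDiffAt ℝ ∞ (f t) θ :=
        ContDiffAt.comp (g := fun z : ℝ × ℝ => f z.1 z.2) θ h4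
          (contDiffAt_const.prodMk contDiffAt_id)
      exact h5.of_le (by exact_mod_cast le_top)
    have hgt : ContDiffAt ℝ k (g 0) θ := hsmooth.contDiffAt.of_le (by exact_mod_cast le_top)
    have h6 := iteratedDeriv_fun_sub hft hgt
    rw [h6, hiter, ← dth_iterate]
    exact h3 k t θ ht

lemma SmoothOrd.tendsto (hr : 0 < r) {g : ℝ → ℝ}
    (hf : SmoothOrd t₀ T (-r) fun t θ => f t θ - g θ) (θ : ℝ) :
    Tendsto (fun t => f t θ) atTop (𝓝 (g θ)) := by
  obtain ⟨C, hC⟩ := hf.isOrd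
  have h1 : Tendsto (fun s : ℝ => C * s ^ (-r)) atTop (𝓝 0) := by
    simpa using (tendsto_rpow_neg_atTop hr).const_mul C
  have h2 : Tendsto (fun t => f t θ - g θ) atTop (𝓝 0) :=
    squeeze_zero_norm' ((eventually_ge_atTop T).mono fun t ht => hC t θ ht) h1
  simpa using h2.add_const (g θ)

/-- The norm on the circle of functions with given decay. -/
lemma SmoothOrd.cNorm_le (hf : SmoothOrd t₀ T r f) (hT : 0 < T) (N : ℕ) :
    ∃ C, 0 ≤ C ∧ ∀ t, T ≤ t → cNorm N (f t) ≤ ENNReal.ofReal (C * t ^ r) := by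
  choose C hC using (smoothOrd_iff.1 hf).2
  have hC0 : ∀ k, 0 ≤ C k := fun k => nonneg_of_mul_nonneg_left
    ((abs_nonneg _).trans (hC k T 0 le_rfl)) (Real.rpow_pos_of_pos hT _)
  refine ⟨∑ k ∈ Finset.range (N + 1), C k, Finset.sum_nonneg fun k _ => hC0 k, fun t ht => ?_⟩
  have ht' : 0 < t ^ r := Real.rpow_pos_of_pos (hT.trans_le ht) r
  rw [Finset.sum_mul, ENNReal.ofReal_sum_of_nonneg fun k _ => mul_nonneg (hC0 k) ht'.le]
  refine Finset.sum_le_sum fun k _ => iSup_le fun θ => ?_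
  rw [← ofReal_norm]
  exact ENNReal.ofReal_le_ofReal (hC k t θ ht)

end SmoothOrd

/-! ### Asymptotics of the solutions of the normalized system -/

section Damped

variable {t₀ T : ℝ} {ℓ : ℝ → ℝ → ℝ}

/-- Damping gives decay: `∂_t (t f) = t^{-1/2} S`. -/
lemma SmoothOrd.of_damped (ht₀ : 0 ≤ t₀) (hT : t₀ < T) (hT1 : 1 ≤ T) {f S : ℝ → ℝ → ℝ}
    (hf : SmoothOnCylinder t₀ f) (hS : SmoothOrd t₀ T 0 S)
    (h : ∀ t θ, t₀ < t → t ^ (3 / 2 : ℝ) * dt f t θ = -(t ^ (1 / 2 : ℝ) * f t θ) + S t θ) :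
    SmoothOrd t₀ T (-(1 / 2)) f := by
  have h1 : SmoothOrd t₀ T (1 / 2 - 1) (dt fun t θ => t ^ (1 : ℝ) * f t θ) := by
    refine ((SmoothOrd.rpow ht₀ hT (-(1 / 2))).mul hT hT1 hS (by norm_num)).congr hT
      fun t θ ht => ?_
    have ht' : 0 < t := ht₀.trans_lt ht
    have h2 : t ^ (-(1 / 2) : ℝ) * t ^ (3 / 2 : ℝ) = t := by
      rw [← Real.rpow_add ht']; norm_num
    have h3 := Real.rpow_neg_half_mul ht'
    have h4 := h t θ ht
    rw [dt_mul (Sm.rpow ht₀ 1) hf.sm ht, dt_rpow 1 ht', sub_self, Real.rpow_zero, Real.rpow_one]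
    linear_combination (-dt f t θ) * h2 + t ^ (-(1 / 2) : ℝ) * h4 - f t θ * h3
  have h2 := SmoothOrd.of_dt ht₀ hT hT1 ((SmoothOnCylinder.rpow ht₀ 1).mul hf) one_half_pos h1
  refine ((SmoothOrd.rpow ht₀ hT (-1)).mul hT hT1 h2 (by norm_num)).congr hT fun t θ ht => ?_
  have ht' : 0 < t := ht₀.trans_lt ht
  rw [← mul_assoc, ← Real.rpow_add ht']
  norm_num

/-- The sum of the two characteristic variables of a wave is damped. -/
lemma SmoothOrd.of_damped_pair (ht₀ : 0 ≤ t₀) (hT : t₀ < T) (hT1 : 1 ≤ T)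
    {U₁ U₂ S₁ S₂ : ℝ → ℝ → ℝ} (hU₁ : SmoothOrd t₀ T 0 U₁) (hU₂ : SmoothOrd t₀ T 0 U₂)
    (hS₁ : SmoothOrd t₀ T 0 S₁) (hS₂ : SmoothOrd t₀ T 0 S₂)
    (hℓ : SmoothOrd t₀ T 0 fun t θ => Real.exp (ℓ t θ / 2))
    (h₁ : ∀ t θ, t₀ < t →
      nullD ℓ (-1) U₁ t θ = -(1 / 2 * t ^ (1 / 2 : ℝ) * (U₁ t θ + U₂ t θ)) + S₁ t θ)
    (h₂ : ∀ t θ, t₀ < t →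
      nullD ℓ 1 U₂ t θ = -(1 / 2 * t ^ (1 / 2 : ℝ) * (U₂ t θ + U₁ t θ)) + S₂ t θ) :
    SmoothOrd t₀ T (-(1 / 2)) fun t θ => U₁ t θ + U₂ t θ := by
  have hS := (hS₁.add hT hS₂).add hT
    (hℓ.mul hT hT1 (hU₁.spaceDeriv.sub ht₀ hT hU₂.spaceDeriv) (show (0 : ℝ) + 0 ≤ 0 by norm_num))
  refine SmoothOrd.of_damped ht₀ hT hT1 (hU₁.smooth.add hU₂.smooth) hS fun t θ ht => ?_
  have e1 := h₁ t θ ht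
  have e2 := h₂ t θ ht
  rw [nullD] at e1 e2
  rw [dt_add hU₁.smooth.sm hU₂.smooth.sm ht]
  linear_combination e1 + e2

end Damped

namespace NormalizedSystem

variable {P Q φ ℓ Λ : ℝ → ℝ → ℝ} {t₀ c₀ J K T : ℝ}

/-- The optimal decay of the time derivatives. -/
theorem smoothOrd_dt (h : NormalizedSystem t₀ c₀ J K P Q φ ℓ Λ)
    (hlam : ∀ ε : ℝ, 0 < ε → ∃ T : ℝ, t₀ < T ∧ ∀ t θ : ℝ, T ≤ t → -ε ≤ Λ t θ)
    (hT : t₀ < T) (hT1 : 1 ≤ T) :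
    (SmoothOrd t₀ T 0 P ∧ SmoothOrd t₀ T 0 Q ∧ SmoothOrd t₀ T 0 φ ∧ SmoothOrd t₀ T 0 ℓ ∧
      SmoothOrd t₀ T (-1) Λ) ∧
    SmoothOrd t₀ T (-2) (dt P) ∧ SmoothOrd t₀ T (-2) (dt Q) ∧ SmoothOrd t₀ T (-2) (dt φ) ∧
      SmoothOrd t₀ T (-2) (dt ℓ) ∧ SmoothOrd t₀ T (-2) (dt Λ) := by
  have ht₀ := h.t₀_nonneg
  have hU : ∀ i, SmoothOrd t₀ T 0 (unknowns P Q φ ℓ Λ i) := fun i k => h.bd_unknowns hlam hT hT1 k i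
  have hB : ∀ k i, Bd t₀ T (fun _ _ => 0) 0 (k + 1) (unknowns P Q φ ℓ Λ i) := fun k i => hU i _
  have hsrc : ∀ {S : ℝ → ℝ → ℝ}, (∀ (k : ℕ) (m : ℝ → ℝ → ℝ), (∀ t θ, 0 ≤ m t θ) →
      (∀ j, Bd t₀ T m 0 (k + 1) (unknowns P Q φ ℓ Λ j)) → Bd t₀ T m 0 (k + 1) S) →
      SmoothOrd t₀ T 0 S := fun hS k =>
    (hS k _ (fun _ _ => le_rfl) (hB k)).of_succ (by linarith) fun _ _ => le_rfl
  have hco := fun k => h.bd_coefficients hT hT1 (fun _ _ => le_rfl) (hB k)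
  have hsucc : ∀ {f : ℝ → ℝ → ℝ}, (∀ k, Bd t₀ T (fun _ _ => 0) 0 (k + 1) f) →
      SmoothOrd t₀ T 0 f := fun hf k => (hf k).of_succ (by linarith) fun _ _ => le_rfl
  have one_sq : (1 : ℝ) ^ 2 = 1 := one_pow 2
  have neg_one_sq : (-1 : ℝ) ^ 2 = 1 := by norm_num
  have z : (0 : ℝ) + 0 ≤ 0 := by norm_num
  have hA : ∀ s : ℝ, s ^ 2 = 1 → SmoothOrd t₀ T 0 (nullEnergy P Q φ ℓ s) := fun s hs =>
    hsucc fun k => ((hco k).1 s hs).2.2.2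
  have hE : SmoothOrd t₀ T 0 fun t θ => Real.exp (Λ t θ / 2) := hsucc fun k => (hco k).2.2.1
  have he : SmoothOrd t₀ T 0 fun t θ => Real.exp (ℓ t θ / 2) := hsucc fun k => (hco k).2.2.2.2.1
  have hnP : SmoothOrd t₀ T 0 fun t θ => Real.exp (-P t θ) := hsucc fun k => (hco k).2.1
  have hτ : SmoothOrd t₀ T 0 (twist J K P Q) := hsucc fun k => (hco k).2.2.2.2.2.2.1
  have hμ : SmoothOrd t₀ T (-(1 / 2)) fun t θ =>
      t ^ (1 / 2 : ℝ) * (Real.exp (-Λ t θ / 2) - 1) := by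
    obtain ⟨S, h1, h2⟩ := h.exists_source_weighted hT hT1
    exact SmoothOrd.of_damped ht₀ hT hT1 (h.cyl_expΛ _) (hsrc h2) h1
  have hP : SmoothOrd t₀ T (-(1 / 2)) fun t θ => nullD ℓ 1 P t θ + nullD ℓ (-1) P t θ := by
    obtain ⟨S₁, h1, h2⟩ := h.exists_source_P hT hT1 one_sq
    obtain ⟨S₂, h3, h4⟩ := h.exists_source_P hT hT1 neg_one_sq
    rw [neg_neg] at h3
    exact SmoothOrd.of_damped_pair ht₀ hT hT1 (hU 0) (hU 1) (hsrc h2) (hsrc h4) he h1 h3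
  have hQ : SmoothOrd t₀ T (-(1 / 2)) fun t θ => nullDQ P Q ℓ 1 t θ + nullDQ P Q ℓ (-1) t θ := by
    obtain ⟨S₁, h1, h2⟩ := h.exists_source_Q hT hT1 one_sq
    obtain ⟨S₂, h3, h4⟩ := h.exists_source_Q hT hT1 neg_one_sq
    rw [neg_neg] at h3
    exact SmoothOrd.of_damped_pair ht₀ hT hT1 (hU 2) (hU 3) (hsrc h2) (hsrc h4) he h1 h3
  have hφ : SmoothOrd t₀ T (-(1 / 2)) fun t θ => nullD ℓ 1 φ t θ + nullD ℓ (-1) φ t θ := by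
    obtain ⟨S₁, h1, h2⟩ := h.exists_source_phi hT hT1 one_sq
    obtain ⟨S₂, h3, h4⟩ := h.exists_source_phi hT hT1 neg_one_sq
    rw [neg_neg] at h3
    exact SmoothOrd.of_damped_pair ht₀ hT hT1 (hU 4) (hU 5) (hsrc h2) (hsrc h4) he h1 h3
  have hdiv : ∀ {f S : ℝ → ℝ → ℝ}, SmoothOrd t₀ T (-(1 / 2)) S →
      (∀ t θ, t₀ < t → t ^ (3 / 2 : ℝ) * dt f t θ = S t θ) → SmoothOrd t₀ T (-2) (dt f) := by
    intro f S hS heq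
    refine ((SmoothOrd.rpow ht₀ hT (-(3 / 2))).mul hT hT1 hS (by norm_num)).congr hT
      fun t θ ht => ?_
    rw [← heq t θ ht, ← mul_assoc, ← Real.rpow_add (ht₀.trans_lt ht)]
    norm_num
  have hL : SmoothOrd t₀ T (-(1 / 2)) fun t θ => t ^ (3 / 2 : ℝ) * dt ℓ t θ := by
    have h5 : SmoothOrd t₀ T (-(1 / 2)) fun t θ =>
        (t ^ (-(5 / 2) : ℝ)) * (c₀ * Real.exp (Λ t θ / 2) * twist J K P Q t θ) :=
      (SmoothOrd.rpow ht₀ hT _).mul hT hT1 ((hE.const_mul ht₀ hT c₀).mul hT hT1 hτ z)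
        (by norm_num)
    refine (((hE.mul hT hT1 hμ (by norm_num : (0 : ℝ) + -(1 / 2) ≤ -(1 / 2))).const_mul ht₀ hT
      3).sub ht₀ hT h5).congr hT fun t θ ht => ?_
    rw [h.nullD_ell ht, ← Real.rpow_mul_natCast (ht₀.trans ht.le),
      show (-(1 / 2) * (5 : ℕ) : ℝ) = -(5 / 2) by norm_num]
    linear_combination (-3 * t ^ (1 / 2 : ℝ)) * exp_neg_mul_exp (ℓ := Λ) t θ
  have hΛ_t : SmoothOrd t₀ T (-2) (dt Λ) := hdiv ((((SmoothOrd.rpow ht₀ hT (-(1 / 2))).mul hT hT1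
      (((hA 1 one_sq).add hT (hA (-1) neg_one_sq)).const_mul ht₀ hT (1 / 2))
      (show -(1 / 2) + 0 ≤ (-(1 / 2) : ℝ) by norm_num))).add hT hL) fun t θ ht => by
    rw [h.nullD_ell_add one_sq ht]; ring
  -- the limit of `Λ` vanishes
  have hΛ : SmoothOrd t₀ T (-1) Λ := by
    obtain ⟨g, -, hg⟩ := SmoothOrd.exists_limit ht₀ hT h.cylΛ one_pos (by norm_num; exact hΛ_t)
    refine hg.congr hT fun t θ _ => ?_
    suffices g θ = 0 by rw [this, sub_zero]
    have h1 : Tendsto (fun t => Real.exp (-Λ t θ / 2) - 1) atTop (𝓝 (Real.exp (-g θ / 2) - 1)) :=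
      (((hg.tendsto one_pos θ).neg.div_const 2).rexp).sub_const 1
    have h2 : SmoothOrd t₀ T (-(1 / 2)) fun t θ => (Real.exp (-Λ t θ / 2) - 1) - 0 :=
      ((SmoothOrd.rpow ht₀ hT (-(1 / 2))).mul hT hT1 hμ (by norm_num)).congr hT fun t θ ht => by
        rw [← mul_assoc, Real.rpow_neg_half_mul (ht₀.trans_lt ht), one_mul, sub_zero]
    have h3 := tendsto_nhds_unique h1 (h2.tendsto (g := fun _ => 0) one_half_pos θ)
    have h4 : Real.exp (-g θ / 2) = 1 := by linarith
    rw [Real.exp_eq_one_iff] at h4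
    linarith
  refine ⟨⟨hU 6, hU 7, hU 8, hU 9, hΛ⟩, hdiv (hP.const_mul ht₀ hT (1 / 2)) fun t θ _ => ?_,
    hdiv (hnP.mul hT hT1 (hQ.const_mul ht₀ hT (1 / 2)) (by norm_num)) fun t θ _ => ?_,
    hdiv (hφ.const_mul ht₀ hT (1 / 2)) fun t θ _ => ?_, hdiv hL fun _ _ _ => rfl, hΛ_t⟩
  · rw [rpow_mul_dt (ℓ := ℓ)]; ring
  · rw [rpow_mul_dtQ (ℓ := ℓ) (P := P)]; ring
  · rw [rpow_mul_dt (ℓ := ℓ)]; ring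

end NormalizedSystem

/-! ### The induced metric and the second fundamental form -/

section Settles

variable {t₀ T : ℝ} {f h : ℝ → ℝ → ℝ}

lemma SmoothOnCircle.smoothOrd (hT : t₀ < T) {g : ℝ → ℝ} (hg : SmoothOnCircle g) :
    SmoothOrd t₀ T 0 fun _ θ => g θ := by
  have hs : SmoothOnCylinder t₀ fun _ θ => g θ :=
    ⟨(hg.1.comp contDiff_snd).contDiffOn, fun _ _ => hg.2⟩
  refine smoothOrd_iff.2 ⟨hs, fun k => ?_⟩
  obtain ⟨B, hB⟩ := exists_bound_Icc (hs.iterate k).1 (hs.iterate k).2 hT T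
  refine ⟨B, fun t θ _ => ?_⟩
  have h1 := hB T θ le_rfl le_rfl
  rw [dth_iterate] at h1
  rwa [Real.rpow_zero, mul_one]

/-- A function which is bounded, and whose time derivative is `O(t⁻²)`, with all spatial
derivatives. -/
def Settles (t₀ T : ℝ) (f : ℝ → ℝ → ℝ) : Prop := SmoothOrd t₀ T 0 f ∧ SmoothOrd t₀ T (-2) (dt f)

namespace Settles

lemma add (hT : t₀ < T) (hf : Settles t₀ T f) (hh : Settles t₀ T h) :
    Settles t₀ T fun t θ => f t θ + h t θ :=
  ⟨hf.1.add hT hh.1, (hf.2.add hT hh.2).congr hT fun _ θ ht =>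
    dt_add hf.1.smooth.sm hh.1.smooth.sm ht θ⟩

lemma mul (hT : t₀ < T) (hT1 : 1 ≤ T) (hf : Settles t₀ T f) (hh : Settles t₀ T h) :
    Settles t₀ T fun t θ => f t θ * h t θ :=
  ⟨hf.1.mul hT hT1 hh.1 (by norm_num),
    ((hf.2.mul hT hT1 hh.1 (by norm_num : (-2 : ℝ) + 0 ≤ -2)).add hT
      (hf.1.mul hT hT1 hh.2 (by norm_num))).congr hT fun _ θ ht =>
    dt_mul hf.1.smooth.sm hh.1.smooth.sm ht θ⟩

lemma const (ht₀ : 0 ≤ t₀) (hT : t₀ < T) (c : ℝ) : Settles t₀ T fun _ _ => c := by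
  refine ⟨SmoothOrd.const ht₀ hT c, ?_⟩
  rw [show dt (fun _ _ => c) = fun _ _ => 0 by ext t θ; exact deriv_const _ _]
  exact fun k => Bd.zero _ k

lemma const_mul (ht₀ : 0 ≤ t₀) (hT : t₀ < T) (hT1 : 1 ≤ T) (c : ℝ) (hf : Settles t₀ T f) :
    Settles t₀ T fun t θ => c * f t θ := (const ht₀ hT c).mul hT hT1 hf

lemma exp (hT : t₀ < T) (hT1 : 1 ≤ T) (hf : Settles t₀ T f) :
    Settles t₀ T fun t θ => Real.exp (f t θ) :=
  ⟨hf.1.exp hT hT1, ((hf.1.exp hT hT1).mul hT hT1 hf.2 (by norm_num)).congr hT fun _ θ ht =>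
    dt_exp hf.1.smooth.sm ht θ⟩

/-- The rate of convergence to a pointwise limit. -/
lemma of_tendsto (ht₀ : 0 ≤ t₀) (hT : t₀ < T) (hf : Settles t₀ T f) {g : ℝ → ℝ}
    (hg : ∀ θ, Tendsto (fun t => f t θ) atTop (𝓝 (g θ))) :
    SmoothOrd t₀ T (-1) fun t θ => f t θ - g θ := by
  obtain ⟨g', -, h1⟩ := SmoothOrd.exists_limit ht₀ hT hf.1.smooth one_pos (by norm_num; exact hf.2)
  have : g' = g := funext fun θ => tendsto_nhds_unique (h1.tendsto one_pos θ) (hg θ)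
  rwa [this] at h1

end Settles

/-- Functions whose time derivative is integrable are bounded with all spatial derivatives. -/
lemma SmoothOrd.of_dt_integrable (ht₀ : 0 ≤ t₀) (hT : t₀ < T) (hT1 : 1 ≤ T)
    (hf : SmoothOnCylinder t₀ f) {r : ℝ} (hr : 0 < r) (h : SmoothOrd t₀ T (-r - 1) (dt f)) :
    SmoothOrd t₀ T 0 f := by
  obtain ⟨g, hg, hfg⟩ := SmoothOrd.exists_limit ht₀ hT hf hr h
  exact ((hfg.mono hT1 (by linarith)).add hT (hg.smoothOrd hT)).congr hT
    fun t θ _ => (sub_add_cancel _ _).symm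

end Settles

namespace Fields

variable (u : Fields)

/-- The components of `t⁻¹` times the metric induced on the hypersurfaces of constant `t`. -/
noncomputable def rescaled (Vc : ℝ) (i j : Fin 3) (t θ : ℝ) : ℝ :=
  3 / (4 * Vc) * Real.exp (u.lamHat Vc t θ / 2) * Real.exp (-u.ell t θ)
      * (![1, 0, 0] i * ![1, 0, 0] j)
    + Real.exp (u.P t θ) * (u.coframe 2 i.succ t θ * u.coframe 2 j.succ t θ)
    + Real.exp (-u.P t θ) * (u.coframe 3 i.succ t θ * u.coframe 3 j.succ t θ)

end Fields

namespace IsT2Solution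

variable {t₀ t Vc : ℝ} {u : Fields}

lemma comp_eq_rescaled (hVc : 0 < Vc) (ht : 0 < t) (θ : ℝ) (i j : Fin 3) :
    u.comp i.succ j.succ t θ = t * u.rescaled Vc i j t θ := by
  rw [Fields.comp, Fin.sum_univ_four, coeff_one hVc ht, coeff_two ht, coeff_three ht,
    Fields.rescaled, Real.exp_neg (u.ell t θ)]
  have h0 : ∀ i : Fin 3, u.coframe 0 i.succ t θ = 0 := fun i => by fin_cases i <;> rfl
  have h1 : ∀ i : Fin 3, u.coframe 1 i.succ t θ = (![1, 0, 0] : Fin 3 → ℝ) i := fun i => by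
    fin_cases i <;> rfl
  rw [h0, h1, h1]
  ring

lemma sm_rescaled (hu : IsT2Solution t₀ (fun _ => Vc) u) (ht₀ : 0 ≤ t₀) (hVc : 0 < Vc)
    (i j : Fin 3) : Sm t₀ (u.rescaled Vc i j) := by
  refine ((Sm.rpow ht₀ (-1)).mul (hu.sm_comp ht₀ i.succ j.succ)).congr fun t θ ht => ?_
  have ht' : 0 < t := ht₀.trans_lt ht
  rw [comp_eq_rescaled hVc ht', Real.rpow_neg_one, inv_mul_cancel_left₀ ht'.ne']

lemma inducedMetric_apply (hu : IsT2Solution t₀ (fun _ => Vc) u) (ht₀ : 0 ≤ t₀) (hVc : 0 < Vc)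
    (ht : t₀ < t) (θ x y : ℝ) (i j : Fin 3) :
    inducedMetric u.metric ![t, θ, x, y] i j = t * u.rescaled Vc i j t θ := by
  rw [inducedMetric, Matrix.of_apply, hu.metric_apply ht₀ (by exact ht),
    ← comp_eq_rescaled hVc (ht₀.trans_lt ht)]
  rfl

lemma unitNormal_zero (hu : IsT2Solution t₀ (fun _ => Vc) u) (ht₀ : 0 ≤ t₀) (hVc : 0 < Vc)
    (ht : t₀ < t) (θ x y : ℝ) :
    unitNormal u.metric 0 ![t, θ, x, y]
      = 2 * Real.sqrt (Vc / 3) * t * Real.exp (-u.lamHat Vc t θ / 4) := by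
  have ht' : 0 < t := ht₀.trans_lt ht
  have h1 : -(u.metric ![t, θ, x, y])⁻¹ 0 0
      = (2 * Real.sqrt (Vc / 3) * t * Real.exp (-u.lamHat Vc t θ / 4)) ^ 2 := by
    rw [hu.inv_apply ht₀ (by exact ht)]
    change -u.invComp 0 0 t θ = _
    have h2 : u.invComp 0 0 t θ = (u.coeff 0 t θ)⁻¹ := by
      simp [Fields.invComp, Fin.sum_univ_four, Fields.frame]
    have h3 : Real.exp (-u.lamHat Vc t θ / 4) ^ 2 = (Real.exp (u.lamHat Vc t θ / 2))⁻¹ := by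
      rw [← Real.exp_nat_mul, ← Real.exp_neg]; congr 1; push_cast; ring
    rw [h2, coeff_zero hVc ht', mul_pow, mul_pow, mul_pow, h3, Real.sq_sqrt (by positivity)]
    have := Real.exp_pos (u.lamHat Vc t θ / 2)
    field_simp
    norm_num
  rw [unitNormal, h1, Real.sqrt_sq (by positivity), sq, mul_div_assoc, div_self (by positivity),
    mul_one]

lemma secondFundamentalForm_apply (hu : IsT2Solution t₀ (fun _ => Vc) u) (ht₀ : 0 ≤ t₀)
    (hVc : 0 < Vc) (ht : t₀ < t) (θ x y : ℝ) (i j : Fin 3) :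
    secondFundamentalForm u.metric ![t, θ, x, y] i j
      = Real.sqrt (Vc / 3) * t * Real.exp (-u.lamHat Vc t θ / 4)
        * (u.rescaled Vc i j t θ + t * dt (u.rescaled Vc i j) t θ) := by
  have ht' : 0 < t := ht₀.trans_lt ht
  have hp : t₀ < (![t, θ, x, y] : Fin 4 → ℝ) 0 := ht
  rw [secondFundamentalForm_eq (hu.isMetricAt ht₀ hp) ?_ ?_ i j, hu.unitNormal_zero ht₀ hVc ht,
    hu.pd_metric ht₀ hp]
  · have h1 : dt (u.comp i.succ j.succ) t θ
        = u.rescaled Vc i j t θ + t * dt (u.rescaled Vc i j) t θ := by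
      rw [dt_congr (t₀ := t₀) (h := fun t θ => t * u.rescaled Vc i j t θ)
        (fun s hs => comp_eq_rescaled hVc (ht₀.trans_lt hs) θ i j) ht,
        dt_mul Sm.time (hu.sm_rescaled ht₀ hVc i j) ht,
        show dt (fun t _ => t) t θ = 1 from deriv_id t, one_mul]
    change _ * dt (u.comp i.succ j.succ) t θ = _
    rw [h1]
    ring
  · filter_upwards [eventually_mem hp] with q hq k
    rw [hu.metric_apply ht₀ hq]
    fin_cases k <;> simp [Fields.comp, Fin.sum_univ_four, Fields.coframe]
  · filter_upwards [eventually_mem hp] with q hq k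
    rw [hu.inv_apply ht₀ hq]
    fin_cases k <;> simp [Fields.invComp, Fin.sum_univ_four, Fields.frame]

end IsT2Solution

lemma limitMetric_apply (Vc α P Q G H : ℝ) (i j : Fin 3) :
    limitMetric Vc α P Q G H i j = 3 / (4 * Vc * α) * (![1, 0, 0] i * ![1, 0, 0] j)
      + Real.exp P * ((![G + Q * H, 1, Q] : Fin 3 → ℝ) i * (![G + Q * H, 1, Q] : Fin 3 → ℝ) j)
      + Real.exp (-P) * ((![H, 0, 1] : Fin 3 → ℝ) i * (![H, 0, 1] : Fin 3 → ℝ) j) := by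
  simp only [limitMetric, formSq, Matrix.add_apply, Matrix.smul_apply, Matrix.vecMulVec_apply,
    smul_eq_mul]

/-- The asymptotics of a solution, with all spatial derivatives; `e^{lim ℓ}` is the limit of
`t³ α`. -/
theorem IsT2Solution.asymptotics {t₀ T Vc : ℝ} {u : Fields}
    (hu : IsT2Solution t₀ (fun _ => Vc) u) (ht₀ : 0 ≤ t₀) (hVc : 0 < Vc)
    (hlam : HasLambdaAsymptotics t₀ Vc u) (hT : t₀ < T) (hT1 : 1 ≤ T) :
    ∃ αinf Pinf Qinf φinf Ginf Hinf : ℝ → ℝ,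
      (SmoothOnCircle αinf ∧ SmoothOnCircle Pinf ∧ SmoothOnCircle Qinf ∧
        SmoothOnCircle φinf ∧ SmoothOnCircle Ginf ∧ SmoothOnCircle Hinf) ∧
      (∀ θ, 0 < αinf θ) ∧
      (SmoothOrd t₀ T (-2) (dt u.P) ∧ SmoothOrd t₀ T (-2) (dt u.Q) ∧
        SmoothOrd t₀ T (-2) (dt u.φ)) ∧
      (SmoothOrd t₀ T (-1) (fun t θ => u.P t θ - Pinf θ) ∧
        SmoothOrd t₀ T (-1) (fun t θ => u.Q t θ - Qinf θ) ∧
        SmoothOrd t₀ T (-1) (fun t θ => u.φ t θ - φinf θ)) ∧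
      (SmoothOrd t₀ T (-2) (fun t θ => dt u.α t θ / u.α t θ + 3 / t) ∧
        SmoothOrd t₀ T (-2) (fun t θ => dt u.lam t θ + 3 / t)) ∧
      (SmoothOrd t₀ T (-1) (fun t θ => t ^ 3 * u.α t θ - αinf θ) ∧
        SmoothOrd t₀ T (-1)
          (fun t θ => u.lam t θ + 3 * Real.log t - 2 * Real.log (3 / (4 * Vc)))) ∧
      (SmoothOrd t₀ T (-(5 / 2)) (dt u.G) ∧ SmoothOrd t₀ T (-(5 / 2)) (dt u.H) ∧
        SmoothOrd t₀ T (-(3 / 2)) (fun t θ => u.G t θ - Ginf θ) ∧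
        SmoothOrd t₀ T (-(3 / 2)) (fun t θ => u.H t θ - Hinf θ)) ∧
      ∀ (i j : Fin 3) (x y : ℝ),
        SmoothOrd t₀ T (-1) (fun t θ => t⁻¹ * inducedMetric u.metric ![t, θ, x, y] i j
          - limitMetric Vc (αinf θ) (Pinf θ) (Qinf θ) (Ginf θ) (Hinf θ) i j) ∧
        SmoothOrd t₀ T (-1) (fun t θ => t⁻¹ * secondFundamentalForm u.metric ![t, θ, x, y] i j
          - Real.sqrt (Vc / 3)
            * limitMetric Vc (αinf θ) (Pinf θ) (Qinf θ) (Ginf θ) (Hinf θ) i j) := by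
  obtain ⟨J, K, h, hG, hH⟩ := hu.exists_normalizedSystem ht₀ hVc
  have hlam' : ∀ ε : ℝ, 0 < ε → ∃ T : ℝ, t₀ < T ∧ ∀ t θ : ℝ, T ≤ t → -ε ≤ u.lamHat Vc t θ := by
    intro ε hε
    obtain ⟨T, h1, h2⟩ := hlam ε hε
    refine ⟨T, h1, fun t θ ht => ?_⟩
    rw [Fields.lamHat]
    linarith [h2 t θ ht]
  obtain ⟨⟨oP, oQ, oφ, oℓ, oΛ⟩, dP, dQ, dφ, dℓ, dΛ⟩ := h.smoothOrd_dt hlam' hT hT1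
  have sP : Settles t₀ T u.P := ⟨oP, dP⟩
  have sQ : Settles t₀ T u.Q := ⟨oQ, dQ⟩
  have sℓ : Settles t₀ T u.ell := ⟨oℓ, dℓ⟩
  have sΛ : Settles t₀ T (u.lamHat Vc) := ⟨oΛ.mono hT1 (by norm_num), dΛ⟩
  have e21 : (-1 - 1 : ℝ) = -2 := by norm_num
  obtain ⟨Pinf, cP, lP⟩ := SmoothOrd.exists_limit ht₀ hT h.cylP one_pos (by rwa [e21])
  obtain ⟨Qinf, cQ, lQ⟩ := SmoothOrd.exists_limit ht₀ hT h.cylQ one_pos (by rwa [e21])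
  obtain ⟨φinf, cφ, lφ⟩ := SmoothOrd.exists_limit ht₀ hT h.cylφ one_pos (by rwa [e21])
  obtain ⟨ℓinf, cℓ, lℓ⟩ := SmoothOrd.exists_limit ht₀ hT h.cylℓ one_pos (by rwa [e21])
  have tP := lP.tendsto one_pos
  have tQ := lQ.tendsto one_pos
  have tℓ := lℓ.tendsto one_pos
  have tΛ : ∀ θ, Tendsto (fun t => u.lamHat Vc t θ) atTop (𝓝 0) := fun θ =>
    SmoothOrd.tendsto (g := fun _ => 0) one_pos (oΛ.congr hT fun t θ _ => sub_zero _) θ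
  -- the shift functions `G` and `H`
  have z : (0 : ℝ) + 0 ≤ 0 := by norm_num
  have z5 : (-(5 / 2) : ℝ) + 0 ≤ -(5 / 2) := by norm_num
  have oe : SmoothOrd t₀ T 0 fun t θ =>
      Real.exp (u.lamHat Vc t θ / 2) * Real.exp (-(u.ell t θ / 2)) := by
    have h1 := ((sΛ.const_mul ht₀ hT hT1 (1 / 2)).exp hT hT1).mul hT hT1
      ((sℓ.const_mul ht₀ hT hT1 (-(1 / 2))).exp hT hT1)
    refine h1.1.congr hT fun t θ _ => ?_
    congr 2 <;> ring
  have opow : SmoothOrd t₀ T (-(5 / 2)) fun t _ => 3 / (4 * Vc) * t ^ (-(5 / 2) : ℝ) :=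
    (SmoothOrd.rpow ht₀ hT _).const_mul ht₀ hT _
  have onP : SmoothOrd t₀ T 0 fun t θ => Real.exp (-u.P t θ) :=
    (((sP.const_mul ht₀ hT hT1 (-1)).exp hT hT1).1).congr hT fun t θ _ => by rw [neg_one_mul]
  have dH : SmoothOrd t₀ T (-(5 / 2)) (dt u.H) := by
    have hK : SmoothOrd t₀ T 0 fun t θ => K - u.Q t θ * J :=
      (SmoothOrd.const ht₀ hT K).sub ht₀ hT (oQ.mul hT hT1 (SmoothOrd.const ht₀ hT J) z)
    exact (opow.mul hT hT1 ((oe.mul hT hT1 (oP.exp hT hT1) z).mul hT hT1 hK z) z5).congr hT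
      fun t θ ht => hH t θ ht
  have dG : SmoothOrd t₀ T (-(5 / 2)) (dt u.G) := by
    refine ((opow.mul hT hT1 ((oe.mul hT hT1 onP z).mul hT hT1 (SmoothOrd.const ht₀ hT J) z)
      z5).sub ht₀ hT (oQ.mul hT hT1 dH (by norm_num))).congr hT fun t θ ht => ?_
    rw [← hG t θ ht, add_sub_cancel_right]
  have e25 : (-(3 / 2) - 1 : ℝ) = -(5 / 2) := by norm_num
  have h32 : (0 : ℝ) < 3 / 2 := by norm_num
  obtain ⟨Ginf, cG, lG⟩ := SmoothOrd.exists_limit ht₀ hT hu.smooth_G h32 (by rwa [e25])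
  obtain ⟨Hinf, cH, lH⟩ := SmoothOrd.exists_limit ht₀ hT hu.smooth_H h32 (by rwa [e25])
  have tG := lG.tendsto h32
  have tH := lH.tendsto h32
  have sG : Settles t₀ T u.G := ⟨SmoothOrd.of_dt_integrable ht₀ hT hT1 hu.smooth_G h32
    (by rwa [e25]), dG.mono hT1 (by norm_num)⟩
  have sH : Settles t₀ T u.H := ⟨SmoothOrd.of_dt_integrable ht₀ hT hT1 hu.smooth_H h32
    (by rwa [e25]), dH.mono hT1 (by norm_num)⟩
  -- the rescaled induced metric
  have sω : ∀ i : Fin 3, Settles t₀ T (u.coframe 2 i.succ) := by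
    intro i
    fin_cases i
    exacts [sG.add hT (sQ.mul hT hT1 sH), Settles.const ht₀ hT 1, sQ]
  have sη : ∀ i : Fin 3, Settles t₀ T (u.coframe 3 i.succ) := by
    intro i
    fin_cases i
    exacts [sH, Settles.const ht₀ hT 0, Settles.const ht₀ hT 1]
  have tω : ∀ (i : Fin 3) θ, Tendsto (fun t => u.coframe 2 i.succ t θ) atTop
      (𝓝 ((![Ginf θ + Qinf θ * Hinf θ, 1, Qinf θ] : Fin 3 → ℝ) i)) := by
    intro i θ
    fin_cases i
    exacts [(tG θ).add ((tQ θ).mul (tH θ)), tendsto_const_nhds, tQ θ]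
  have tη : ∀ (i : Fin 3) θ, Tendsto (fun t => u.coframe 3 i.succ t θ) atTop
      (𝓝 ((![Hinf θ, 0, 1] : Fin 3 → ℝ) i)) := by
    intro i θ
    fin_cases i
    exacts [tH θ, tendsto_const_nhds, tendsto_const_nhds]
  have sresc : ∀ i j, Settles t₀ T (u.rescaled Vc i j) := by
    intro i j
    have h1 := (((Settles.const ht₀ hT (3 / (4 * Vc))).mul hT hT1
      ((sΛ.const_mul ht₀ hT hT1 (1 / 2)).exp hT hT1)).mul hT hT1
      ((sℓ.const_mul ht₀ hT hT1 (-1)).exp hT hT1)).mul hT hT1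
      (Settles.const ht₀ hT ((![1, 0, 0] : Fin 3 → ℝ) i * (![1, 0, 0] : Fin 3 → ℝ) j))
    have h2 := (sP.exp hT hT1).mul hT hT1 ((sω i).mul hT hT1 (sω j))
    have h3 := ((sP.const_mul ht₀ hT hT1 (-1)).exp hT hT1).mul hT hT1
      ((sη i).mul hT hT1 (sη j))
    have h4 := (h1.add hT h2).add hT h3
    refine (congrArg (Settles t₀ T) (?_ : _ = u.rescaled Vc i j)).mp h4
    ext t θ
    rw [Fields.rescaled, neg_one_mul, neg_one_mul, one_div_mul_eq_div]
  have tresc : ∀ i j θ, Tendsto (fun t => u.rescaled Vc i j t θ) atTop (𝓝 (limitMetric Vc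
      (Real.exp (ℓinf θ)) (Pinf θ) (Qinf θ) (Ginf θ) (Hinf θ) i j)) := by
    intro i j θ
    rw [limitMetric_apply, show 3 / (4 * Vc * Real.exp (ℓinf θ))
      = 3 / (4 * Vc) * Real.exp (0 / 2) * Real.exp (-ℓinf θ) by
        rw [zero_div, Real.exp_zero, mul_one, Real.exp_neg, div_mul_eq_div_div, div_eq_mul_inv _
          (Real.exp _)]]
    exact (((((tΛ θ).div_const 2).rexp.const_mul _).mul (tℓ θ).neg.rexp).mul_const _).add
      ((tP θ).rexp.mul ((tω i θ).mul (tω j θ))) |>.add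
      ((tP θ).neg.rexp.mul ((tη i θ).mul (tη j θ)))
  have lresc := fun i j => (sresc i j).of_tendsto ht₀ hT (tresc i j)
  have sE : Settles t₀ T fun t θ => Real.exp (-u.lamHat Vc t θ / 4) := by
    have h1 := (sΛ.const_mul ht₀ hT hT1 (-(1 / 4))).exp hT hT1
    refine (congrArg (Settles t₀ T) (?_ : _ = fun t θ => Real.exp (-u.lamHat Vc t θ / 4))).mp h1
    ext t θ
    congr 1; ring
  have lE : SmoothOrd t₀ T (-1) fun t θ => Real.exp (-u.lamHat Vc t θ / 4) - 1 :=
    sE.of_tendsto ht₀ hT (g := fun _ => 1) fun θ => by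
      simpa using ((tΛ θ).neg.div_const 4).rexp
  have hpos : ∀ {t}, t₀ < t → 0 < t := fun ht => ht₀.trans_lt ht
  have hexpℓ : ∀ t θ, t₀ < t → Real.exp (u.ell t θ) = t ^ 3 * u.α t θ := by
    intro t θ ht
    rw [Fields.ell, Real.exp_add, Real.exp_log (hu.α_pos t θ ht), ← Real.exp_log (hpos ht),
      ← Real.exp_nat_mul, Real.log_exp]
    norm_num
  have hlog : ∀ t, t₀ < t → HasDerivAt (fun t => 3 * Real.log t) (3 / t) t := fun t ht => by
    simpa [div_eq_mul_inv] using (Real.hasDerivAt_log (hpos ht).ne').const_mul 3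
  have cα : SmoothOnCircle fun θ => Real.exp (ℓinf θ) :=
    ⟨cℓ.1.exp, fun θ => by simp only [cℓ.2 θ]⟩
  refine ⟨fun θ => Real.exp (ℓinf θ), Pinf, Qinf, φinf, Ginf, Hinf, ⟨cα, cP, cQ, cφ, cG, cH⟩,
    fun θ => Real.exp_pos _, ⟨dP, dQ, dφ⟩, ⟨lP, lQ, lφ⟩, ⟨?_, ?_⟩, ⟨?_, oΛ⟩, ⟨dG, dH, lG, lH⟩,
    fun i j x y => ⟨?_, ?_⟩⟩
  · refine dℓ.congr hT fun t θ ht => ?_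
    rw [add_comm]
    exact ((hlog t ht).add ((hu.smα.hasDerivAt_t ht θ).log (hu.α_pos t θ ht).ne')).deriv.symm
  · refine dΛ.congr hT fun t θ ht => ?_
    exact (((hu.smlam.hasDerivAt_t ht θ).add (hlog t ht)).sub_const _).deriv.symm
  · refine ((sℓ.exp hT hT1).of_tendsto ht₀ hT fun θ => (tℓ θ).rexp).congr hT fun t θ ht => ?_
    rw [hexpℓ t θ ht]
  · refine (lresc i j).congr hT fun t θ ht => ?_
    rw [hu.inducedMetric_apply ht₀ hVc ht, inv_mul_cancel_left₀ (hpos ht).ne']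
  · have h1 : SmoothOrd t₀ T (-1) fun t θ => t ^ (1 : ℝ) * dt (u.rescaled Vc i j) t θ :=
      (SmoothOrd.rpow ht₀ hT 1).mul hT hT1 (sresc i j).2 (by norm_num)
    have h2 := ((lE.mul hT hT1 (sresc i j).1 (by norm_num : (-1 : ℝ) + 0 ≤ -1)).add hT
      (sE.1.mul hT hT1 h1 (by norm_num : (0 : ℝ) + -1 ≤ -1))).add hT (lresc i j)
    refine (h2.const_mul ht₀ hT (Real.sqrt (Vc / 3))).congr hT fun t θ ht => ?_
    have ht' := (hpos ht).ne'
    rw [hu.secondFundamentalForm_apply ht₀ hVc ht, Real.rpow_one]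
    field_simp
    ring

/-! ### Sums of norms -/

lemma add_le_ofReal {x y : ℝ≥0∞} {a b s : ℝ} (ha : 0 ≤ a) (hb : 0 ≤ b) (hs : 0 ≤ s)
    (hx : x ≤ ENNReal.ofReal (a * s)) (hy : y ≤ ENNReal.ofReal (b * s)) :
    x + y ≤ ENNReal.ofReal ((a + b) * s) := by
  rw [add_mul, ENNReal.ofReal_add (by positivity) (by positivity)]
  exact add_le_add hx hy

end T2Sym

theorem mainTheorem2 (t₀ Vc : ℝ) (ht₀ : 0 ≤ t₀) (hVc : 0 < Vc) (u : T2Sym.Fields)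
    (hu : T2Sym.IsT2Solution t₀ (fun _ => Vc) u)
    (hlam : T2Sym.HasLambdaAsymptotics t₀ Vc u) :
    ∃ αinf Pinf Qinf φinf Ginf Hinf : ℝ → ℝ,
      (T2Sym.SmoothOnCircle αinf ∧ T2Sym.SmoothOnCircle Pinf ∧ T2Sym.SmoothOnCircle Qinf ∧
        T2Sym.SmoothOnCircle φinf ∧ T2Sym.SmoothOnCircle Ginf ∧ T2Sym.SmoothOnCircle Hinf) ∧
      (∀ θ, 0 < αinf θ) ∧
      ∀ N : ℕ, ∃ C : ℝ, ∀ t : ℝ, t₀ + 2 ≤ t →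
        T2Sym.cNorm N (T2Sym.dt u.P t) + T2Sym.cNorm N (T2Sym.dt u.Q t)
            + T2Sym.cNorm N (T2Sym.dt u.φ t)
          ≤ ENNReal.ofReal (C * t ^ (-2 : ℝ)) ∧
        T2Sym.cNorm N (fun θ => u.P t θ - Pinf θ) + T2Sym.cNorm N (fun θ => u.Q t θ - Qinf θ)
            + T2Sym.cNorm N (fun θ => u.φ t θ - φinf θ)
          ≤ ENNReal.ofReal (C * t ^ (-1 : ℝ)) ∧
        T2Sym.cNorm N (fun θ => T2Sym.dt u.α t θ / u.α t θ + 3 / t)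
            + T2Sym.cNorm N (fun θ => T2Sym.dt u.lam t θ + 3 / t)
          ≤ ENNReal.ofReal (C * t ^ (-2 : ℝ)) ∧
        T2Sym.cNorm N (fun θ => t ^ 3 * u.α t θ - αinf θ)
            + T2Sym.cNorm N
              (fun θ => u.lam t θ + 3 * Real.log t - 2 * Real.log (3 / (4 * Vc)))
          ≤ ENNReal.ofReal (C * t ^ (-1 : ℝ)) ∧
        ENNReal.ofReal t * T2Sym.cNorm N (T2Sym.dt u.G t)
            + ENNReal.ofReal t * T2Sym.cNorm N (T2Sym.dt u.H t)
            + T2Sym.cNorm N (fun θ => u.G t θ - Ginf θ)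
            + T2Sym.cNorm N (fun θ => u.H t θ - Hinf θ)
          ≤ ENNReal.ofReal (C * t ^ (-(3 / 2) : ℝ)) ∧
        ∀ (i j : Fin 3) (x y : ℝ),
          T2Sym.cNorm N (fun θ => t⁻¹ * T2Sym.inducedMetric u.metric ![t, θ, x, y] i j
              - T2Sym.limitMetric Vc (αinf θ) (Pinf θ) (Qinf θ) (Ginf θ) (Hinf θ) i j)
            + T2Sym.cNorm N (fun θ => t⁻¹ * T2Sym.secondFundamentalForm u.metric ![t, θ, x, y] i j
              - Real.sqrt (Vc / 3)
                * T2Sym.limitMetric Vc (αinf θ) (Pinf θ) (Qinf θ) (Ginf θ) (Hinf θ) i j)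
            ≤ ENNReal.ofReal (C * t ^ (-1 : ℝ)) := by
  have hT : t₀ < t₀ + 2 := by linarith
  obtain ⟨αinf, Pinf, Qinf, φinf, Ginf, Hinf, hsm, hpos, ⟨dP, dQ, dφ⟩, ⟨lP, lQ, lφ⟩, ⟨dα, dl⟩,
    ⟨lα, ll⟩, ⟨dG, dH, lG, lH⟩, hgk⟩ := hu.asymptotics ht₀ hVc hlam hT (by linarith)
  refine ⟨αinf, Pinf, Qinf, φinf, Ginf, Hinf, hsm, hpos, fun N => ?_⟩
  have hT0 : 0 < t₀ + 2 := by linarith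
  obtain ⟨a₁, ha₁, b₁⟩ := dP.cNorm_le hT0 N
  obtain ⟨a₂, ha₂, b₂⟩ := dQ.cNorm_le hT0 N
  obtain ⟨a₃, ha₃, b₃⟩ := dφ.cNorm_le hT0 N
  obtain ⟨a₄, ha₄, b₄⟩ := lP.cNorm_le hT0 N
  obtain ⟨a₅, ha₅, b₅⟩ := lQ.cNorm_le hT0 N
  obtain ⟨a₆, ha₆, b₆⟩ := lφ.cNorm_le hT0 N
  obtain ⟨a₇, ha₇, b₇⟩ := dα.cNorm_le hT0 N
  obtain ⟨a₈, ha₈, b₈⟩ := dl.cNorm_le hT0 N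
  obtain ⟨a₉, ha₉, b₉⟩ := lα.cNorm_le hT0 N
  obtain ⟨a₁₀, ha₁₀, b₁₀⟩ := ll.cNorm_le hT0 N
  obtain ⟨a₁₁, ha₁₁, b₁₁⟩ := dG.cNorm_le hT0 N
  obtain ⟨a₁₂, ha₁₂, b₁₂⟩ := dH.cNorm_le hT0 N
  obtain ⟨a₁₃, ha₁₃, b₁₃⟩ := lG.cNorm_le hT0 N
  obtain ⟨a₁₄, ha₁₄, b₁₄⟩ := lH.cNorm_le hT0 N
  -- the components of the metric do not depend on `x` and `y`
  have hgk0 : ∀ i j : Fin 3, ∃ a, 0 ≤ a ∧ ∀ t x y : ℝ, t₀ + 2 ≤ t →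
      T2Sym.cNorm N (fun θ => t⁻¹ * T2Sym.inducedMetric u.metric ![t, θ, x, y] i j
          - T2Sym.limitMetric Vc (αinf θ) (Pinf θ) (Qinf θ) (Ginf θ) (Hinf θ) i j)
        + T2Sym.cNorm N (fun θ => t⁻¹ * T2Sym.secondFundamentalForm u.metric ![t, θ, x, y] i j
          - Real.sqrt (Vc / 3)
            * T2Sym.limitMetric Vc (αinf θ) (Pinf θ) (Qinf θ) (Ginf θ) (Hinf θ) i j)
        ≤ ENNReal.ofReal (a * t ^ (-1 : ℝ)) := by
    intro i j
    obtain ⟨a, ha, b⟩ := (hgk i j 0 0).1.cNorm_le hT0 N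
    obtain ⟨a', ha', b'⟩ := (hgk i j 0 0).2.cNorm_le hT0 N
    refine ⟨a + a', add_nonneg ha ha', fun t x y ht => ?_⟩
    have h1 := T2Sym.add_le_ofReal ha ha' (Real.rpow_nonneg (hT0.le.trans ht) _) (b t ht) (b' t ht)
    have hI : ∀ θ, T2Sym.inducedMetric u.metric ![t, θ, x, y] i j
        = T2Sym.inducedMetric u.metric ![t, θ, 0, 0] i j := fun θ => by
      rw [hu.inducedMetric_apply ht₀ hVc (hT.trans_le ht),
        hu.inducedMetric_apply ht₀ hVc (hT.trans_le ht)]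
    have hK : ∀ θ, T2Sym.secondFundamentalForm u.metric ![t, θ, x, y] i j
        = T2Sym.secondFundamentalForm u.metric ![t, θ, 0, 0] i j := fun θ => by
      rw [hu.secondFundamentalForm_apply ht₀ hVc (hT.trans_le ht),
        hu.secondFundamentalForm_apply ht₀ hVc (hT.trans_le ht)]
    simpa only [hI, hK] using h1
  choose a ha b using hgk0
  have hsum : 0 ≤ ∑ i, ∑ j, a i j := Finset.sum_nonneg fun i _ => Finset.sum_nonneg fun j _ => ha i j
  refine ⟨a₁ + a₂ + a₃ + (a₄ + a₅ + a₆) + (a₇ + a₈) + (a₉ + a₁₀) + (a₁₁ + a₁₂ + a₁₃ + a₁₄)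
    + ∑ i, ∑ j, a i j, fun t ht => ?_⟩
  have ht' : 0 < t := hT0.trans_le ht
  have hp : ∀ r : ℝ, 0 ≤ t ^ r := fun r => Real.rpow_nonneg ht'.le r
  have hmono : ∀ {c c' : ℝ} (r : ℝ), c ≤ c' →
      ENNReal.ofReal (c * t ^ r) ≤ ENNReal.ofReal (c' * t ^ r) := fun r h =>
    ENNReal.ofReal_le_ofReal (mul_le_mul_of_nonneg_right h (hp r))
  have hshift : ∀ {x : ℝ≥0∞} {c : ℝ}, 0 ≤ c → x ≤ ENNReal.ofReal (c * t ^ (-(5 / 2) : ℝ)) →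
      ENNReal.ofReal t * x ≤ ENNReal.ofReal (c * t ^ (-(3 / 2) : ℝ)) := by
    intro x c hc hx
    have e : c * t ^ (-(3 / 2) : ℝ) = t * (c * t ^ (-(5 / 2) : ℝ)) := by
      rw [mul_left_comm, ← Real.rpow_one_add' ht'.le (by norm_num)]
      norm_num
    rw [e, ENNReal.ofReal_mul ht'.le]
    exact mul_le_mul_right hx _
  refine ⟨?_, ?_, ?_, ?_, ?_, fun i j x y => ?_⟩
  · exact (T2Sym.add_le_ofReal (add_nonneg ha₁ ha₂) ha₃ (hp _)
      (T2Sym.add_le_ofReal ha₁ ha₂ (hp _) (b₁ t ht) (b₂ t ht)) (b₃ t ht)).trans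
      (hmono _ (by linarith))
  · exact (T2Sym.add_le_ofReal (add_nonneg ha₄ ha₅) ha₆ (hp _)
      (T2Sym.add_le_ofReal ha₄ ha₅ (hp _) (b₄ t ht) (b₅ t ht)) (b₆ t ht)).trans
      (hmono _ (by linarith))
  · exact (T2Sym.add_le_ofReal ha₇ ha₈ (hp _) (b₇ t ht) (b₈ t ht)).trans (hmono _ (by linarith))
  · exact (T2Sym.add_le_ofReal ha₉ ha₁₀ (hp _) (b₉ t ht) (b₁₀ t ht)).trans
      (hmono _ (by linarith))
  · exact (T2Sym.add_le_ofReal (add_nonneg (add_nonneg ha₁₁ ha₁₂) ha₁₃) ha₁₄ (hp _)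
      (T2Sym.add_le_ofReal (add_nonneg ha₁₁ ha₁₂) ha₁₃ (hp _)
        (T2Sym.add_le_ofReal ha₁₁ ha₁₂ (hp _) (hshift ha₁₁ (b₁₁ t ht)) (hshift ha₁₂ (b₁₂ t ht)))
        (b₁₃ t ht)) (b₁₄ t ht)).trans (hmono _ (by linarith))
  · refine (b i j t x y ht).trans (hmono _ ?_)
    have h1 : a i j ≤ ∑ i, ∑ j, a i j :=
      (Finset.single_le_sum (fun j _ => ha i j) (Finset.mem_univ j)).trans
        (Finset.single_le_sum (f := fun i => ∑ j, a i j)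
          (fun i _ => Finset.sum_nonneg fun j _ => ha i j) (Finset.mem_univ i))
    linarith
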